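/- Let $N=\{1,\dots,n\}$ be a set of players. An embedded coalition is a pair $(S,P)$ with $P$ a partition of $N$ and $S\in P$; a game is a function $g$ assigning a number $g(S,P)$ to every embedded coalition. The McQuillin (MQ) value of player $i$ in $g$ is \[ MQ_i(g)=\sum_{(S,P),\ |P|\le 2}\zeta^i_S\, g(S,P),\qquad \zeta^i_S=\begin{cases}\frac{(|S|-1)!\,(n-|S|)!}{n!}& i\in S,\\ -\frac{|S|!\,(n-|S|-1)!}{n!}& i\notin S.\end{cases}\] An MC-nets rule $\alpha\to c$ consists of a number $c$ (the weight) and a conjunction $\alpha$ of at least one positive literal and of negative literals over $N$, no player occurring both positively and negatively; a coalition satisfies $\alpha$ if it contains all positive and no negative literals. A weighted MC-nets rule is an expression \[ (\alpha^1_1\to c^1_1)\cdots(\alpha^1_{k_1}\to c^1_{k_1})\mid\cdots\mid(\alpha^m_1\to c^m_1)\cdots(\alpha^m_{k_m}\to c^m_{k_m}),\qquad m,k_1,\dots,k_m\ge 1,\] of MC-nets rules; a partition $P$ satisfies it if $P=P_1\,\dot\cup\cdots\dot\cup\,P_m$ for disjoint sets $P_j$ such that every $\alpha^j_l$ is satisfied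 by some coalition in $P_j$. A finite list $\Gamma$ of weighted MC-nets rules represents the game $g^\Gamma$ in which $g^\Gamma(S,P)$ is the sum of the weights of all MC-nets rules that $S$ satisfies in all weighted MC-nets rules of $\Gamma$ that $P$ satisfies. The size of $\Gamma$ is the number of literals plus the number of weights. Theorem. For games represented as weighted MC-nets, the MQ-value can be computed in polynomial time. Precisely, there are a single random access machine program and a polynomial $p$ such that, given $n$, $\Gamma$ and a player $i$, the program halts with output $MQ_i(g^\Gamma)$, and (1) for real weights, its running time is at most $p(n+\mathrm{size}(\Gamma))$, where operations on natural numbers have logarithmic cost (the bit lengths of the numbers involved) and each of the operations $+,-,\times,/$ on real numbers has cost one; (2) for rational weights, its running time is at most $p(n+\mathrm{bitsize}(\Gamma))$, where the cost of all operations is measured by the bit lengths of the numbers involved, and $\mathrm{bitsize}(\Gamma)$ is the number of literals plus the total bit length of the numerators and denominators of the weights. -/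

import Mathlib

namespace MCNets

/-! ### Games with externalities and the McQuillin value -/

/-- Embedded coalitions: a partition `P` of the players `Fin n` with one of its blocks `S`. -/
abbrev EmbeddedCoalition (n : ℕ) : Type :=
  (P : Finpartition (Finset.univ : Finset (Fin n))) × {S : Finset (Fin n) // S ∈ P.parts}

/-- Games in partition function form. -/
abbrev Game (n : ℕ) (K : Type) : Type := EmbeddedCoalition n → K

/-- The coefficient of coalition `S` in the Shapley value of player `i`. -/
def shapleyCoeff {n : ℕ} (K : Type) [Field K] (i : Fin n) (S : Finset (Fin n)) : K :=
  if i ∈ S then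
    ((S.card - 1).factorial : K) * ((n - S.card).factorial : K) / (n.factorial : K)
  else
    -((S.card.factorial : K) * ((n - S.card - 1).factorial : K) / (n.factorial : K))

/-- The McQuillin extension of the Shapley value: only partitions into at most two blocks count. -/
def mqValue {n : ℕ} {K : Type} [Field K] (g : Game n K) (i : Fin n) : K :=
  ∑ e : EmbeddedCoalition n,
    (shapleyCoeff K i e.2.1 * (if e.1.parts.card ≤ 2 then 1 else 0)) * g e

/-! ### Weighted MC-nets -/

/-- Conjunctions of positive literals (at least one) and negative literals,
no player occurring both positively and negatively. -/
structure Conj (n : ℕ) where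
  pos : List (Fin n)
  neg : List (Fin n)
  pos_ne_nil : pos ≠ []
  disjoint : ∀ a ∈ pos, a ∉ neg

/-- A coalition satisfies a conjunction if it contains all positive literals and no negative one. -/
def Conj.SatisfiedBy {n : ℕ} (α : Conj n) (S : Finset (Fin n)) : Prop :=
  (∀ a ∈ α.pos, a ∈ S) ∧ ∀ a ∈ α.neg, a ∉ S

/-- MC-nets rules `α → c`. -/
structure MCRule (n : ℕ) (K : Type) where
  expr : Conj n
  weight : K

/-- Weighted MC-nets rules
`(α₁¹ → c₁¹) … | … | (α₁ᵐ → c₁ᵐ) …`, as the list of the groups that the bars separate. -/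
structure WeightedRule (n : ℕ) (K : Type) where
  groups : List (List (MCRule n K))
  groups_ne_nil : groups ≠ []
  group_ne_nil : ∀ G ∈ groups, G ≠ []

/-- `P` satisfies a weighted rule with `m` groups if it is the union of `m` disjoint subsets
`P₁, …, Pₘ` such that each expression in group `j` is satisfied by some coalition in `Pⱼ`. -/
def WeightedRule.SatisfiedBy {n : ℕ} {K : Type} (γ : WeightedRule n K)
    (P : Finpartition (Finset.univ : Finset (Fin n))) : Prop :=
  ∃ Q : Fin γ.groups.length → Finset (Finset (Fin n)),
    (∀ j j', j ≠ j' → Disjoint (Q j) (Q j')) ∧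
    Finset.univ.biUnion Q = P.parts ∧
    ∀ j, ∀ r ∈ γ.groups.get j, ∃ T ∈ Q j, r.expr.SatisfiedBy T

open Classical in
/-- The game represented by the rules `Γ`: the value of `(S, P)` is the sum of the weights of the
MC-nets rules satisfied by `S`, in all the weighted rules satisfied by `P`. -/
noncomputable def game {n : ℕ} {K : Type} [Field K] (Γ : List (WeightedRule n K)) : Game n K :=
  fun e =>
    (Γ.map fun γ =>
      if γ.SatisfiedBy e.1 then
        (γ.groups.flatten.map fun r => if r.expr.SatisfiedBy e.2.1 then r.weight else 0).sum
      else 0).sum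

/-- The size of a representation: the number of literals, plus every weight `c` counted `sz c`
times. With `sz = 1` it is the number of literals plus the number of weights. -/
def size {n : ℕ} {K : Type} (sz : K → ℕ) (Γ : List (WeightedRule n K)) : ℕ :=
  (Γ.map fun γ =>
    (γ.groups.flatten.map fun r =>
      r.expr.pos.length + r.expr.neg.length + sz r.weight).sum).sum

/-- The number of bits of the numerator and of the denominator of a rational number. -/
def ratBits (q : ℚ) : ℕ := q.num.natAbs.size + q.den.size

/-! ### Random access machines with logarithmic cost

A machine has registers and a memory for natural numbers, where the cost of an operation is the bit
length of the numbers involved, and a second memory for elements of a field `K`, with the field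
operations, whose cost is measured by a function `sz : K → ℕ`. With `K = ℝ` and `sz = 1` this is
the real RAM (a field operation costs one step; there is no rounding, and no test of a field element
at all); with `K = ℚ` and `sz = ratBits` all costs are bit costs. -/

/-- Configurations of the machine. -/
structure State (K : Type) where
  /-- the registers -/
  reg : ℕ → ℕ
  /-- the memory for natural numbers -/
  mem : ℕ → ℕ
  /-- the memory for field elements -/
  num : ℕ → K

/-- Expressions for natural numbers. Subtraction is truncated, division rounds down. -/
inductive NExpr : Type
  | const (c : ℕ)
  | reg (r : ℕ)
  | load (addr : NExpr)
  | add (a b : NExpr)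
  | sub (a b : NExpr)
  | mul (a b : NExpr)
  | div (a b : NExpr)

/-- The value of an expression. -/
def NExpr.eval {K : Type} (s : State K) : NExpr → ℕ
  | .const c => c
  | .reg r => s.reg r
  | .load a => s.mem (a.eval s)
  | .add a b => a.eval s + b.eval s
  | .sub a b => a.eval s - b.eval s
  | .mul a b => a.eval s * b.eval s
  | .div a b => a.eval s / b.eval s

/-- The cost of an evaluation: one plus the bit length of the value, for each subexpression
(so the operands and the memory addresses are charged too). -/
def NExpr.cost {K : Type} (s : State K) : NExpr → ℕ
  | .const c => c.size + 1
  | .reg r => (s.reg r).size + 1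
  | .load a => a.cost s + (s.mem (a.eval s)).size + 1
  | .add a b => a.cost s + b.cost s + (a.eval s + b.eval s).size + 1
  | .sub a b => a.cost s + b.cost s + (a.eval s - b.eval s).size + 1
  | .mul a b => a.cost s + b.cost s + (a.eval s * b.eval s).size + 1
  | .div a b => a.cost s + b.cost s + (a.eval s / b.eval s).size + 1

/-- Expressions for field elements. -/
inductive KExpr : Type
  | ofNat (e : NExpr)
  | load (addr : NExpr)
  | add (a b : KExpr)
  | sub (a b : KExpr)
  | mul (a b : KExpr)
  | div (a b : KExpr)

/-- The value of an expression. -/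
def KExpr.eval {K : Type} [Field K] (s : State K) : KExpr → K
  | .ofNat e => (e.eval s : K)
  | .load e => s.num (e.eval s)
  | .add a b => a.eval s + b.eval s
  | .sub a b => a.eval s - b.eval s
  | .mul a b => a.eval s * b.eval s
  | .div a b => a.eval s / b.eval s

/-- The cost of an evaluation: one plus the size of the value, for each subexpression. -/
def KExpr.cost {K : Type} [Field K] (sz : K → ℕ) (s : State K) : KExpr → ℕ
  | .ofNat e => e.cost s + sz (e.eval s : K) + 1
  | .load e => e.cost s + sz (s.num (e.eval s)) + 1
  | .add a b => a.cost sz s + b.cost sz s + sz (a.eval s + b.eval s) + 1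
  | .sub a b => a.cost sz s + b.cost sz s + sz (a.eval s - b.eval s) + 1
  | .mul a b => a.cost sz s + b.cost sz s + sz (a.eval s * b.eval s) + 1
  | .div a b => a.cost sz s + b.cost sz s + sz (a.eval s / b.eval s) + 1

/-- Programs. A test `e` succeeds if the value of `e` is not zero. -/
inductive Program : Type
  | skip
  | setReg (r : ℕ) (e : NExpr)
  | setMem (addr e : NExpr)
  | setNum (addr : NExpr) (e : KExpr)
  | seq (c d : Program)
  | ite (e : NExpr) (c d : Program)
  | while (e : NExpr) (c : Program)

/-- `Exec sz c s s' t`: the program `c`, started in `s`, halts in `s'`, and the run costs `t`. -/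
inductive Exec {K : Type} [Field K] (sz : K → ℕ) :
    Program → State K → State K → ℕ → Prop
  | skip (s : State K) : Exec sz .skip s s 1
  | setReg (r : ℕ) (e : NExpr) (s : State K) :
      Exec sz (.setReg r e) s { s with reg := Function.update s.reg r (e.eval s) } (e.cost s + 1)
  | setMem (a e : NExpr) (s : State K) :
      Exec sz (.setMem a e) s { s with mem := Function.update s.mem (a.eval s) (e.eval s) }
        (a.cost s + e.cost s + 1)
  | setNum (a : NExpr) (e : KExpr) (s : State K) :
      Exec sz (.setNum a e) s { s with num := Function.update s.num (a.eval s) (e.eval s) }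
        (a.cost s + e.cost sz s + 1)
  | seq {c d : Program} {s s' s'' : State K} {t t' : ℕ} :
      Exec sz c s s' t → Exec sz d s' s'' t' → Exec sz (.seq c d) s s'' (t + t')
  | iteTrue {e : NExpr} {c d : Program} {s s' : State K} {t : ℕ} :
      e.eval s ≠ 0 → Exec sz c s s' t → Exec sz (.ite e c d) s s' (e.cost s + t + 1)
  | iteFalse {e : NExpr} {c d : Program} {s s' : State K} {t : ℕ} :
      e.eval s = 0 → Exec sz d s s' t → Exec sz (.ite e c d) s s' (e.cost s + t + 1)
  | whileTrue {e : NExpr} {c : Program} {s s' s'' : State K} {t t' : ℕ} :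
      e.eval s ≠ 0 → Exec sz c s s' t → Exec sz (.while e c) s' s'' t' →
      Exec sz (.while e c) s s'' (e.cost s + t + t' + 1)
  | whileFalse {e : NExpr} {c : Program} {s : State K} :
      e.eval s = 0 → Exec sz (.while e c) s s (e.cost s + 1)

/-! ### The input -/

/-- A list of blocks, written as the number of blocks followed by the blocks. -/
def encodeBlocks (l : List (List ℕ)) : List ℕ := l.length :: l.flatten

/-- Literals are written as lists of player numbers, preceded by their length. -/
def Conj.encode {n : ℕ} (α : Conj n) : List ℕ :=
  encodeBlocks (α.pos.map fun a => [a.val]) ++ encodeBlocks (α.neg.map fun a => [a.val])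

/-- The code of a rule, without its weights. -/
def WeightedRule.encode {n : ℕ} {K : Type} (γ : WeightedRule n K) : List ℕ :=
  encodeBlocks (γ.groups.map fun G => encodeBlocks (G.map fun r => r.expr.encode))

/-- The weights of the rules, in their order of occurrence. -/
def weights {n : ℕ} {K : Type} (Γ : List (WeightedRule n K)) : List K :=
  (Γ.map fun γ => γ.groups.flatten.map fun r => r.weight).flatten

/-- The initial configuration on the input `(Γ, i)`: the memory holds the number `n` of players,
the player `i` and the code of the rules; the cells `1, 2, …` of the memory for field elements hold
the weights; all else is zero. -/
def inputState {n : ℕ} {K : Type} [Field K] (Γ : List (WeightedRule n K)) (i : Fin n) : State K where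
  reg := fun _ => 0
  mem := fun a => (n :: i.val :: encodeBlocks (Γ.map fun γ => γ.encode)).getD a 0
  num := fun a => (0 :: weights Γ).getD a 0

/-- The program `c`, on the input `(Γ, i)`, halts with the MQ-value of player `i` in the game
represented by `Γ` in cell `0` of the memory for field elements, at a cost of at most `t`. -/
def ComputesMQ {n : ℕ} {K : Type} [Field K] (sz : K → ℕ) (c : Program)
    (Γ : List (WeightedRule n K)) (i : Fin n) (t : ℕ) : Prop :=
  ∃ (s : State K) (t' : ℕ),
    Exec sz c (inputState Γ i) s t' ∧ s.num 0 = mqValue (game Γ) i ∧ t' ≤ t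

end MCNets

/-! Only partitions into at most two blocks matter. Such a partition consists of `S` and, if
nonempty, `Sᶜ`, so it is determined by one block `S`. The value is thus a sum over coalitions, and
by linearity a sum over rules `r`: the weight of `r` times the sum of the Shapley coefficients of
those `S` that satisfy `r` and whose pair `S`, `Sᶜ` satisfies the weighted rule containing `r`
(`mqValue_game`). The coefficient depends only on `|S|` and on whether `i ∈ S`. So it suffices to
count, for each rule and each of the two cases, the admissible coalitions of every size.

Every conjunction has a positive literal, so every group needs a block of its own and at most two
groups are possible. With two groups, the fact that `S` satisfies `r` decides which group belongs to
`S` and which to `Sᶜ`. With one group, every conjunction must hold in `S` or in `Sᶜ`: its positive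
literals lie on one side and its negative ones on the other. All conditions are therefore equations
`f u ^^ f v = e` between Boolean variables, one for each player and one extra variable `n` that is
always true (`WeightedRule.satisfiedByPair_iff`, `MCRule.compatible_iff`).

Such a system is kept in solved form by a table of representatives and parities
(`Links.WF.sol_union`). A solution is a free choice of one bit per class, up to the condition on
`n`, so the polynomial `∑ x ^ |S|` over the solutions is a product over the classes of sums of two
terms (`genFun_eq`). It is evaluated at `x = 2 ^ (n + 1)`, which exceeds all its coefficients, so
that the counts are the digits of one number (`sum_digits_mod`).

For the running time, `Runs` is a Hoare triple with a step count and a bound `W` on all bit lengths.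
With `X` the number of players plus the size plus one, all natural numbers stay below `O(X ^ 3)`
bits. The accumulated field element grows by an additive amount per rule, because the division by
`n!` is left to the very end. Both cost measures are instances of `CostModel`, so a single analysis
covers real and rational weights. -/

namespace MCNets

/-! ### Reduction of the MQ-value to sums over coalitions, rule by rule. -/

section Semantics

variable {n : ℕ}

theorem Conj.SatisfiedBy.nonempty {α : Conj n} {S : Finset (Fin n)} (h : α.SatisfiedBy S) :
    S.Nonempty := by
  obtain ⟨a, l, hl⟩ := List.exists_cons_of_ne_nil α.pos_ne_nil
  exact ⟨a, h.1 a (by simp [hl])⟩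

/-- A positive literal cannot lie on both sides. This is what later fixes the orientation of a
two-group rule. -/
theorem Conj.SatisfiedBy.not_compl {α : Conj n} {S : Finset (Fin n)} (h : α.SatisfiedBy S) :
    ¬ α.SatisfiedBy Sᶜ := by
  obtain ⟨a, l, hl⟩ := List.exists_cons_of_ne_nil α.pos_ne_nil
  intro h'
  have h1 := h.1 a (by simp [hl])
  have h2 := h'.1 a (by simp [hl])
  simp [h1] at h2

/-- The partition into `S` and its complement satisfies the weighted rule `γ`. -/
def WeightedRule.SatisfiedByPair {K : Type} (γ : WeightedRule n K) (S : Finset (Fin n)) : Prop :=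
  (∃ G, γ.groups = [G] ∧ ∀ r ∈ G, r.expr.SatisfiedBy S ∨ r.expr.SatisfiedBy Sᶜ) ∨
  ∃ G₁ G₂, γ.groups = [G₁, G₂] ∧
    (((∀ r ∈ G₁, r.expr.SatisfiedBy S) ∧ ∀ r ∈ G₂, r.expr.SatisfiedBy Sᶜ) ∨
      ((∀ r ∈ G₁, r.expr.SatisfiedBy Sᶜ) ∧ ∀ r ∈ G₂, r.expr.SatisfiedBy S))

/-- Each group is nonempty and its rules need a block, so the sets `Q j` are disjoint and nonempty;
with only `S` and `Sᶜ` available, three groups are impossible, and two groups receive one block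
each. The hypothesis `hP` also covers the case `Sᶜ = ∅`, where the partition has a single block. -/
theorem WeightedRule.satisfiedBy_iff_pair {K : Type} (γ : WeightedRule n K)
    (P : Finpartition (Finset.univ : Finset (Fin n))) (S : Finset (Fin n)) (hS : S ≠ ∅)
    (hP : ∀ T, T ∈ P.parts ↔ T ≠ ∅ ∧ (T = S ∨ T = Sᶜ)) :
    γ.SatisfiedBy P ↔ γ.SatisfiedByPair S := by
  obtain ⟨groups, hne, hG⟩ := γ
  have hSc : S ≠ Sᶜ := by
    intro h
    obtain ⟨a, ha⟩ := Finset.nonempty_iff_ne_empty.2 hS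
    have h' : a ∈ Sᶜ := h ▸ ha
    simp [ha] at h'
  constructor
  · rintro ⟨Q, hd, hU, hr⟩
    simp only at Q hd hU hr
    have hmem : ∀ j, ∀ T ∈ Q j, T = S ∨ T = Sᶜ := fun j T hT =>
      ((hP T).1 (hU ▸ Finset.mem_biUnion.2 ⟨j, Finset.mem_univ _, hT⟩)).2
    have hex : ∀ j, ∃ T, T ∈ Q j := fun j => by
      obtain ⟨r, l, hl⟩ := List.exists_cons_of_ne_nil (hG (groups.get j) (by simp))
      obtain ⟨T, hT, -⟩ := hr j r (by rw [hl]; simp)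
      exact ⟨T, hT⟩
    have hdis : ∀ j j' T, j ≠ j' → T ∈ Q j → T ∉ Q j' := fun j j' T h hT hT' =>
      Finset.disjoint_left.1 (hd j j' h) hT hT'
    match groups, hne with
    | [G], _ =>
      refine Or.inl ⟨G, rfl, fun r hrG => ?_⟩
      obtain ⟨T, hT, hs⟩ := hr ⟨0, by simp⟩ r (by simpa using hrG)
      rcases hmem _ T hT with rfl | rfl
      · exact Or.inl hs
      · exact Or.inr hs
    | [G₁, G₂], _ =>
      refine Or.inr ⟨G₁, G₂, rfl, ?_⟩
      have h01 : (⟨0, by simp⟩ : Fin [G₁, G₂].length) ≠ ⟨1, by simp⟩ := by simp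
      obtain ⟨T₀, hT₀⟩ := hex ⟨0, by simp⟩
      obtain ⟨T₁, hT₁⟩ := hex ⟨1, by simp⟩
      have hT₀' := hdis _ _ _ h01 hT₀
      have hT₁' := hdis _ _ _ h01.symm hT₁
      rcases hmem _ _ hT₀ with rfl | rfl <;> rcases hmem _ _ hT₁ with rfl | h1
      · exact absurd hT₁ hT₀'
      · subst h1
        refine Or.inl ⟨fun r hrG => ?_, fun r hrG => ?_⟩
        · obtain ⟨T, hT, hs⟩ := hr ⟨0, by simp⟩ r (by simpa using hrG)
          rcases hmem _ T hT with rfl | rfl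
          · exact hs
          · exact absurd hT hT₁'
        · obtain ⟨T, hT, hs⟩ := hr ⟨1, by simp⟩ r (by simpa using hrG)
          rcases hmem _ T hT with rfl | rfl
          · exact absurd hT hT₀'
          · exact hs
      · refine Or.inr ⟨fun r hrG => ?_, fun r hrG => ?_⟩
        · obtain ⟨T, hT, hs⟩ := hr ⟨0, by simp⟩ r (by simpa using hrG)
          rcases hmem _ T hT with rfl | rfl
          · exact absurd hT hT₁'
          · exact hs
        · obtain ⟨T, hT, hs⟩ := hr ⟨1, by simp⟩ r (by simpa using hrG)
          rcases hmem _ T hT with rfl | rfl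
          · exact hs
          · exact absurd hT hT₀'
      · subst h1
        exact absurd hT₁ hT₀'
    | G₁ :: G₂ :: G₃ :: t, _ =>
      exfalso
      obtain ⟨T₀, hT₀⟩ := hex ⟨0, by simp⟩
      obtain ⟨T₁, hT₁⟩ := hex ⟨1, by simp⟩
      obtain ⟨T₂, hT₂⟩ := hex ⟨2, by simp⟩
      have h01 : T₀ ≠ T₁ := by rintro rfl; exact hdis _ _ _ (by simp) hT₀ hT₁
      have h02 : T₀ ≠ T₂ := by rintro rfl; exact hdis _ _ _ (by simp) hT₀ hT₂
      have h12 : T₁ ≠ T₂ := by rintro rfl; exact hdis _ _ _ (by simp) hT₁ hT₂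
      rcases hmem _ _ hT₀ with rfl | rfl <;> rcases hmem _ _ hT₁ with h1 | h1 <;>
        rcases hmem _ _ hT₂ with h2 | h2 <;> simp_all
  · rintro (⟨G, hg, h⟩ | ⟨G₁, G₂, hg, h⟩) <;> simp only at hg <;> subst hg
    · refine ⟨fun _ => P.parts, ?_, ?_, ?_⟩
      · intro j j' hj
        exact absurd (Subsingleton.elim (α := Fin 1) j j') hj
      · ext T
        simp
      · rintro ⟨j, hj⟩ r hr
        have hrG : r ∈ G := by
          simp only [List.length_singleton, Nat.lt_one_iff] at hj
          subst hj
          simpa using hr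
        rcases h r hrG with hs | hs
        · exact ⟨S, (hP S).2 ⟨hS, Or.inl rfl⟩, hs⟩
        -- `Sᶜ` is a block only if it is nonempty, which satisfaction of a conjunction guarantees.
        · exact ⟨Sᶜ, (hP _).2 ⟨hs.nonempty.ne_empty, Or.inr rfl⟩, hs⟩
    · have key : ∀ A B : Finset (Fin n), A ≠ B → (∀ T, T ∈ P.parts ↔ T ≠ ∅ ∧ (T = A ∨ T = B)) →
          (∀ r ∈ G₁, r.expr.SatisfiedBy A) → (∀ r ∈ G₂, r.expr.SatisfiedBy B) →
          WeightedRule.SatisfiedBy ⟨[G₁, G₂], hne, hG⟩ P := by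
        intro A B hAB hP hA hB
        obtain ⟨r₁, l₁, hl₁⟩ := List.exists_cons_of_ne_nil (hG G₁ (by simp))
        obtain ⟨r₂, l₂, hl₂⟩ := List.exists_cons_of_ne_nil (hG G₂ (by simp))
        have hA0 := (hA r₁ (by simp [hl₁])).nonempty.ne_empty
        have hB0 := (hB r₂ (by simp [hl₂])).nonempty.ne_empty
        refine ⟨(![{A}, {B}] : Fin 2 → Finset (Finset (Fin n))), ?_, ?_, ?_⟩
        · show ∀ j j' : Fin 2, _
          intro j j' hj
          fin_cases j <;> fin_cases j' <;> simp_all [Ne.symm]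
        · show Finset.biUnion (Finset.univ : Finset (Fin 2)) _ = _
          ext T
          rw [hP T]
          simp only [Finset.mem_biUnion, Finset.mem_univ, true_and, Fin.exists_fin_two,
            Matrix.cons_val_zero, Matrix.cons_val_one, Finset.mem_singleton]
          constructor
          · rintro (rfl | rfl) <;> simp_all
          · exact fun h => h.2
        · show ∀ j : Fin 2, _
          intro j
          fin_cases j
          · intro r hr
            exact ⟨A, by simp, hA r (by simpa using hr)⟩
          · intro r hr
            exact ⟨B, by simp, hB r (by simpa using hr)⟩
      rcases h with ⟨hA, hB⟩ | ⟨hA, hB⟩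
      · exact key S Sᶜ hSc hP hA hB
      · exact key Sᶜ S hSc.symm (fun T => by rw [hP T, or_comm]) hA hB

/-- A block other than `S` is disjoint from `S`; an element in neither of them would lie in a third
block. -/
theorem mem_parts_iff_of_card_le_two (P : Finpartition (Finset.univ : Finset (Fin n)))
    {S : Finset (Fin n)} (hS : S ∈ P.parts) (hc : P.parts.card ≤ 2) (T : Finset (Fin n)) :
    T ∈ P.parts ↔ T ≠ ∅ ∧ (T = S ∨ T = Sᶜ) := by
  have key : ∀ T ∈ P.parts, T ≠ S → T = Sᶜ := by
    intro T hT hTS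
    have hdis : Disjoint T S := P.disjoint hT hS hTS
    apply Finset.Subset.antisymm
    · intro a ha
      simpa using Finset.disjoint_left.1 hdis ha
    · intro a ha
      have hu : a ∈ P.parts.sup id := by rw [P.sup_parts]; simp
      obtain ⟨U, hU, haU⟩ := Finset.mem_sup.1 hu
      by_cases hUT : U = T
      · exact hUT ▸ haU
      have hUS : U ≠ S := by
        rintro rfl
        simp only [Finset.mem_compl] at ha
        exact ha haU
      have : ({U, T, S} : Finset (Finset (Fin n))).card ≤ P.parts.card := by
        apply Finset.card_le_card
        intro V hV
        simp only [Finset.mem_insert, Finset.mem_singleton] at hV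
        rcases hV with rfl | rfl | rfl <;> assumption
      rw [Finset.card_eq_three.2 ⟨U, T, S, hUT, hUS, hTS, rfl⟩] at this
      omega
  constructor
  · intro hT
    refine ⟨P.ne_bot hT, ?_⟩
    by_cases h : T = S
    · exact Or.inl h
    · exact Or.inr (key T hT h)
  · rintro ⟨h0, rfl | rfl⟩
    · exact hS
    · obtain ⟨a, ha⟩ := Finset.nonempty_iff_ne_empty.2 h0
      have hu : a ∈ P.parts.sup id := by rw [P.sup_parts]; simp
      obtain ⟨U, hU, haU⟩ := Finset.mem_sup.1 hu
      have hUS : U ≠ S := by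
        rintro rfl
        simp only [Finset.mem_compl] at ha
        exact ha haU
      exact key U hU hUS ▸ hU

/-- The partition of the players into `S` and its complement. -/
def pairPartition (S : Finset (Fin n)) : Finpartition (Finset.univ : Finset (Fin n)) :=
  -- Erasing the empty set makes the construction valid when `S` or `Sᶜ` is empty.
  Finpartition.ofErase {S, Sᶜ}
    (by
      rw [Finset.supIndep_iff_pairwiseDisjoint]
      intro a ha b hb hab
      simp only [Finset.coe_insert, Finset.coe_singleton, Set.mem_insert_iff,
        Set.mem_singleton_iff] at ha hb
      rcases ha with rfl | rfl <;> rcases hb with rfl | rfl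
      · exact absurd rfl hab
      · exact disjoint_compl_right
      · exact disjoint_compl_left
      · exact absurd rfl hab)
    (by simp)

theorem mem_pairPartition (S T : Finset (Fin n)) :
    T ∈ (pairPartition S).parts ↔ T ≠ ∅ ∧ (T = S ∨ T = Sᶜ) := by
  simp [pairPartition]

theorem card_pairPartition_le (S : Finset (Fin n)) : (pairPartition S).parts.card ≤ 2 :=
  (Finset.card_le_card (Finset.erase_subset _ _)).trans Finset.card_le_two

/-- A sum over the embedded coalitions with at most two blocks is a sum over coalitions. -/
theorem sum_embeddedCoalition {K : Type} [Field K] (i : Fin n) (g : Game n K)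
    (h : Finset (Fin n) → K)
    (hg : ∀ e : EmbeddedCoalition n, e.1.parts.card ≤ 2 → g e = h e.2.1) :
    mqValue g i = ∑ S : Finset (Fin n) with S ≠ ∅, shapleyCoeff K i S * h S := by
  have h1 : mqValue g i =
      ∑ e : EmbeddedCoalition n with e.1.parts.card ≤ 2, shapleyCoeff K i e.2.1 * h e.2.1 := by
    rw [mqValue, Finset.sum_filter]
    refine Finset.sum_congr rfl fun e _ => ?_
    split_ifs with hc
    · rw [hg e hc, mul_one]
    · simp
  rw [h1]
  -- Forgetting the partition is a bijection onto the nonempty coalitions, since a partition with at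
  -- most two blocks is determined by any one of them.
  refine Finset.sum_bij (fun e _ => e.2.1) ?_ ?_ ?_ ?_
  · intro e _
    simpa using e.1.ne_bot e.2.2
  · rintro ⟨P, S, hS⟩ he ⟨P', S', hS'⟩ he' hSS
    simp only [Finset.mem_filter, Finset.mem_univ, true_and] at he he' hSS
    subst hSS
    have : P = P' := by
      ext T
      rw [mem_parts_iff_of_card_le_two P hS he, mem_parts_iff_of_card_le_two P' hS' he']
    subst this
    rfl
  · intro S hS
    simp only [Finset.mem_filter, Finset.mem_univ, true_and] at hS
    exact ⟨⟨pairPartition S, S, (mem_pairPartition S S).2 ⟨hS, Or.inl rfl⟩⟩,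
      by simpa using card_pairPartition_le S, rfl⟩
  · intro e _
    rfl

open Classical in
/-- The MQ-value as a sum over the rules. -/
theorem mqValue_game {K : Type} [Field K] (Γ : List (WeightedRule n K)) (i : Fin n) :
    mqValue (game Γ) i = (Γ.map fun γ => (γ.groups.flatten.map fun r => r.weight *
      ∑ S : Finset (Fin n), if r.expr.SatisfiedBy S ∧ γ.SatisfiedByPair S
        then shapleyCoeff K i S else 0).sum).sum := by
  rw [sum_embeddedCoalition i (game Γ) (fun S => (Γ.map fun γ =>
      if γ.SatisfiedByPair S then
        (γ.groups.flatten.map fun r => if r.expr.SatisfiedBy S then r.weight else 0).sum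
      else 0).sum)]
  · have comm : ∀ {β : Type} (l : List β) (f : β → Finset (Fin n) → K) (A : Finset (Finset (Fin n))),
        (l.map fun b => ∑ S ∈ A, f b S).sum = ∑ S ∈ A, (l.map fun b => f b S).sum := by
      intro β l f A
      induction l with
      | nil => simp
      | cons b l ih => simp [ih, Finset.sum_add_distrib]
    simp_rw [Finset.mul_sum, comm]
    rw [Finset.sum_filter]
    refine Finset.sum_congr rfl fun S _ => ?_
    -- The empty coalition is never a block, but it satisfies no conjunction, so including it in the
    -- sum is harmless.
    by_cases hS : S = ∅
    · have hno : ∀ α : Conj n, ¬ α.SatisfiedBy ∅ := fun α h => by simpa using h.nonempty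
      simp [hS, hno, -List.map_flatten]
    · rw [if_pos hS, ← List.sum_map_mul_left]
      congr 1
      refine List.map_congr_left fun γ _ => ?_
      by_cases hγ : γ.SatisfiedByPair S
      · simp only [hγ, if_true, and_true]
        rw [← List.sum_map_mul_left]
        congr 1
        refine List.map_congr_left fun r _ => ?_
        split_ifs <;> ring
      · simp [hγ, -List.map_flatten]
  · rintro ⟨P, S, hS⟩ hc
    simp only [game]
    congr 1
    refine List.map_congr_left fun γ _ => ?_
    simp only [γ.satisfiedBy_iff_pair P S (P.ne_bot hS) (mem_parts_iff_of_card_le_two P hS hc)]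

/-- The numerator of the coefficient of a coalition of size `s`, which contains the player
if `e = 0` and does not contain it if `e = 1`. -/
def coeffNum (n e s : ℕ) : ℕ := (s + e - 1).factorial * (n - s - e).factorial

-- The sign of the coefficient becomes a subtraction and the common denominator is pulled out,
-- leaving two sums of natural numbers whose terms depend only on `|S|`.
open Classical in
theorem sum_shapleyCoeff {K : Type} [Field K] (i : Fin n) (C : Finset (Fin n) → Prop) :
    (∑ S : Finset (Fin n), if C S then shapleyCoeff K i S else 0) =
      ((∑ S : Finset (Fin n) with C S ∧ i ∈ S, coeffNum n 0 S.card : ℕ) -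
        (∑ S : Finset (Fin n) with C S ∧ i ∉ S, coeffNum n 1 S.card : ℕ)) / (n.factorial : K) := by
  push_cast
  rw [Finset.sum_filter, Finset.sum_filter, ← Finset.sum_sub_distrib, Finset.sum_div]
  refine Finset.sum_congr rfl fun S _ => ?_
  by_cases hC : C S <;> by_cases hi : i ∈ S <;> simp [hC, hi, shapleyCoeff, coeffNum, neg_div]

end Semantics

/-! ### Satisfaction as a system of parity equations between players. -/

section Constraints

variable {n : ℕ} {K : Type}

/-- The condition on `S` that a rule of another group (`flip = true`) or of the same group
(`flip = false`) imposes, depending on whether there is only one group. -/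
def MCRule.Compatible (r : MCRule n K) (single flip : Bool) (S : Finset (Fin n)) : Prop :=
  if single then r.expr.SatisfiedBy S ∨ r.expr.SatisfiedBy Sᶜ
  else if flip then r.expr.SatisfiedBy Sᶜ else r.expr.SatisfiedBy S

/-- For a rule in a group followed by `t` further groups, satisfaction of the weighted rule
is a condition on every single rule. -/
theorem WeightedRule.satisfiedByPair_iff (γ : WeightedRule n K) {dG tG : List (List (MCRule n K))}
    {G : List (MCRule n K)} (hγ : γ.groups = dG ++ G :: tG) {r : MCRule n K} (hr : r ∈ G)
    (S : Finset (Fin n)) :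
    (γ.SatisfiedByPair S ∧ r.expr.SatisfiedBy S) ↔
      (γ.groups.length ≤ 2 ∧ ∀ d G' t, γ.groups = d ++ G' :: t → ∀ r' ∈ G',
        r'.Compatible (γ.groups.length = 1) (t.length ≠ tG.length) S) ∧ r.expr.SatisfiedBy S := by
  -- With `S` satisfying `r`, the group of `r` is the one assigned to `S`. Groups are identified by
  -- the number of groups that follow them, which is what the loop counters of the program provide.
  refine and_congr_left fun hrS => ?_
  obtain ⟨groups, hne, hG⟩ := γ
  simp only [WeightedRule.SatisfiedByPair] at hγ ⊢
  match groups, hne with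
  | [G₀], _ =>
    have : dG = [] ∧ G₀ = G ∧ tG = [] := by
      rcases dG with _ | ⟨a, dG⟩
      · simp at hγ
        simp [hγ]
      · simp at hγ
    obtain ⟨rfl, rfl, rfl⟩ := this
    constructor
    · rintro (⟨G, h, h'⟩ | ⟨G₁, G₂, h, -⟩)
      · simp only [List.cons.injEq, and_true] at h
        subst h
        refine ⟨by simp, fun d G' t he r' hr' => ?_⟩
        have : G₀ = G' := by
          rcases d with _ | ⟨a, d⟩
          · simp at he
            simp [he]
          · simp at he
        subst this
        simpa [MCRule.Compatible] using h' r' hr'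
      · simp at h
    · rintro ⟨-, h⟩
      refine Or.inl ⟨G₀, rfl, fun r' hr' => ?_⟩
      simpa [MCRule.Compatible] using h [] G₀ [] rfl r' hr'
  | [G₁, G₂], _ =>
    have hsplit : ∀ d G' t, [G₁, G₂] = d ++ G' :: t ↔
        (d = [] ∧ G' = G₁ ∧ t = [G₂]) ∨ (d = [G₁] ∧ G' = G₂ ∧ t = []) := by
      intro d G' t
      rcases d with _ | ⟨a, _ | ⟨b, d⟩⟩
      · simp only [List.nil_append, List.cons.injEq]
        grind
      · simp only [List.cons_append, List.nil_append, List.cons.injEq]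
        grind
      · simp
    simp only [hsplit, List.length_cons, List.length_nil] at hγ ⊢
    have hex : ∀ (p : List (MCRule n K) → List (MCRule n K) → Prop),
        (∃ A B, [G₁, G₂] = [A, B] ∧ p A B) ↔ p G₁ G₂ := by
      intro p
      constructor
      · rintro ⟨A, B, h, hp⟩
        simp only [List.cons.injEq, and_true] at h
        obtain ⟨rfl, rfl⟩ := h
        exact hp
      · exact fun h => ⟨_, _, rfl, h⟩
    rw [hex]
    rcases hγ with ⟨rfl, rfl, rfl⟩ | ⟨rfl, rfl, rfl⟩
    · constructor
      · rintro (⟨A, h, -⟩ | ⟨h1, h2⟩ | ⟨h1, -⟩)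
        · simp at h
        · refine ⟨by simp, ?_⟩
          rintro d G' t (⟨rfl, rfl, rfl⟩ | ⟨rfl, rfl, rfl⟩) r' hr'
          · simpa [MCRule.Compatible] using h1 r' hr'
          · simpa [MCRule.Compatible] using h2 r' hr'
        -- The opposite assignment would make `r` hold in `Sᶜ` as well.
        · exact absurd (h1 r hr) hrS.not_compl
      · rintro ⟨-, h⟩
        refine Or.inr (Or.inl ⟨fun r' hr' => ?_, fun r' hr' => ?_⟩)
        · simpa [MCRule.Compatible] using h _ _ _ (Or.inl ⟨rfl, rfl, rfl⟩) r' hr'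
        · simpa [MCRule.Compatible] using h _ _ _ (Or.inr ⟨rfl, rfl, rfl⟩) r' hr'
    · constructor
      · rintro (⟨A, h, -⟩ | ⟨h1, h2⟩ | ⟨h1, h2⟩)
        · simp at h
        · exact absurd (h2 r hr) hrS.not_compl
        · refine ⟨by simp, ?_⟩
          rintro d G' t (⟨rfl, rfl, rfl⟩ | ⟨rfl, rfl, rfl⟩) r' hr'
          · simpa [MCRule.Compatible] using h1 r' hr'
          · simpa [MCRule.Compatible] using h2 r' hr'
      · rintro ⟨-, h⟩
        refine Or.inr (Or.inr ⟨fun r' hr' => ?_, fun r' hr' => ?_⟩)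
        · simpa [MCRule.Compatible] using h _ _ _ (Or.inl ⟨rfl, rfl, rfl⟩) r' hr'
        · simpa [MCRule.Compatible] using h _ _ _ (Or.inr ⟨rfl, rfl, rfl⟩) r' hr'
  | G₁ :: G₂ :: G₃ :: t, _ => simp

/-- The characteristic function of `S`; it is true outside of the players. -/
def charFun (S : Finset (Fin n)) (v : ℕ) : Bool := if h : v < n then decide (⟨v, h⟩ ∈ S) else true

@[simp] theorem charFun_fin (S : Finset (Fin n)) (a : Fin n) : charFun S a = decide (a ∈ S) := by
  simp [charFun]

@[simp] theorem charFun_self (S : Finset (Fin n)) : charFun S n = true := by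
  simp [charFun]

/-- The constraints by which a conjunction `α` relates its literals to the node `ref`. -/
def Conj.Linked (α : Conj n) (ref : ℕ) (flip : Bool) (S : Finset (Fin n)) : Prop :=
  (∀ a ∈ α.pos, (charFun S ref ^^ charFun S a) = flip) ∧
    ∀ a ∈ α.neg, (charFun S ref ^^ charFun S a) = !flip

/-- The node `n` is always true, so an equation with it prescribes the value of a literal. -/
theorem Conj.linked_self (α : Conj n) (flip : Bool) (S : Finset (Fin n)) :
    α.Linked n flip S ↔ if flip then α.SatisfiedBy Sᶜ else α.SatisfiedBy S := by
  cases flip <;> simp [Conj.Linked, Conj.SatisfiedBy]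

/-- The disjunction is invariant under complementation and so compares literals only with each
other. Any positive literal can serve as the reference: exactly one of `S` and `Sᶜ` contains it, and
that is the side on which `α` must hold. -/
theorem Conj.linked_head (α : Conj n) (S : Finset (Fin n)) :
    α.Linked (α.pos.head α.pos_ne_nil) false S ↔ α.SatisfiedBy S ∨ α.SatisfiedBy Sᶜ := by
  have hmem := List.head_mem α.pos_ne_nil
  set b := α.pos.head α.pos_ne_nil
  by_cases hb : b ∈ S
  · have : ¬ α.SatisfiedBy Sᶜ := fun h => by simpa [hb] using h.1 b hmem
    rw [or_iff_left this]
    simp [Conj.Linked, hb, Conj.SatisfiedBy]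
  · have : ¬ α.SatisfiedBy S := fun h => hb (h.1 b hmem)
    rw [or_iff_right this]
    simp [Conj.Linked, hb, Conj.SatisfiedBy]

/-- One form for both cases, in which only the reference node differs. With a single group no rule
belongs to another group, which is the hypothesis `h`. -/
theorem MCRule.compatible_iff (r : MCRule n K) (single flip : Bool) (h : single → flip = false)
    (S : Finset (Fin n)) :
    r.Compatible single flip S ↔
      r.expr.Linked (if single then r.expr.pos.head r.expr.pos_ne_nil else n) flip S := by
  cases single
  · simp [MCRule.Compatible, Conj.linked_self]
  · simp [MCRule.Compatible, h rfl, Conj.linked_head]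

end Constraints


/-! ### Parity equations in solved form. -/

section UnionFind

/-- A system of equalities and inequalities between Boolean variables in solved form: variable `w`
is the variable `rep w`, negated if `par w` holds; there is no solution unless `ok`. -/
structure Links where
  rep : ℕ → ℕ
  par : ℕ → Bool
  ok : Bool

/-- The assignment `f` solves the system. -/
def Links.Sol (σ : Links) (f : ℕ → Bool) : Prop :=
  σ.ok = true ∧ ∀ w, f w = (f (σ.rep w) ^^ σ.par w)

/-- The system is in solved form, with representatives up to `n` for the variables up to `n`. -/
structure Links.WF (σ : Links) (n : ℕ) : Prop where
  rep_rep : ∀ w, σ.rep (σ.rep w) = σ.rep w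
  par_rep : ∀ w, σ.par (σ.rep w) = false
  rep_le : ∀ w ≤ n, σ.rep w ≤ n
  of_gt : ∀ w, n < w → σ.rep w = w ∧ σ.par w = false

/-- Adding the equation `f u ^^ f v = e`. -/
def Links.union (σ : Links) (u v : ℕ) (e : Bool) : Links :=
  let d := (σ.par u ^^ σ.par v) ^^ e
  if σ.rep u = σ.rep v then { σ with ok := σ.ok && !d }
  else
    { rep := fun w => if σ.rep w = σ.rep v then σ.rep u else σ.rep w
      par := fun w => if σ.rep w = σ.rep v then σ.par w ^^ d else σ.par w
      ok := σ.ok }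

theorem Links.WF.union {σ : Links} {n : ℕ} (h : σ.WF n) {u v : ℕ} (hu : u ≤ n) (hv : v ≤ n)
    (e : Bool) : (σ.union u v e).WF n := by
  unfold Links.union
  split_ifs with huv
  · exact ⟨h.rep_rep, h.par_rep, h.rep_le, h.of_gt⟩
  · refine ⟨fun w => ?_, fun w => ?_, fun w hw => ?_, fun w hw => ?_⟩
    · by_cases hw : σ.rep w = σ.rep v <;> simp [hw, h.rep_rep, huv]
    · by_cases hw : σ.rep w = σ.rep v <;> simp [hw, h.rep_rep, huv, h.par_rep]
    · by_cases hw' : σ.rep w = σ.rep v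
      · simp [hw', h.rep_le u hu]
      · simp [hw', h.rep_le w hw]
    · have hw' : σ.rep w ≠ σ.rep v := by
        have := h.rep_le v hv
        rw [(h.of_gt w hw).1]
        omega
      simp only [if_neg hw']
      exact h.of_gt w hw

/-- Written at the representatives, the new equation says that `rep u` and `rep v` differ by `d =
par u ^^ par v ^^ e`. If the classes agree, it is solvable only for `d = false`; otherwise it
eliminates `rep v` in favour of `rep u`. -/
theorem Links.WF.sol_union {σ : Links} {n : ℕ} (h : σ.WF n) (u v : ℕ) (e : Bool) (f : ℕ → Bool) :
    (σ.union u v e).Sol f ↔ σ.Sol f ∧ (f u ^^ f v) = e := by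
  unfold Links.union
  split_ifs with huv
  · simp only [Links.Sol, Bool.and_eq_true]
    constructor
    · rintro ⟨⟨h1, h2⟩, h3⟩
      refine ⟨⟨h1, h3⟩, ?_⟩
      rw [h3 u, h3 v, huv]
      revert h2
      generalize σ.par u = a; generalize σ.par v = b; generalize f (σ.rep v) = c
      revert a b c e
      decide
    · rintro ⟨⟨h1, h3⟩, h2⟩
      refine ⟨⟨h1, ?_⟩, h3⟩
      rw [h3 u, h3 v, huv] at h2
      revert h2
      generalize σ.par u = a; generalize σ.par v = b; generalize f (σ.rep v) = c
      revert a b c e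
      decide
  · simp only [Links.Sol]
    constructor
    · rintro ⟨h1, h3⟩
      -- Read at the old representative `rep v`, which has parity `false`, the new table is the
      -- added equation itself.
      have hv : f (σ.rep v) = (f (σ.rep u) ^^ ((σ.par u ^^ σ.par v) ^^ e)) := by
        simpa [h.rep_rep, h.par_rep] using h3 (σ.rep v)
      have key : ∀ w, f w = (f (σ.rep w) ^^ σ.par w) := by
        intro w
        have := h3 w
        by_cases hw : σ.rep w = σ.rep v
        · rw [if_pos hw, if_pos hw] at this
          rw [hw, hv, this]
          generalize σ.par u = a; generalize σ.par v = b; generalize f (σ.rep u) = c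
          generalize σ.par w = d
          cases a <;> cases b <;> cases c <;> cases d <;> cases e <;> rfl
        · simpa [hw] using this
      refine ⟨⟨h1, key⟩, ?_⟩
      rw [key u, key v, hv]
      generalize σ.par u = a; generalize σ.par v = b; generalize f (σ.rep u) = c
      cases a <;> cases b <;> cases c <;> cases e <;> rfl
    · rintro ⟨⟨h1, h3⟩, h2⟩
      refine ⟨h1, fun w => ?_⟩
      by_cases hw : σ.rep w = σ.rep v
      · rw [if_pos hw, if_pos hw, h3 w, hw]
        rw [h3 u, h3 v] at h2
        revert h2
        generalize σ.par u = a; generalize σ.par v = b; generalize f (σ.rep u) = c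
        generalize σ.par w = d; generalize f (σ.rep v) = c'
        revert a b c d e c'
        decide
      · simp [hw, ← h3 w]

/-- The system without equations, which has no solution unless `b`. -/
def Links.init (b : Bool) : Links := ⟨id, fun _ => false, b⟩

theorem Links.init_wf (b : Bool) (n : ℕ) : (Links.init b).WF n :=
  ⟨fun _ => rfl, fun _ => rfl, fun _ h => h, fun _ _ => ⟨rfl, rfl⟩⟩

theorem Links.init_sol (b : Bool) (f : ℕ → Bool) : (Links.init b).Sol f ↔ b = true := by
  simp [Links.Sol, Links.init]

end UnionFind

/-! ### Counting solutions by size with a generating function. -/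

section GeneratingFunction

/-- The weight of the value `b` of variable `w`: the variable `n` has to be true, the variables
below `n` are counted by the exponent of `x`. -/
def varWeight (n x w : ℕ) (b : Bool) : ℕ :=
  if w < n then (if b then x else 1) else (if b then 1 else 0)

/-- The total weight of the class of `ρ` if `ρ` has the value `b`. -/
def classWeight (n x : ℕ) (σ : Links) (ρ : ℕ) (b : Bool) (m : ℕ) : ℕ :=
  ∏ w ∈ Finset.range m, if σ.rep w = ρ then varWeight n x w (b ^^ σ.par w) else 1

/-- The generating function of the solutions. -/
def genFun (n x : ℕ) (σ : Links) (m : ℕ) : ℕ :=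
  σ.ok.toNat * ∏ ρ ∈ Finset.range m, if σ.rep ρ = ρ then
    classWeight n x σ ρ true (n + 1) + classWeight n x σ ρ false (n + 1) else 1

theorem varWeight_le {n x w : ℕ} {b : Bool} (hx : 1 ≤ x) : varWeight n x w b ≤ x := by
  unfold varWeight
  split_ifs <;> omega

theorem classWeight_le {n x : ℕ} (hx : 1 ≤ x) (σ : Links) (ρ : ℕ) (b : Bool) (m : ℕ) :
    classWeight n x σ ρ b m ≤ x ^ m := by
  calc classWeight n x σ ρ b m ≤ ∏ w ∈ Finset.range m, x := by
        refine Finset.prod_le_prod' fun w _ => ?_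
        split_ifs
        · exact varWeight_le hx
        · exact hx
    _ = x ^ m := by simp

/-- The bound is needed for all partial products, since the program stores each of them. For `x ≥ 2`
the sum of two class weights costs only one more power of `x`. -/
theorem genFun_le {n x : ℕ} (hx : 2 ≤ x) (σ : Links) (m : ℕ) :
    genFun n x σ m ≤ x ^ ((n + 2) * m) := by
  calc genFun n x σ m ≤ 1 * ∏ w ∈ Finset.range m, x ^ (n + 2) := by
        unfold genFun
        refine Nat.mul_le_mul (Bool.toNat_le _) (Finset.prod_le_prod' fun w _ => ?_)
        split_ifs
        · have h1 := classWeight_le (n := n) (by omega : 1 ≤ x) σ w true (n + 1)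
          have h2 := classWeight_le (n := n) (by omega : 1 ≤ x) σ w false (n + 1)
          calc _ ≤ 2 * x ^ (n + 1) := by omega
            _ ≤ x * x ^ (n + 1) := Nat.mul_le_mul_right _ hx
            _ = x ^ (n + 2) := by ring
        · exact Nat.one_le_pow _ _ (by omega)
    _ = x ^ ((n + 2) * m) := by simp [pow_mul]

variable {n : ℕ}

-- A solution amounts to the set `T` of representatives that are true. Expanding the product of the
-- two-term sums gives one summand for each `T`, and this summand is the product of the weights of
-- all variables: `x` for each member of the coalition, and `0` if the node `n` comes out false.
open Classical in
theorem genFun_eq (x : ℕ) {σ : Links} (h : σ.WF n) :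
    genFun n x σ (n + 1) = ∑ S : Finset (Fin n) with σ.Sol (charFun S), x ^ S.card := by
  unfold genFun
  cases hok : σ.ok with
  | false => simp [Links.Sol, hok]
  | true =>
  rw [Bool.toNat_true, one_mul, ← Finset.prod_filter, Finset.prod_add]
  set R := (Finset.range (n + 1)).filter fun ρ => σ.rep ρ = ρ with hR
  have hrepR : ∀ w ≤ n, σ.rep w ∈ R := fun w hw => by
    have := h.rep_le w hw
    simp only [hR, Finset.mem_filter, Finset.mem_range, h.rep_rep, and_true]
    omega
  -- The assignment determined by the set `T` of true representatives.
  let val : Finset ℕ → ℕ → Bool := fun T w => decide (σ.rep w ∈ T) ^^ σ.par w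
  have hterm : ∀ T ∈ R.powerset, (∏ ρ ∈ T, classWeight n x σ ρ true (n + 1)) *
      ∏ ρ ∈ R \ T, classWeight n x σ ρ false (n + 1) =
      if val T n then x ^ (Finset.univ.filter fun a : Fin n => val T a).card else 0 := by
    intro T hT
    rw [Finset.mem_powerset] at hT
    have h1 : (∏ ρ ∈ T, classWeight n x σ ρ true (n + 1)) *
        ∏ ρ ∈ R \ T, classWeight n x σ ρ false (n + 1) =
        ∏ ρ ∈ R, classWeight n x σ ρ (decide (ρ ∈ T)) (n + 1) := by
      rw [← Finset.prod_sdiff hT, mul_comm]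
      congr 1
      · exact Finset.prod_congr rfl fun ρ hρ => by simp [(Finset.mem_sdiff.1 hρ).2]
      · exact Finset.prod_congr rfl fun ρ hρ => by simp [hρ]
    rw [h1]
    simp only [classWeight]
    -- Every variable lies in exactly one class, so for a fixed variable only one factor of the
    -- product over classes differs from `1`.
    rw [Finset.prod_comm, Finset.prod_congr rfl (g := fun w => varWeight n x w (val T w))]
    · rw [Finset.prod_range_succ, Finset.prod_range]
      have h2 : varWeight n x n (val T n) = if val T n then 1 else 0 := by simp [varWeight]
      have h3 : ∀ a : Fin n, varWeight n x a (val T a) = if val T a then x else 1 := fun a => by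
        simp [varWeight]
      rw [h2, Finset.prod_congr rfl fun a _ => h3 a, ← Finset.prod_filter, Finset.prod_const]
      split_ifs <;> simp
    · intro w hw
      rw [Finset.prod_ite_eq, if_pos (hrepR w (Nat.lt_succ_iff.1 (Finset.mem_range.1 hw)))]
  rw [Finset.sum_congr rfl hterm, ← Finset.sum_filter]
  have hval : ∀ T, val T n = true → ∀ w ≤ n,
      charFun (Finset.univ.filter fun a : Fin n => val T a) w = val T w := by
    intro T hT w hw
    rcases hw.lt_or_eq with hw | rfl
    · simp [charFun, hw]
    · simp [charFun, hT]
  symm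
  refine Finset.sum_bij' (fun S _ => R.filter fun ρ => charFun S ρ)
    (fun T _ => Finset.univ.filter fun a : Fin n => val T a) ?_ ?_ ?_ ?_ ?_
  · intro S hS
    have hS' := (Finset.mem_filter.1 hS).2.2 n
    simp only [Finset.mem_filter, Finset.mem_powerset, Finset.filter_subset, true_and]
    simp only [val, Finset.mem_filter, hrepR n le_rfl, true_and, Bool.decide_eq_true]
    rw [← hS', charFun_self]
  · intro T hT
    simp only [Finset.mem_filter, Finset.mem_univ, true_and, Finset.mem_powerset] at hT ⊢
    refine ⟨hok, fun w => ?_⟩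
    by_cases hw : w ≤ n
    · rw [hval T hT.2 w hw, hval T hT.2 _ (h.rep_le w hw)]
      simp [val, h.rep_rep, h.par_rep]
    · obtain ⟨h1, h2⟩ := h.of_gt w (by omega)
      simp [h1, h2]
  · intro S hS
    have hS' := (Finset.mem_filter.1 hS).2.2
    ext a
    have := hS' a
    simp only [charFun_fin] at this
    simp only [Finset.mem_filter, Finset.mem_univ, true_and, val, hrepR a a.2.le,
      Bool.decide_eq_true, ← this, decide_eq_true_eq]
  · intro T hT
    simp only [Finset.mem_filter, Finset.mem_powerset] at hT
    ext ρ
    simp only [Finset.mem_filter]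
    constructor
    · rintro ⟨h1, h2⟩
      simp only [hR, Finset.mem_filter, Finset.mem_range] at h1
      rw [hval T hT.2 ρ (by omega)] at h2
      have h3 := h.par_rep ρ
      rw [h1.2] at h3
      simpa [val, h1.2, h3] using h2
    · intro h1
      have h2 := hT.1 h1
      refine ⟨h2, ?_⟩
      simp only [hR, Finset.mem_filter, Finset.mem_range] at h2
      rw [hval T hT.2 ρ (by omega)]
      have h3 := h.par_rep ρ
      rw [h2.2] at h3
      simpa [val, h2.2, h3] using h1
  · intro S hS
    have hS' := (Finset.mem_filter.1 hS).2.2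
    congr 2
    ext a
    have := hS' a
    simp only [charFun_fin] at this
    simp only [Finset.mem_filter, Finset.mem_univ, true_and, val, hrepR a a.2.le,
      Bool.decide_eq_true, ← this, decide_eq_true_eq]

/-- Coefficients below `x` are the digits in base `x`: the remainder reads the lowest one and the
quotient shifts the rest down. -/
theorem sum_digits_mod (c : ℕ → ℕ) {x : ℕ} (hx : 0 < x) (hc : ∀ s, c s < x) (m : ℕ) :
    (∑ s ∈ Finset.range (m + 1), c s * x ^ s) % x = c 0 ∧
      (∑ s ∈ Finset.range (m + 1), c s * x ^ s) / x =
        ∑ s ∈ Finset.range m, c (s + 1) * x ^ s := by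
  have : ∑ s ∈ Finset.range (m + 1), c s * x ^ s =
      c 0 + x * ∑ s ∈ Finset.range m, c (s + 1) * x ^ s := by
    rw [Finset.sum_range_succ', Finset.mul_sum, add_comm]
    congr 1
    · simp
    · exact Finset.sum_congr rfl fun s _ => by ring
  rw [this]
  exact ⟨by rw [Nat.add_mul_mod_self_left, Nat.mod_eq_of_lt (hc 0)],
    by rw [Nat.add_mul_div_left _ _ hx, Nat.div_eq_of_lt (hc 0), zero_add]⟩

/-- The number of the coalitions of size `s` in `A`. -/
def sizeCount (A : Finset (Finset (Fin n))) (s : ℕ) : ℕ := (A.filter fun S => S.card = s).card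

/-- This makes `2 ^ (n + 1)` an admissible radix: there are only `2 ^ n` coalitions. -/
theorem sizeCount_lt (A : Finset (Finset (Fin n))) (s : ℕ) : sizeCount A s < 2 ^ (n + 1) := by
  have h1 : sizeCount A s ≤ (Finset.univ : Finset (Finset (Fin n))).card :=
    Finset.card_le_card (Finset.subset_univ _)
  have h2 : 2 ^ (n + 1) = 2 * 2 ^ n := by ring
  have h3 : 0 < 2 ^ n := by positivity
  simp only [Finset.card_univ, Fintype.card_finset, Fintype.card_fin] at h1
  omega

theorem sum_sizeCount (A : Finset (Finset (Fin n))) (F : ℕ → ℕ) :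
    ∑ S ∈ A, F S.card = ∑ s ∈ Finset.range (n + 1), F s * sizeCount A s := by
  rw [← Finset.sum_fiberwise_of_maps_to (s := A) (t := Finset.range (n + 1))
    (g := fun S => S.card)]
  · refine Finset.sum_congr rfl fun s _ => ?_
    rw [Finset.sum_congr rfl (g := fun _ => F s)]
    · simp [sizeCount, mul_comm]
    · intro S hS
      rw [(Finset.mem_filter.1 hS).2]
  · intro S _
    have := S.card_le_univ
    simp only [Fintype.card_fin] at this
    simp only [Finset.mem_range]
    omega

end GeneratingFunction

/-! ### Cost measures for field elements; heights of rational numbers. -/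

section CostModel

/-- A cost measure for field elements, with a height that is subadditive up to one. -/
structure CostModel (K : Type) [Field K] where
  sz : K → ℕ
  ht : K → ℕ
  sz_le : ∀ x, sz x ≤ 2 * ht x + 1
  ht_le : ∀ x, ht x ≤ sz x
  ht_nat : ∀ m : ℕ, ht (m : K) ≤ m.size + 1
  ht_add : ∀ x y, ht (x + y) ≤ ht x + ht y + 1
  ht_sub : ∀ x y, ht (x - y) ≤ ht x + ht y + 1
  ht_mul : ∀ x y, ht (x * y) ≤ ht x + ht y + 1
  ht_div : ∀ x y, ht (x / y) ≤ ht x + ht y + 1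

/-- Field operations at unit cost. -/
def CostModel.unit (K : Type) [Field K] : CostModel K where
  sz := fun _ => 1
  ht := fun _ => 1
  sz_le := by simp
  ht_le := by simp
  ht_nat := by simp
  ht_add := by simp
  ht_sub := by simp
  ht_mul := by simp
  ht_div := by simp

theorem size_mul_le (a b : ℕ) : (a * b).size ≤ a.size + b.size := by
  rw [Nat.size_le, pow_add]
  rcases Nat.eq_zero_or_pos (a * b) with h | h
  · rw [h]; positivity
  · exact Nat.mul_lt_mul'' (Nat.lt_size_self a) (Nat.lt_size_self b)

theorem size_add_le (a b : ℕ) : (a + b).size ≤ a.size + b.size + 1 := by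
  rw [Nat.size_le]
  have ha := Nat.lt_size_self a
  have hb := Nat.lt_size_self b
  have h1 : 2 ^ a.size ≤ 2 ^ (a.size + b.size) := Nat.pow_le_pow_right (by simp) (by simp)
  have h2 : 2 ^ b.size ≤ 2 ^ (a.size + b.size) := Nat.pow_le_pow_right (by simp) (by simp)
  rw [pow_succ]
  omega

/-- The height of a rational number: the larger one of numerator and denominator. -/
def ratHeight (q : ℚ) : ℕ := max q.num.natAbs q.den

/-- Cancelling never increases the height: the reduced numerator and denominator divide `a` and `b`.
-/
theorem ratHeight_divInt_le (a b : ℤ) (hb : b ≠ 0) :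
    ratHeight (Rat.divInt a b) ≤ max a.natAbs b.natAbs := by
  refine max_le_max ?_ ?_
  · rcases eq_or_ne a 0 with rfl | ha
    · simp
    · exact Nat.le_of_dvd (by omega) (Int.natAbs_dvd_natAbs.2 (Rat.num_dvd a hb))
  · have h := Int.natAbs_dvd_natAbs.2 (Rat.den_dvd a b)
    exact Nat.le_of_dvd (by omega) (by simpa using h)

theorem ratHeight_neg (q : ℚ) : ratHeight (-q) = ratHeight q := by simp [ratHeight]

theorem ratHeight_mul_le (p q : ℚ) : ratHeight (p * q) ≤ ratHeight p * ratHeight q := by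
  have h : p * q = Rat.divInt (p.num * q.num) (p.den * q.den) := by
    rw [Rat.divInt_eq_div]
    push_cast
    rw [← div_mul_div_comm, Rat.num_div_den, Rat.num_div_den]
  rw [h]
  refine (ratHeight_divInt_le _ _ (by simp)).trans (max_le ?_ ?_)
  · rw [Int.natAbs_mul]
    exact Nat.mul_le_mul (le_max_left _ _) (le_max_left _ _)
  · rw [Int.natAbs_mul]
    exact Nat.mul_le_mul (le_max_right _ _) (le_max_right _ _)

theorem ratHeight_inv (q : ℚ) : ratHeight q⁻¹ ≤ ratHeight q := by
  rcases eq_or_ne q 0 with rfl | hq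
  · simp
  · have h : q⁻¹ = Rat.divInt q.den q.num := by
      rw [Rat.divInt_eq_div]
      push_cast
      rw [← inv_div, Rat.num_div_den]
    rw [h]
    refine (ratHeight_divInt_le _ _ (by simpa using hq)).trans ?_
    rw [max_comm]
    simp [ratHeight]

/-- The total bit count of numerator and denominator is not subadditive up to a constant under
addition, but the logarithm of the height is. In the cross-multiplied fraction, each of the two
terms of the numerator is at most the product of the heights. -/
theorem ratHeight_add_le (p q : ℚ) : ratHeight (p + q) ≤ 2 * (ratHeight p * ratHeight q) := by
  have hp : (p.den : ℚ) ≠ 0 := by simp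
  have hq : (q.den : ℚ) ≠ 0 := by simp
  have h : p + q = Rat.divInt (p.num * q.den + p.den * q.num) (p.den * q.den) := by
    rw [Rat.divInt_eq_div]
    push_cast
    rw [← div_add_div _ _ hp hq, Rat.num_div_den, Rat.num_div_den]
  rw [h]
  refine (ratHeight_divInt_le _ _ (by simp)).trans (max_le ?_ ?_)
  · refine (Int.natAbs_add_le _ _).trans ?_
    rw [Int.natAbs_mul, Int.natAbs_mul]
    have h1 : p.num.natAbs * (q.den : ℤ).natAbs ≤ ratHeight p * ratHeight q :=
      Nat.mul_le_mul (le_max_left _ _) (le_max_right _ _)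
    have h2 : (p.den : ℤ).natAbs * q.num.natAbs ≤ ratHeight p * ratHeight q :=
      Nat.mul_le_mul (le_max_right _ _) (le_max_left _ _)
    omega
  · rw [Int.natAbs_mul]
    have h1 : (p.den : ℤ).natAbs * (q.den : ℤ).natAbs ≤ ratHeight p * ratHeight q :=
      Nat.mul_le_mul (le_max_right _ _) (le_max_right _ _)
    omega

theorem size_ratHeight_mul_le (p q : ℚ) :
    (ratHeight (p * q)).size ≤ (ratHeight p).size + (ratHeight q).size :=
  (Nat.size_le_size (ratHeight_mul_le p q)).trans (size_mul_le _ _)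

theorem size_ratHeight_add_le (p q : ℚ) :
    (ratHeight (p + q)).size ≤ (ratHeight p).size + (ratHeight q).size + 1 := by
  refine (Nat.size_le_size (ratHeight_add_le p q)).trans ?_
  have h := size_mul_le (ratHeight p) (ratHeight q)
  rw [Nat.size_le]
  have h1 := Nat.lt_size_self (ratHeight p * ratHeight q)
  have h2 := Nat.pow_le_pow_right (n := 2) (by simp) h
  rw [pow_succ]
  omega

/-- Bit costs for rational numbers. -/
def CostModel.rat : CostModel ℚ where
  sz := ratBits
  ht := fun q => (ratHeight q).size
  sz_le := fun q => by
    have h1 := Nat.size_le_size (le_max_left q.num.natAbs q.den)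
    have h2 := Nat.size_le_size (le_max_right q.num.natAbs q.den)
    unfold ratBits ratHeight
    omega
  ht_le := fun q => by
    unfold ratBits ratHeight
    rcases max_cases q.num.natAbs q.den with ⟨h, -⟩ | ⟨h, -⟩ <;> rw [h] <;> omega
  ht_nat := fun m => by
    rcases Nat.eq_zero_or_pos m with rfl | hm
    · simp [ratHeight]
    · have : ratHeight (m : ℚ) = m := by
        simp [ratHeight]
        omega
      simp only [this]
      omega
  ht_add := size_ratHeight_add_le
  ht_sub := fun x y => by
    rw [sub_eq_add_neg, ← ratHeight_neg y]
    exact size_ratHeight_add_le x (-y)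
  ht_mul := fun x y => (size_ratHeight_mul_le x y).trans (Nat.le_succ _)
  ht_div := fun x y => by
    rw [div_eq_mul_inv]
    have := size_ratHeight_mul_le x y⁻¹
    have := Nat.size_le_size (ratHeight_inv y)
    omega

end CostModel

/-! ### Updates of configurations. -/

section Updates

variable {K : Type}

/-- Updating a register. -/
def State.setReg (s : State K) (r v : ℕ) : State K :=
  { s with reg := Function.update s.reg r v }

/-- Updating a memory cell. -/
def State.setMem (s : State K) (a v : ℕ) : State K :=
  { s with mem := Function.update s.mem a v }

/-- Updating a cell of the memory for field elements. -/
def State.setNum (s : State K) (a : ℕ) (v : K) : State K :=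
  { s with num := Function.update s.num a v }

@[simp] theorem State.setReg_reg (s : State K) (r v r' : ℕ) :
    (s.setReg r v).reg r' = if r' = r then v else s.reg r' := by
  simp [State.setReg, Function.update_apply]

@[simp] theorem State.setReg_mem (s : State K) (r v : ℕ) : (s.setReg r v).mem = s.mem := rfl

@[simp] theorem State.setReg_num (s : State K) (r v : ℕ) : (s.setReg r v).num = s.num := rfl

@[simp] theorem State.setMem_reg (s : State K) (a v : ℕ) : (s.setMem a v).reg = s.reg := rfl

@[simp] theorem State.setMem_num (s : State K) (a v : ℕ) : (s.setMem a v).num = s.num := rfl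

theorem State.setMem_mem (s : State K) (a v a' : ℕ) :
    (s.setMem a v).mem a' = if a' = a then v else s.mem a' := by
  simp [State.setMem, Function.update_apply]

@[simp] theorem State.setNum_reg (s : State K) (a : ℕ) (v : K) : (s.setNum a v).reg = s.reg := rfl

@[simp] theorem State.setNum_mem (s : State K) (a : ℕ) (v : K) : (s.setNum a v).mem = s.mem := rfl

theorem State.setNum_num (s : State K) (a : ℕ) (v : K) (a' : ℕ) :
    (s.setNum a v).num a' = if a' = a then v else s.num a' := by
  simp [State.setNum, Function.update_apply]

end Updates

/-! ### A program logic with step counts and bit bounds. -/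

section Runs

/-- A measure of the length of an expression. -/
def NExpr.nodes : NExpr → ℕ
  | .const c => c.size + 1
  | .reg _ => 1
  | .load a => a.nodes + 1
  | .add a b => a.nodes + b.nodes + 1
  | .sub a b => a.nodes + b.nodes + 1
  | .mul a b => a.nodes + b.nodes + 1
  | .div a b => a.nodes + b.nodes + 1

/-- A measure of the length of an expression. -/
def KExpr.nodes : KExpr → ℕ
  | .ofNat e => e.nodes + 1
  | .load e => e.nodes + 1
  | .add a b => a.nodes + b.nodes + 1
  | .sub a b => a.nodes + b.nodes + 1
  | .mul a b => a.nodes + b.nodes + 1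
  | .div a b => a.nodes + b.nodes + 1

variable {K : Type} [Field K] (M : CostModel K) (W : ℕ)

/-- All numbers in the configuration have at most `W` bits. -/
structure Bounded (s : State K) : Prop where
  reg : ∀ r, s.reg r < 2 ^ W
  mem : ∀ a, s.mem a < 2 ^ W
  num : ∀ a, M.ht (s.num a) ≤ W

variable {M W}

/-- No operation yields more bits than its operands have together, plus one; constants are paid for
because `nodes` counts their bits. -/
theorem Bounded.size_eval {s : State K} (h : Bounded M W s) (e : NExpr) :
    (e.eval s).size ≤ e.nodes * (W + 1) := by
  induction e with
  | const c =>
    simp only [NExpr.eval, NExpr.nodes]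
    nlinarith [Nat.zero_le (c.size * W)]
  | reg r =>
    simp only [NExpr.eval, NExpr.nodes]
    have := Nat.size_le.2 (h.reg r)
    omega
  | load a _ =>
    simp only [NExpr.eval, NExpr.nodes]
    have := Nat.size_le.2 (h.mem (a.eval s))
    nlinarith [Nat.zero_le (a.nodes * (W + 1))]
  | add a b iha ihb =>
    simp only [NExpr.eval, NExpr.nodes]
    have := size_add_le (a.eval s) (b.eval s)
    nlinarith
  | sub a b iha ihb =>
    simp only [NExpr.eval, NExpr.nodes]
    have := Nat.size_le_size (Nat.sub_le (a.eval s) (b.eval s))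
    nlinarith [Nat.zero_le (b.nodes * (W + 1))]
  | mul a b iha ihb =>
    simp only [NExpr.eval, NExpr.nodes]
    have := size_mul_le (a.eval s) (b.eval s)
    nlinarith
  | div a b iha ihb =>
    simp only [NExpr.eval, NExpr.nodes]
    have := Nat.size_le_size (Nat.div_le_self (a.eval s) (b.eval s))
    nlinarith [Nat.zero_le (b.nodes * (W + 1))]

/-- The induction step for a quadratic cost bound: each node pays for a value of length linear in
its subtree, and `(a + b + 1) ^ 2` exceeds `a ^ 2 + b ^ 2` by at least `a + b + 1`. -/
theorem cost_node_le {ca cb v a b W c : ℕ} (ha : ca ≤ c * a ^ 2 * (W + 1))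
    (hb : cb ≤ c * b ^ 2 * (W + 1)) (hv : v + 1 ≤ c * (a + b + 1) * (W + 1)) :
    ca + cb + v + 1 ≤ c * (a + b + 1) ^ 2 * (W + 1) := by
  have h : c * (a + b + 1) ^ 2 * (W + 1) = c * a ^ 2 * (W + 1) + c * b ^ 2 * (W + 1) +
      c * (a + b + 1) * (W + 1) + c * (2 * a * b + a + b) * (W + 1) := by ring
  rw [h]
  have := Nat.zero_le (c * (2 * a * b + a + b) * (W + 1))
  omega

theorem cost_node_le' {ca v a W c : ℕ} (ha : ca ≤ c * a ^ 2 * (W + 1))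
    (hv : v + 1 ≤ c * (a + 1) * (W + 1)) :
    ca + v + 1 ≤ c * (a + 1) ^ 2 * (W + 1) := by
  have := cost_node_le (cb := 0) (b := 0) ha (by simp) (by simpa using hv)
  simpa using this

theorem Bounded.cost_le {s : State K} (h : Bounded M W s) (e : NExpr) :
    e.cost s ≤ 2 * e.nodes ^ 2 * (W + 1) := by
  have key : ∀ e : NExpr, (e.eval s).size + 1 ≤ 2 * e.nodes * (W + 1) := by
    intro e
    have h1 := h.size_eval e
    have h2 : 1 ≤ e.nodes := by cases e <;> simp [NExpr.nodes]
    nlinarith [Nat.mul_le_mul_right (W + 1) h2]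
  induction e with
  | const c =>
    have := key (.const c)
    simp only [NExpr.eval, NExpr.cost, NExpr.nodes] at this ⊢
    nlinarith [Nat.zero_le (c.size ^ 2), Nat.zero_le (c.size ^ 2 * W), Nat.zero_le (c.size * W)]
  | reg r => exact key (.reg r)
  | load a ih => exact cost_node_le' ih (key (.load a))
  | add a b iha ihb => exact cost_node_le iha ihb (key (.add a b))
  | sub a b iha ihb => exact cost_node_le iha ihb (key (.sub a b))
  | mul a b iha ihb => exact cost_node_le iha ihb (key (.mul a b))
  | div a b iha ihb => exact cost_node_le iha ihb (key (.div a b))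

theorem Bounded.ht_eval {s : State K} (h : Bounded M W s) (e : KExpr) :
    M.ht (e.eval s) ≤ e.nodes * (W + 1) := by
  induction e with
  | ofNat e =>
    simp only [KExpr.eval, KExpr.nodes]
    have h1 := h.size_eval e
    have h2 := M.ht_nat (e.eval s)
    nlinarith
  | load e =>
    simp only [KExpr.eval, KExpr.nodes]
    have := h.num (e.eval s)
    nlinarith [Nat.zero_le (e.nodes * (W + 1))]
  | add a b iha ihb =>
    simp only [KExpr.eval, KExpr.nodes]
    nlinarith [M.ht_add (a.eval s) (b.eval s)]
  | sub a b iha ihb =>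
    simp only [KExpr.eval, KExpr.nodes]
    nlinarith [M.ht_sub (a.eval s) (b.eval s)]
  | mul a b iha ihb =>
    simp only [KExpr.eval, KExpr.nodes]
    nlinarith [M.ht_mul (a.eval s) (b.eval s)]
  | div a b iha ihb =>
    simp only [KExpr.eval, KExpr.nodes]
    nlinarith [M.ht_div (a.eval s) (b.eval s)]

theorem Bounded.kcost_le {s : State K} (h : Bounded M W s) (e : KExpr) :
    e.cost M.sz s ≤ 4 * e.nodes ^ 2 * (W + 1) := by
  have key : ∀ e : KExpr, M.sz (e.eval s) + 1 ≤ 4 * e.nodes * (W + 1) := by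
    intro e
    have h1 := h.ht_eval e
    have h2 : 1 ≤ e.nodes := by cases e <;> simp [KExpr.nodes]
    have h3 := M.sz_le (e.eval s)
    nlinarith [Nat.mul_le_mul_right (W + 1) h2]
  have hN : ∀ e : NExpr, e.cost s ≤ 4 * e.nodes ^ 2 * (W + 1) := fun e =>
    (h.cost_le e).trans (by
      have := Nat.zero_le (2 * e.nodes ^ 2 * (W + 1))
      have h2 : 4 * e.nodes ^ 2 * (W + 1) = 2 * (2 * e.nodes ^ 2 * (W + 1)) := by ring
      omega)
  induction e with
  | ofNat e => exact cost_node_le' (hN e) (key (.ofNat e))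
  | load e => exact cost_node_le' (hN e) (key (.load e))
  | add a b iha ihb => exact cost_node_le iha ihb (key (.add a b))
  | sub a b iha ihb => exact cost_node_le iha ihb (key (.sub a b))
  | mul a b iha ihb => exact cost_node_le iha ihb (key (.mul a b))
  | div a b iha ihb => exact cost_node_le iha ihb (key (.div a b))

theorem Bounded.setReg {s : State K} (h : Bounded M W s) {r v : ℕ} (hv : v < 2 ^ W) :
    Bounded M W (s.setReg r v) :=
  ⟨fun r' => by rw [State.setReg_reg]; split_ifs; exacts [hv, h.reg r'], h.mem, h.num⟩

theorem Bounded.setMem {s : State K} (h : Bounded M W s) {a v : ℕ} (hv : v < 2 ^ W) :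
    Bounded M W (s.setMem a v) :=
  ⟨h.reg, fun a' => by rw [State.setMem_mem]; split_ifs; exacts [hv, h.mem a'], h.num⟩

theorem Bounded.setNum {s : State K} (h : Bounded M W s) {a : ℕ} {v : K} (hv : M.ht v ≤ W) :
    Bounded M W (s.setNum a v) :=
  ⟨h.reg, h.mem, fun a' => by rw [State.setNum_num]; split_ifs; exacts [hv, h.num a']⟩

/-- A bound for the cost of a statement in configurations with at most `W` bits. -/
def stepCost (W : ℕ) : ℕ := 400000 * (W + 1)

variable (M W)

/-- Started in `s` with numbers of at most `W` bits, the program `c` halts after at most `N`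
statements, the numbers never having more than `W` bits, and `Q` holds afterwards. -/
def Runs (c : Program) (s : State K) (N : ℕ) (Q : State K → Prop) : Prop :=
  Bounded M W s → ∃ s' t, Exec M.sz c s s' t ∧ t ≤ N * stepCost W ∧ Bounded M W s' ∧ Q s'

variable {M W}

theorem Runs.mono {c : Program} {s : State K} {N N' : ℕ} {Q Q' : State K → Prop}
    (h : Runs M W c s N Q) (hN : N ≤ N') (hQ : ∀ s', Q s' → Q' s') : Runs M W c s N' Q' :=
  fun hb =>
    let ⟨s', t, h1, h2, h3, h4⟩ := h hb
    ⟨s', t, h1, h2.trans (Nat.mul_le_mul_right _ hN), h3, hQ s' h4⟩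

/-- `Runs` presupposes that the initial configuration is bounded, so that bound may be used in
proving it. -/
theorem Runs.of_bounded {c : Program} {s : State K} {N : ℕ} {Q : State K → Prop}
    (h : Bounded M W s → Runs M W c s N Q) : Runs M W c s N Q := fun hb => h hb hb

theorem Runs.skip {s : State K} {N : ℕ} {Q : State K → Prop} (h : Q s) :
    Runs M W .skip s (N + 1) Q := fun hb =>
  ⟨s, 1, .skip s, by unfold stepCost; nlinarith [Nat.zero_le (N * (400000 * (W + 1)))], hb, h⟩

/-- Here `160000 = 4 * 200 ^ 2`. A statement evaluates at most two expressions, which leaves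
`stepCost` room for its constant overhead. -/
theorem stepCost_le_of_nodes {a W c : ℕ} (ha : a ≤ 200) (hc : c ≤ 4 * a ^ 2 * (W + 1)) :
    c ≤ 160000 * (W + 1) := by
  have : a ^ 2 ≤ 200 ^ 2 := Nat.pow_le_pow_left ha 2
  exact hc.trans (Nat.mul_le_mul_right _ (by omega))

theorem Bounded.cost_le_of_nodes {s : State K} (h : Bounded M W s) {e : NExpr}
    (he : e.nodes ≤ 200) : e.cost s ≤ 160000 * (W + 1) :=
  stepCost_le_of_nodes he ((h.cost_le e).trans (Nat.mul_le_mul_right _ (by omega)))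

theorem Runs.setReg {r : ℕ} {e : NExpr} {s : State K} {N : ℕ} {Q : State K → Prop}
    (he : e.nodes ≤ 200) (hv : e.eval s < 2 ^ W) (h : Q (s.setReg r (e.eval s))) :
    Runs M W (.setReg r e) s (N + 1) Q := fun hb =>
  ⟨_, _, .setReg r e s, by
    have := hb.cost_le_of_nodes he
    unfold stepCost
    nlinarith [Nat.zero_le (N * (400000 * (W + 1)))], hb.setReg hv, h⟩

theorem Runs.setMem {a e : NExpr} {s : State K} {N : ℕ} {Q : State K → Prop}
    (ha : a.nodes ≤ 200) (he : e.nodes ≤ 200) (hv : e.eval s < 2 ^ W)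
    (h : Q (s.setMem (a.eval s) (e.eval s))) :
    Runs M W (.setMem a e) s (N + 1) Q := fun hb =>
  ⟨_, _, .setMem a e s, by
    have := hb.cost_le_of_nodes he
    have := hb.cost_le_of_nodes ha
    unfold stepCost
    nlinarith [Nat.zero_le (N * (400000 * (W + 1)))], hb.setMem hv, h⟩

theorem Runs.setNum {a : NExpr} {e : KExpr} {s : State K} {N : ℕ} {Q : State K → Prop}
    (ha : a.nodes ≤ 200) (he : e.nodes ≤ 200) (hv : M.ht (e.eval s) ≤ W)
    (h : Q (s.setNum (a.eval s) (e.eval s))) :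
    Runs M W (.setNum a e) s (N + 1) Q := fun hb =>
  ⟨_, _, .setNum a e s, by
    have := stepCost_le_of_nodes he (hb.kcost_le e)
    have := hb.cost_le_of_nodes ha
    unfold stepCost
    nlinarith [Nat.zero_le (N * (400000 * (W + 1)))], hb.setNum hv, h⟩

theorem Runs.seq {c d : Program} {s : State K} {N₁ N₂ : ℕ} {Q : State K → Prop}
    (h : Runs M W c s N₁ fun s' => Runs M W d s' N₂ Q) :
    Runs M W (.seq c d) s (N₁ + N₂) Q := fun hb =>
  let ⟨_, _, h1, h2, h3, h4⟩ := h hb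
  let ⟨s'', _, h1', h2', h3', h4'⟩ := h4 h3
  ⟨s'', _, .seq h1 h1', by rw [Nat.add_mul]; omega, h3', h4'⟩

theorem Runs.seq' {c d : Program} {s : State K} {N₁ N₂ N : ℕ} {P Q : State K → Prop}
    (h : Runs M W c s N₁ P) (h' : ∀ s', P s' → Runs M W d s' N₂ Q) (hN : N₁ + N₂ ≤ N) :
    Runs M W (.seq c d) s N Q :=
  (Runs.seq (h.mono le_rfl h')).mono hN fun _ => id

/-- A register is set first. -/
theorem Runs.setReg_seq {r : ℕ} {e : NExpr} {d : Program} {s : State K} {N : ℕ}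
    {Q : State K → Prop} (he : e.nodes ≤ 200) (hv : e.eval s < 2 ^ W)
    (h : Runs M W d (s.setReg r (e.eval s)) N Q) :
    Runs M W (.seq (.setReg r e) d) s (N + 1) Q :=
  (Runs.seq (Runs.setReg (N := 0) he hv h)).mono (by omega) fun _ => id

/-- A memory cell is set first. -/
theorem Runs.setMem_seq {a e : NExpr} {d : Program} {s : State K} {N : ℕ}
    {Q : State K → Prop} (ha : a.nodes ≤ 200) (he : e.nodes ≤ 200) (hv : e.eval s < 2 ^ W)
    (h : Runs M W d (s.setMem (a.eval s) (e.eval s)) N Q) :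
    Runs M W (.seq (.setMem a e) d) s (N + 1) Q :=
  (Runs.seq (Runs.setMem (N := 0) ha he hv h)).mono (by omega) fun _ => id

theorem Runs.ite {e : NExpr} {c d : Program} {s : State K} {N : ℕ} {Q : State K → Prop}
    (he : e.nodes ≤ 200) (h₁ : e.eval s ≠ 0 → Runs M W c s N Q)
    (h₂ : e.eval s = 0 → Runs M W d s N Q) : Runs M W (.ite e c d) s (N + 1) Q := fun hb => by
  have hc := hb.cost_le_of_nodes he
  by_cases h : e.eval s = 0
  · obtain ⟨s', t, h1, h2, h3, h4⟩ := h₂ h hb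
    refine ⟨s', _, .iteFalse h h1, ?_, h3, h4⟩
    rw [Nat.add_mul]
    unfold stepCost at h2 ⊢
    omega
  · obtain ⟨s', t, h1, h2, h3, h4⟩ := h₁ h hb
    refine ⟨s', _, .iteTrue h h1, ?_, h3, h4⟩
    rw [Nat.add_mul]
    unfold stepCost at h2 ⊢
    omega

/-- A loop with an invariant indexed by the number of rounds still to come. -/
theorem Runs.while {e : NExpr} {c : Program} {N : ℕ} (I : ℕ → State K → Prop)
    (he : e.nodes ≤ 200) (hI : ∀ k s, I (k + 1) s → e.eval s ≠ 0 ∧ Runs M W c s N (I k))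
    (h0 : ∀ s, I 0 s → e.eval s = 0) :
    ∀ k s, I k s → Runs M W (.while e c) s (k * (N + 1) + 1) (I 0) := by
  intro k
  induction k with
  | zero =>
    intro s hs hb
    have hc := hb.cost_le_of_nodes he
    exact ⟨s, _, .whileFalse (h0 s hs), by unfold stepCost; omega, hb, hs⟩
  | succ k ih =>
    intro s hs hb
    have hc := hb.cost_le_of_nodes he
    obtain ⟨hne, hr⟩ := hI k s hs
    obtain ⟨s', t, h1, h2, h3, h4⟩ := hr hb
    obtain ⟨s'', t', h1', h2', h3', h4'⟩ := ih s' h4 h3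
    refine ⟨s'', _, .whileTrue hne h1 h1', ?_, h3', h4'⟩
    have h5 : ((k + 1) * (N + 1) + 1) * stepCost W =
      (k * (N + 1) + 1) * stepCost W + N * stepCost W + stepCost W := by ring
    rw [h5]
    have h6 : 160000 * (W + 1) + 1 ≤ stepCost W := by unfold stepCost; omega
    omega

end Runs

/-! ### Loops over the nodes and over the blocks of the input. -/

section Loops

variable {K : Type} [Field K] {M : CostModel K} {W : ℕ}

/-- The number of players, which is the content of cell `0`. -/
def playersE : NExpr := .load (.const 0)

/-- The loop for `r = 0, …, n`, where `n` is the content of cell `0`. -/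
def forPlayers (r : ℕ) (c : Program) : Program :=
  .seq (.setReg r (.const 0))
    (.while (.sub (.add playersE (.const 1)) (.reg r))
      (.seq c (.setReg r (.add (.reg r) (.const 1)))))

theorem Runs.forPlayers {r n N : ℕ} {c : Program} {s : State K} (I : ℕ → State K → Prop)
    (hW : n + 1 < 2 ^ W) (hn : ∀ k s, I k s → s.mem 0 = n ∧ s.reg r = k)
    (h0 : I 0 (s.setReg r 0))
    (hc : ∀ k s, k ≤ n → I k s →
      Runs M W c s N fun s' => s'.reg r = k ∧ I (k + 1) (s'.setReg r (k + 1))) :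
    Runs M W (forPlayers r c) s ((n + 1) * (N + 2) + 2) (I (n + 1)) := by
  refine Runs.setReg_seq (N := (n + 1) * (N + 1 + 1) + 1) (by decide) (by
    simp [NExpr.eval]) ?_
  have := Runs.while (M := M) (W := W) (e := .sub (.add playersE (.const 1)) (.reg r))
    (c := .seq c (.setReg r (.add (.reg r) (.const 1)))) (N := N + 1)
    -- The rule for loops counts the rounds still to come, so the round index is `n + 1 - k`.
    (fun k s => k ≤ n + 1 ∧ I (n + 1 - k) s) (by simp [NExpr.nodes, playersE]) ?_ ?_
    (n + 1) (s.setReg r 0) ⟨le_rfl, by simpa using h0⟩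
  · exact this.mono le_rfl fun s' h => by simpa using h.2
  · rintro k s ⟨hk, hI⟩
    obtain ⟨h1, h2⟩ := hn _ _ hI
    refine ⟨by simp [NExpr.eval, playersE, h1, h2]; omega, ?_⟩
    refine Runs.seq' (hc _ s (by omega) hI) (N₂ := 1) (fun s' hs' => ?_) le_rfl
    refine Runs.setReg (N := 0) (by simp [NExpr.nodes]) ?_ ?_
    · simp only [NExpr.eval, hs'.1]
      omega
    · simp only [NExpr.eval, hs'.1]
      have : n + 1 - k = n + 1 - (k + 1) + 1 := by omega
      exact ⟨by omega, this ▸ hs'.2⟩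
  · rintro s ⟨-, hI⟩
    obtain ⟨h1, h2⟩ := hn _ _ hI
    simp [NExpr.eval, playersE, h1, h2]

/-- The list `l` occurs in the list `inp` from position `a` on. -/
def OccursAt (inp : List ℕ) (a : ℕ) (l : List ℕ) : Prop :=
  ∃ pre post, inp = pre ++ l ++ post ∧ pre.length = a

theorem OccursAt.left {inp : List ℕ} {a : ℕ} {l l' : List ℕ} (h : OccursAt inp a (l ++ l')) :
    OccursAt inp a l := by
  obtain ⟨pre, post, h1, h2⟩ := h
  exact ⟨pre, l' ++ post, by simp [h1], h2⟩

theorem OccursAt.right {inp : List ℕ} {a : ℕ} {l l' : List ℕ} (h : OccursAt inp a (l ++ l')) :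
    OccursAt inp (a + l.length) l' := by
  obtain ⟨pre, post, h1, h2⟩ := h
  exact ⟨pre ++ l, post, by simp [h1], by simp [h2]⟩

theorem OccursAt.getD {inp : List ℕ} {a x : ℕ} {l : List ℕ} (h : OccursAt inp a (x :: l)) :
    inp.getD a 0 = x := by
  obtain ⟨pre, post, rfl, rfl⟩ := h
  simp

theorem OccursAt.le {inp : List ℕ} {a : ℕ} {l : List ℕ} (h : OccursAt inp a l) :
    a + l.length ≤ inp.length := by
  obtain ⟨pre, post, rfl, rfl⟩ := h
  simp

/-- The loop over the blocks of a list of blocks, with pointer `p` and counter `c`; the body has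
to advance the pointer. -/
def forBlocks (p c : ℕ) (body : Program) : Program :=
  .seq (.setReg c (.load (.reg p)))
    (.seq (.setReg p (.add (.reg p) (.const 1)))
      (.while (.reg c) (.seq body (.setReg c (.sub (.reg c) (.const 1))))))

/-- The position of the block that follows the blocks `done`. -/
def blockPos {α : Type} (a : ℕ) (enc : α → List ℕ) (done : List α) : ℕ :=
  a + 1 + (done.map enc).flatten.length

/-- The code delimits itself: the end of one block is the start of the next, so it is enough that
the body leaves the pointer behind its block. Nested loops can share the pointer and need separate
counters only. The bound `X` on the number of blocks makes the step count independent of the list.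
-/
theorem Runs.forBlocks {α : Type} {p c : ℕ} (hpc : p ≠ c) {body : Program} {inp : List ℕ}
    {enc : α → List ℕ} {l : List α} {a N X : ℕ} {s : State K} (I : List α → State K → Prop)
    (hmem : ∀ t < inp.length, s.mem t = inp.getD t 0)
    (hW : inp.length < 2 ^ W) (hX : l.length ≤ X) (hXW : X < 2 ^ W)
    (hocc : OccursAt inp a (encodeBlocks (l.map enc))) (hp : s.reg p = a)
    (h0 : I [] ((s.setReg c l.length).setReg p (a + 1)))
    (hc : ∀ done x todo s, l = done ++ x :: todo → OccursAt inp (blockPos a enc done) (enc x) →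
      I done s → s.reg p = blockPos a enc done → s.reg c = todo.length + 1 →
      Runs M W body s N fun s' => s'.reg c = todo.length + 1 ∧
        s'.reg p = blockPos a enc done + (enc x).length ∧
        I (done ++ [x]) (s'.setReg c todo.length)) :
    Runs M W (MCNets.forBlocks p c body) s (X * (N + 2) + 3) fun s' =>
      I l s' ∧ s'.reg p = a + (encodeBlocks (l.map enc)).length ∧ s'.reg c = 0 := by
  have hlen := hocc.le
  have h1 : s.mem a = l.length := by
    rw [hmem a (by simp [encodeBlocks] at hlen; omega)]
    simpa using OccursAt.getD hocc
  have hlt : a + 1 ≤ inp.length := by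
    simp only [encodeBlocks, List.length_cons] at hlen
    omega
  have hmul : l.length * (N + 2) ≤ X * (N + 2) := Nat.mul_le_mul_right _ hX
  refine Runs.mono (N := l.length * (N + 1 + 1) + 1 + 1 + 1) ?_ (by
    show l.length * (N + 2) + 1 + 1 + 1 ≤ _
    omega) fun _ => id
  refine Runs.setReg_seq (by simp [NExpr.nodes]) (by
    simp only [NExpr.eval, hp, h1]; omega) ?_
  refine Runs.setReg_seq (by simp [NExpr.nodes]) (by
    simp only [NExpr.eval, State.setReg_reg, hp, if_neg hpc]; omega) ?_
  simp only [NExpr.eval, State.setReg_reg, hp, if_neg hpc, h1]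
  have hw := Runs.while (M := M) (W := W) (e := .reg c)
    (c := .seq body (.setReg c (.sub (.reg c) (.const 1)))) (N := N + 1)
    (fun k s => ∃ done todo, l = done ++ todo ∧ todo.length = k ∧ I done s ∧ s.reg c = k ∧
      s.reg p = blockPos a enc done) (by simp [NExpr.nodes]) ?_ ?_
    l.length ((s.setReg c l.length).setReg p (a + 1)) ?_
  · refine hw.mono le_rfl ?_
    rintro s' ⟨done, todo, rfl, ht, hI, hc', hp'⟩
    obtain rfl := List.length_eq_zero_iff.1 ht
    rw [List.append_nil]
    refine ⟨hI, ?_, hc'⟩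
    rw [hp', blockPos, encodeBlocks, List.length_cons]
    omega
  · rintro k s ⟨done, todo, rfl, ht, hI, hc', hp'⟩
    obtain ⟨x, todo, rfl⟩ := List.exists_cons_of_length_pos (l := todo) (by omega)
    rw [List.length_cons, Nat.add_right_cancel_iff] at ht
    subst ht
    refine ⟨by simp [NExpr.eval, hc'], ?_⟩
    have hx : OccursAt inp (blockPos a enc done) (enc x) := by
      have := hocc
      rw [encodeBlocks, ← List.singleton_append, List.map_append, List.flatten_append,
        List.map_cons, List.flatten_cons] at this
      simpa [blockPos] using this.right.right.left
    refine Runs.seq' (hc done x todo s rfl hx hI hp' hc') (N₂ := 1) (fun s' hs' => ?_) le_rfl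
    obtain ⟨h1', h2', h3'⟩ := hs'
    simp only [List.length_append, List.length_cons] at hX
    refine Runs.setReg (N := 0) (by simp [NExpr.nodes]) ?_ ?_
    · simp only [NExpr.eval, h1']
      omega
    · simp only [NExpr.eval, h1', Nat.add_sub_cancel]
      refine ⟨done ++ [x], todo, by simp, rfl, h3', by simp, ?_⟩
      rw [State.setReg_reg, if_neg hpc, h2']
      simp [blockPos, Nat.add_assoc]
  · rintro s' ⟨done, todo, rfl, ht, hI, hc', hp'⟩
    simpa [NExpr.eval] using hc'
  · exact ⟨[], l, rfl, rfl, h0, by simp [Ne.symm hpc], by simp [blockPos]⟩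

end Loops

/-! ### Memory layout, invariants and frame conditions. -/

section Environment

/-- The data of an input, with a size parameter `X` and a bound `W` for bit lengths. -/
structure Env where
  n : ℕ
  i : ℕ
  inp : List ℕ
  X : ℕ
  W : ℕ
  inp_zero : inp.getD 0 0 = n
  inp_one : inp.getD 1 0 = i
  length_pos : 3 ≤ inp.length
  i_lt : i < n
  n_lt : n < X
  length_le : inp.length ≤ 20 * X
  le_W : 10 * (X + 10) ^ 3 ≤ W

theorem Env.linear_le (E : Env) : 1000 * E.X + 1000 ≤ E.W := by
  refine le_trans ?_ E.le_W
  nlinarith [Nat.zero_le (E.X ^ 3), Nat.zero_le (E.X ^ 2)]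

theorem Env.small (E : Env) {v : ℕ} (h : v ≤ 1000 * E.X + 1000) : v < 2 ^ E.W :=
  (h.trans E.linear_le).trans_lt Nat.lt_two_pow_self

theorem Env.bool_small (E : Env) (b : Bool) : b.toNat < 2 ^ E.W :=
  E.small (by have := b.toNat_le; omega)

/-- The first free memory cell, from which on the working arrays are interleaved. -/
def Env.base (E : Env) : ℕ := E.inp.length

/-- The memory holds the input. -/
def Env.Input {K : Type} (E : Env) (s : State K) : Prop :=
  ∀ t < E.inp.length, s.mem t = E.inp.getD t 0

/-- The memory holds the input and the factorials, and the two global registers are set. -/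
structure Env.Ready {K : Type} (E : Env) (s : State K) : Prop where
  input : E.Input s
  base : s.reg 0 = E.base
  radix : s.reg 1 = 2 ^ (E.n + 1)
  fact : ∀ v ≤ E.n, s.mem (E.base + 3 * v + 2) = v.factorial

/-- The system `σ` is stored in the memory. -/
structure Env.Stores {K : Type} (E : Env) (σ : Links) (s : State K) : Prop where
  rep : ∀ w ≤ E.n, s.mem (E.base + 3 * w) = σ.rep w
  par : ∀ w ≤ E.n, s.mem (E.base + 3 * w + 1) = (σ.par w).toNat
  ok : s.reg 9 = σ.ok.toNat

/-- The stored system has the coalitions with property `C` as solutions. -/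
def Env.Solves {K : Type} (E : Env) (C : Finset (Fin E.n) → Prop) (s : State K) : Prop :=
  ∃ σ : Links, σ.WF E.n ∧ E.Stores σ s ∧ ∀ S : Finset (Fin E.n), σ.Sol (charFun S) ↔ C S

/-- Only registers from `m` on and the stored system have changed. -/
structure Env.Keeps {K : Type} (E : Env) (m : ℕ) (s s' : State K) : Prop where
  reg : ∀ r < m, r ≠ 9 → s'.reg r = s.reg r
  mem : ∀ a, (a < E.base ∨ (a - E.base) % 3 = 2) → s'.mem a = s.mem a
  num : s'.num = s.num

variable {K : Type} {E : Env}

theorem Env.Input.players {s : State K} (h : E.Input s) : s.mem 0 = E.n := by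
  rw [h 0 (by have := E.length_pos; omega), E.inp_zero]

theorem Env.Input.player {s : State K} (h : E.Input s) : s.mem 1 = E.i := by
  rw [h 1 (by have := E.length_pos; omega), E.inp_one]

theorem Env.Keeps.refl (m : ℕ) (s : State K) : E.Keeps m s s :=
  ⟨fun _ _ _ => rfl, fun _ _ => rfl, rfl⟩

theorem Env.Keeps.trans {m : ℕ} {s s' s'' : State K} (h : E.Keeps m s s')
    (h' : E.Keeps m s' s'') : E.Keeps m s s'' :=
  ⟨fun r hr h9 => (h'.reg r hr h9).trans (h.reg r hr h9),
    fun a ha => (h'.mem a ha).trans (h.mem a ha), h'.num.trans h.num⟩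

theorem Env.Keeps.mono {m m' : ℕ} {s s' : State K} (h : E.Keeps m s s') (hm : m' ≤ m) :
    E.Keeps m' s s' :=
  ⟨fun r hr => h.reg r (hr.trans_le hm), h.mem, h.num⟩

theorem Env.Keeps.setReg {m : ℕ} {s s' : State K} (h : E.Keeps m s s') {r : ℕ}
    (hr : m ≤ r ∨ r = 9) (v : ℕ) : E.Keeps m s (s'.setReg r v) :=
  ⟨fun r' hr' h9 => by rw [State.setReg_reg, if_neg (by omega)]; exact h.reg r' hr' h9,
    h.mem, h.num⟩

theorem Env.Keeps.setMem {m : ℕ} {s s' : State K} (h : E.Keeps m s s') {a : ℕ}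
    (ha : E.base ≤ a ∧ (a - E.base) % 3 ≠ 2) (v : ℕ) : E.Keeps m s (s'.setMem a v) :=
  ⟨h.reg, fun a' ha' => by
    rw [State.setMem_mem, if_neg (by rintro rfl; omega)]; exact h.mem a' ha', h.num⟩

theorem Env.Input.keeps {m : ℕ} {s s' : State K} (h : E.Input s) (hk : E.Keeps m s s') :
    E.Input s' := fun t ht => (hk.mem t (Or.inl ht)).trans (h t ht)

/-- Above `base`, the cells with offset `0`, `1`, `2` modulo `3` hold representatives, parities and
factorials. The frame condition protects the factorials and the input, and leaves register `9`, the
solvability flag, free. -/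
theorem Env.Ready.keeps {m : ℕ} {s s' : State K} (h : E.Ready s) (hk : E.Keeps m s s')
    (hm : 2 ≤ m) : E.Ready s' :=
  ⟨h.input.keeps hk, (hk.reg 0 (by omega) (by simp)).trans h.base,
    (hk.reg 1 (by omega) (by simp)).trans h.radix,
    fun v hv => (hk.mem _ (Or.inr (by omega))).trans (h.fact v hv)⟩

theorem Env.Ready.setReg {s : State K} (h : E.Ready s) {r : ℕ} (hr : 2 ≤ r) (v : ℕ) :
    E.Ready (s.setReg r v) := h.keeps ((Env.Keeps.refl 2 s).setReg (Or.inl hr) v) le_rfl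

theorem Env.Stores.setReg {σ : Links} {s : State K} (h : E.Stores σ s) {r : ℕ} (hr : r ≠ 9)
    (v : ℕ) : E.Stores σ (s.setReg r v) :=
  ⟨h.rep, h.par, by rw [State.setReg_reg, if_neg hr.symm]; exact h.ok⟩

theorem Env.Solves.setReg {C : Finset (Fin E.n) → Prop} {s : State K} (h : E.Solves C s) {r : ℕ}
    (hr : r ≠ 9) (v : ℕ) : E.Solves C (s.setReg r v) :=
  let ⟨σ, h1, h2, h3⟩ := h
  ⟨σ, h1, h2.setReg hr v, h3⟩

theorem Env.Solves.congr {C C' : Finset (Fin E.n) → Prop} {s : State K} (h : E.Solves C s)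
    (hC : ∀ S, C S ↔ C' S) : E.Solves C' s :=
  let ⟨σ, h1, h2, h3⟩ := h
  ⟨σ, h1, h2, fun S => (h3 S).trans (hC S)⟩

end Environment

/-! ### Implementation of the equation system. -/

section Union

/-- The address of the representative of the variable in register `r`. -/
def repE (r : ℕ) : NExpr := .add (.reg 0) (.mul (.const 3) (.reg r))

/-- The address of the parity of the variable in register `r`. -/
def parE (r : ℕ) : NExpr := .add (repE r) (.const 1)

/-- The absolute difference, which tests inequality. -/
def distE (a b : NExpr) : NExpr := .add (.sub a b) (.sub b a)

/-- Starting with a system without equations, whose solvability is the value of `e`. -/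
def initLinks (e : NExpr) : Program :=
  .seq (forPlayers 22 (.seq (.setMem (repE 22) (.reg 22)) (.setMem (parE 22) (.const 0))))
    (.setReg 9 e)

/-- Adding the equation between the variables in registers `16` and `17` given by register `18`. -/
def unionLinks : Program :=
  .seq (.setReg 19 (.load (repE 16))) <|
  .seq (.setReg 20 (.load (repE 17))) <|
  .seq (.setReg 21 (distE (distE (.load (parE 16)) (.load (parE 17))) (.reg 18))) <|
  .ite (distE (.reg 19) (.reg 20))
    (forPlayers 22
      (.ite (distE (.load (repE 22)) (.reg 20)) .skip
        (.seq (.setMem (parE 22) (distE (.load (parE 22)) (.reg 21)))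
          (.setMem (repE 22) (.reg 19)))))
    (.setReg 9 (.mul (.reg 9) (.sub (.const 1) (.reg 21))))

variable {K : Type}

@[simp] theorem eval_repE (s : State K) (r : ℕ) : (repE r).eval s = s.reg 0 + 3 * s.reg r := rfl

@[simp] theorem eval_parE (s : State K) (r : ℕ) :
    (parE r).eval s = s.reg 0 + 3 * s.reg r + 1 := rfl

@[simp] theorem eval_distE (s : State K) (a b : NExpr) :
    (distE a b).eval s = (a.eval s - b.eval s) + (b.eval s - a.eval s) := rfl

@[simp] theorem eval_playersE (s : State K) : playersE.eval s = s.mem 0 := rfl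

variable [Field K] {M : CostModel K} {E : Env}

/-- On bits the absolute difference is exclusive or, which makes parities accessible to the
arithmetic of the machine. -/
theorem toNat_dist (a b : Bool) :
    (a.toNat - b.toNat) + (b.toNat - a.toNat) = (a ^^ b).toNat := by
  cases a <;> cases b <;> rfl

theorem runs_initLinks {s : State K} (hs : E.Ready s) {e : NExpr} {b : Bool}
    (he : e.nodes ≤ 200) (hb : ∀ s', E.Keeps 16 s s' → e.eval s' = b.toNat) :
    Runs M E.W (initLinks e) s (E.X * 4 + 3) fun s' =>
      E.Solves (fun _ => b = true) s' ∧ E.Keeps 16 s s' := by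
  have hX := E.n_lt
  refine Runs.seq' (P := fun s' => E.Keeps 16 s s' ∧ (∀ w ≤ E.n, s'.mem (E.base + 3 * w) = w) ∧
    ∀ w ≤ E.n, s'.mem (E.base + 3 * w + 1) = 0) (N₁ := (E.n + 1) * (2 + 2) + 2) (N₂ := 1)
    ?_ (fun s' hs' => ?_) (by omega)
  · refine (Runs.forPlayers (fun k s' => s'.reg 22 = k ∧ E.Keeps 16 s s' ∧
      (∀ w < k, s'.mem (E.base + 3 * w) = w) ∧ ∀ w < k, s'.mem (E.base + 3 * w + 1) = 0)
      (E.small (by omega)) ?_ ?_ ?_).mono le_rfl ?_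
    · rintro k s' ⟨h1, h2, -⟩
      exact ⟨(hs.input.keeps h2).players, h1⟩
    · exact ⟨by simp, (Env.Keeps.refl 16 s).setReg (by simp) 0, by simp, by simp⟩
    · rintro k s' hk ⟨h1, h2, h3, h4⟩
      have h0 := (hs.keeps h2 (by simp)).base
      refine Runs.setMem_seq (N := 1) (by decide) (by decide) (by
        simp only [NExpr.eval, h1]; exact E.small (by omega)) ?_
      refine Runs.setMem (N := 0) (by decide) (by decide) (by simp [NExpr.eval]) ?_
      simp only [NExpr.eval, eval_repE, eval_parE, h0, h1, State.setMem_reg, State.setReg_mem,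
        State.setReg_reg, if_true, true_and]
      refine ⟨((h2.setMem (by omega) _).setMem (by omega) _).setReg (by simp) _, fun w hw => ?_,
        fun w hw => ?_⟩
      · rw [State.setMem_mem, State.setMem_mem, if_neg (by omega)]
        split_ifs with h
        · omega
        · exact h3 w (by omega)
      · rw [State.setMem_mem, State.setMem_mem]
        split_ifs with h h
        · rfl
        · omega
        · exact h4 w (by omega)
    · rintro s' ⟨-, h2, h3, h4⟩
      exact ⟨h2, fun w hw => h3 w (by omega), fun w hw => h4 w (by omega)⟩
  · obtain ⟨h2, h3, h4⟩ := hs'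
    refine Runs.setReg (N := 0) he (by rw [hb s' h2]; exact E.bool_small b) ?_
    rw [hb s' h2]
    refine ⟨⟨Links.init b, Links.init_wf b _, ⟨h3, fun w hw => ?_, by simp [Links.init]⟩,
      fun S => Links.init_sol b _⟩, h2.setReg (by simp) _⟩
    simpa [Links.init] using h4 w hw

/-- The table of representatives is flat, so no paths have to be followed; merging two classes is
one scan that relabels the class of `v`. -/
theorem runs_unionLinks {s : State K} (hs : E.Ready s) {C : Finset (Fin E.n) → Prop}
    (hC : E.Solves C s) {u v : ℕ} {e : Bool} (hu : s.reg 16 = u) (hv : s.reg 17 = v)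
    (he : s.reg 18 = e.toNat) (hun : u ≤ E.n) (hvn : v ≤ E.n) :
    Runs M E.W unionLinks s (E.X * 5 + 6) fun s' =>
      E.Solves (fun S => C S ∧ (charFun S u ^^ charFun S v) = e) s' ∧ E.Keeps 16 s s' := by
  have hX := E.n_lt
  obtain ⟨σ, hwf, hst, hsol⟩ := hC
  have hru := hwf.rep_le u hun
  have hrv := hwf.rep_le v hvn
  set d := (σ.par u ^^ σ.par v) ^^ e with hd
  refine Runs.mono (N := (E.n + 1) * (3 + 2) + 2 + 1 + 1 + 1 + 1) (Q := fun s' =>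
    E.Stores (σ.union u v e) s' ∧ E.Keeps 16 s s') ?_ (by omega) (fun s' hs' =>
      ⟨⟨σ.union u v e, hwf.union hun hvn e, hs'.1, fun S => by
        rw [hwf.sol_union, hsol]⟩, hs'.2⟩)
  have h1 : (NExpr.load (repE 16)).eval s = σ.rep u := by
    simp [NExpr.eval, hs.base, hu, hst.rep u hun]
  refine Runs.setReg_seq (by decide) (by rw [h1]; exact E.small (by omega)) ?_
  rw [h1]
  have h2 : (NExpr.load (repE 17)).eval (s.setReg 19 (σ.rep u)) = σ.rep v := by
    simp [NExpr.eval, hs.base, hv, hst.rep v hvn]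
  refine Runs.setReg_seq (by decide) (by rw [h2]; exact E.small (by omega)) ?_
  rw [h2]
  have h3 : (distE (distE (.load (parE 16)) (.load (parE 17))) (.reg 18)).eval
      ((s.setReg 19 (σ.rep u)).setReg 20 (σ.rep v)) = d.toNat := by
    simp [NExpr.eval, hs.base, hu, hv, he, hst.par v hvn, hst.par u hun, toNat_dist, hd]
  refine Runs.setReg_seq (by decide) (by rw [h3]; exact E.bool_small d) ?_
  rw [h3]
  set s₁ := ((s.setReg 19 (σ.rep u)).setReg 20 (σ.rep v)).setReg 21 d.toNat with hs₁
  have hk₁ : E.Keeps 16 s s₁ := (((Env.Keeps.refl 16 s).setReg (by simp) _).setReg (by simp)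
    _).setReg (by simp) _
  have hst₁ : E.Stores σ s₁ := ((hst.setReg (by simp) _).setReg (by simp) _).setReg (by simp) _
  have h19 : s₁.reg 19 = σ.rep u := by simp [hs₁]
  have h20 : s₁.reg 20 = σ.rep v := by simp [hs₁]
  have h21 : s₁.reg 21 = d.toNat := by simp [hs₁]
  have hr₁ := hs.keeps hk₁ (by simp)
  clear_value s₁
  refine Runs.ite (by decide) (fun hne => ?_) (fun heq => ?_)
  · have huv : σ.rep u ≠ σ.rep v := by
      simp only [NExpr.eval, eval_distE, h19, h20] at hne
      omega
    -- The first `k` nodes are already those of the new system. Updating in place is safe: a round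
    -- reads only the entries of its own node, and the two representatives and the parity shift were
    -- saved in registers `19` to `21` beforehand.
    refine (Runs.forPlayers (fun k s' => s'.reg 22 = k ∧ E.Keeps 22 s₁ s' ∧
      s'.reg 9 = σ.ok.toNat ∧
      (∀ w ≤ E.n, s'.mem (E.base + 3 * w) =
        if w < k then (σ.union u v e).rep w else σ.rep w) ∧
      ∀ w ≤ E.n, s'.mem (E.base + 3 * w + 1) =
        (if w < k then (σ.union u v e).par w else σ.par w).toNat)
      (E.small (by omega)) ?_ ?_ ?_).mono le_rfl ?_
    · rintro k s' ⟨h1, h2, -⟩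
      exact ⟨(hr₁.input.keeps h2).players, h1⟩
    · exact ⟨by simp, (Env.Keeps.refl 22 s₁).setReg (by simp) 0, by simp [hst₁.ok],
        fun w hw => by simpa using hst₁.rep w hw, fun w hw => by simpa using hst₁.par w hw⟩
    · rintro k s' hk ⟨h1, h2, h3, h4, h5⟩
      have h0 := (hr₁.keeps h2 (by simp)).base
      have h19' : s'.reg 19 = σ.rep u := (h2.reg 19 (by simp) (by simp)).trans h19
      have h20' : s'.reg 20 = σ.rep v := (h2.reg 20 (by simp) (by simp)).trans h20
      have h21' : s'.reg 21 = d.toNat := (h2.reg 21 (by simp) (by simp)).trans h21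
      have h4k : s'.mem (E.base + 3 * k) = σ.rep k := by simpa using h4 k hk
      have h5k : s'.mem (E.base + 3 * k + 1) = (σ.par k).toNat := by simpa using h5 k hk
      refine Runs.ite (by decide) (fun hne => ?_) (fun heq => ?_)
      · have hkv : σ.rep k ≠ σ.rep v := by
          simp only [NExpr.eval, eval_distE, eval_repE, h0, h1, h20', h4k] at hne
          omega
        have hrk : (σ.union u v e).rep k = σ.rep k := by simp [Links.union, huv, hkv]
        have hpk : (σ.union u v e).par k = σ.par k := by simp [Links.union, huv, hkv]
        refine Runs.skip (N := 1) ⟨h1, by simp, h2.setReg (by simp) _, by simpa using h3, ?_, ?_⟩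
        · intro w hw
          rw [State.setReg_mem, h4 w hw]
          rcases lt_trichotomy w k with h | rfl | h
          · rw [if_pos h, if_pos (by omega)]
          · rw [if_neg (by omega), if_pos (by omega), hrk]
          · rw [if_neg (by omega), if_neg (by omega)]
        · intro w hw
          rw [State.setReg_mem, h5 w hw]
          rcases lt_trichotomy w k with h | rfl | h
          · rw [if_pos h, if_pos (by omega)]
          · rw [if_neg (by omega), if_pos (by omega), hpk]
          · rw [if_neg (by omega), if_neg (by omega)]
      · have hkv : σ.rep k = σ.rep v := by
          simp only [NExpr.eval, eval_distE, eval_repE, h0, h1, h20', h4k] at heq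
          omega
        have hrk : (σ.union u v e).rep k = σ.rep u := by simp [Links.union, huv, hkv]
        have hpk : (σ.union u v e).par k = (σ.par k ^^ d) := by
          simp only [Links.union, if_neg huv, if_pos hkv, hd]
        have hval : (distE (.load (parE 22)) (.reg 21)).eval s' = (σ.par k ^^ d).toNat := by
          simp only [NExpr.eval, eval_distE, eval_parE, h0, h1, h21', h5k, toNat_dist]
        refine Runs.setMem_seq (N := 1) (by decide) (by decide) (by
          rw [hval]; exact E.bool_small _) ?_
        rw [hval]
        simp only [eval_parE, h0, h1]
        have hval' : (NExpr.reg 19).eval (s'.setMem (E.base + 3 * k + 1) (σ.par k ^^ d).toNat) =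
          σ.rep u := by simpa [NExpr.eval] using h19'
        refine Runs.setMem (N := 0) (by decide) (by decide) (by
          rw [hval']; exact E.small (by omega)) ?_
        rw [hval']
        simp only [eval_repE, State.setMem_reg, h0, h1]
        refine ⟨trivial, by simp, ((h2.setMem (by omega) _).setMem (by omega) _).setReg
          (by simp) _, by simpa using h3, ?_, ?_⟩
        · intro w hw
          rw [State.setReg_mem, State.setMem_mem, State.setMem_mem, h4 w hw]
          rcases lt_trichotomy w k with h | rfl | h
          · rw [if_neg (by omega), if_neg (by omega), if_pos h, if_pos (by omega)]
          · rw [if_pos rfl, if_pos (by omega), hrk]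
          · rw [if_neg (by omega), if_neg (by omega), if_neg (by omega), if_neg (by omega)]
        · intro w hw
          rw [State.setReg_mem, State.setMem_mem, State.setMem_mem, h5 w hw]
          rcases lt_trichotomy w k with h | rfl | h
          · rw [if_neg (by omega), if_neg (by omega), if_pos h, if_pos (by omega)]
          · rw [if_neg (by omega), if_pos rfl, if_pos (by omega), hpk]
          · rw [if_neg (by omega), if_neg (by omega), if_neg (by omega), if_neg (by omega)]
    · rintro s' ⟨-, h2, h3, h4, h5⟩
      refine ⟨⟨fun w hw => ?_, fun w hw => ?_, ?_⟩, hk₁.trans (h2.mono (by simp))⟩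
      · rw [h4 w hw, if_pos (by omega)]
      · rw [h5 w hw, if_pos (by omega)]
      · rw [h3]
        simp [Links.union, huv]
  · have huv : σ.rep u = σ.rep v := by
      simp only [NExpr.eval, eval_distE, h19, h20] at heq
      omega
    have hval : (NExpr.mul (.reg 9) (.sub (.const 1) (.reg 21))).eval s₁ =
        (σ.ok && !d).toNat := by
      simp only [NExpr.eval, h21, hst₁.ok]
      cases σ.ok <;> cases d <;> rfl
    refine Runs.setReg (N := (E.n + 1) * (3 + 2) + 1) (by decide) (by
      rw [hval]; exact E.bool_small _) ?_
    rw [hval]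
    refine ⟨⟨fun w hw => ?_, fun w hw => ?_, ?_⟩, hk₁.setReg (by simp) _⟩
    · simpa [Links.union, huv] using hst₁.rep w hw
    · simpa [Links.union, huv] using hst₁.par w hw
    · simp [Links.union, huv, hd]

end Union

/-! ### Translating rules into equations. -/

section Linking

/-- Linking the literals of a list with the variable in register `13`. -/
def linkLits (flip : NExpr) : Program :=
  forBlocks 10 15 <|
    .seq (.setReg 17 (.load (.reg 10))) <|
    .seq (.setReg 10 (.add (.reg 10) (.const 1))) <|
    .seq (.setReg 16 (.reg 13)) <|
    .seq (.setReg 18 flip) unionLinks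

/-- Linking the literals of a conjunction with the variable in register `13`. -/
def linkRule : Program :=
  .seq (linkLits (.reg 14)) (linkLits (.sub (.const 1) (.reg 14)))

/-- Adding the conditions of all the rules of the weighted rule at register `4`, for a rule in the
group with number (from the end) in register `5`. -/
def linkGroups : Program :=
  .seq (.setReg 10 (.reg 4)) <|
  forBlocks 10 11 <| forBlocks 10 12 <|
    .seq (.ite (.sub (.load (.reg 4)) (.const 1)) (.setReg 13 playersE)
      (.setReg 13 (.load (.add (.reg 10) (.const 1))))) <|
    .seq (.ite (distE (.reg 11) (.reg 5)) (.setReg 14 (.const 1)) (.setReg 14 (.const 0)))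
    linkRule

/-- The number of steps of `linkLits`. -/
def litSteps (X : ℕ) : ℕ := 20 * X * (5 * X + 12) + 3

/-- The number of steps of `linkGroups`. -/
def groupSteps (X : ℕ) : ℕ := 20 * X * (20 * X * (2 * litSteps X + 4 + 2) + 3 + 2) + 4

variable {K : Type} {E : Env}

theorem length_le_of_occursAt {α : Type} {inp : List ℕ} {a : ℕ} {l : List α} {enc : α → List ℕ}
    (h : OccursAt inp a (encodeBlocks (l.map enc))) (henc : ∀ x, enc x ≠ []) :
    l.length ≤ inp.length := by
  have h1 := h.le
  have h2 : l.length ≤ (l.map enc).flatten.length := by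
    clear h h1
    induction l with
    | nil => simp
    | cons x l ih =>
      have := List.length_pos_iff.2 (henc x)
      simp only [List.map_cons, List.flatten_cons, List.length_append, List.length_cons]
      omega
  simp only [encodeBlocks, List.length_cons] at h1
  omega

theorem Env.Keeps.of_setReg {m : ℕ} {s s' : State K} {r v : ℕ} (h : E.Keeps m (s.setReg r v) s')
    {m' : ℕ} (hm : m' ≤ m) (hr : m' ≤ r) : E.Keeps m' s s' :=
  ⟨fun r' hr' h9 => by
    rw [h.reg r' (by omega) h9, State.setReg_reg, if_neg (by omega)], h.mem, h.num⟩

variable [Field K] {M : CostModel K}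

/-- The pointer in register `10` has to move although it lies in the protected range, so the frame
is stated relative to the initial state with that register advanced. -/
theorem runs_linkLits {s : State K} (hs : E.Ready s) {C : Finset (Fin E.n) → Prop}
    (hC : E.Solves C s) {a ref : ℕ} {f : Bool} {l : List (Fin E.n)} {flip : NExpr}
    (hl : OccursAt E.inp a (encodeBlocks (l.map fun v => [v.val])))
    (hp : s.reg 10 = a) (href : s.reg 13 = ref) (hrefn : ref ≤ E.n) (hf : flip.nodes ≤ 200)
    (hflip : ∀ s' : State K, s'.reg 14 = s.reg 14 → flip.eval s' = f.toNat) :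
    Runs M E.W (linkLits flip) s (litSteps E.X) fun s' =>
      E.Solves (fun S => C S ∧ ∀ v ∈ l, (charFun S ref ^^ charFun S v) = f) s' ∧
      E.Keeps 15 (s.setReg 10 (a + (encodeBlocks (l.map fun v => [v.val])).length)) s' := by
  have hX := E.n_lt
  have hlen := E.length_le
  refine (Runs.forBlocks (X := 20 * E.X) (N := E.X * 5 + 6 + 4) (l := l)
    (enc := fun v : Fin E.n => [v.val]) (by simp)
    (fun done s' => E.Solves (fun S => C S ∧ ∀ v ∈ done, (charFun S ref ^^ charFun S v) = f) s' ∧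
      E.Keeps 15 (s.setReg 10 (s'.reg 10)) s') hs.input (E.small (by omega))
    ((length_le_of_occursAt hl (by simp)).trans hlen) (E.small (by omega)) hl hp ?_ ?_).mono ?_ ?_
  · refine ⟨((hC.setReg (by simp) _).setReg (by simp) _).congr (by simp), ?_⟩
    refine ⟨fun r hr h9 => ?_, fun _ _ => rfl, rfl⟩
    simp only [State.setReg_reg, if_true]
    split_ifs <;> first | rfl | omega
  · rintro done x todo s' rfl hx ⟨h1, h2⟩ hp' hc'
    have hpos := hx.le
    simp only [List.length_singleton] at hpos
    have hk := h2.of_setReg (m' := 10) (by simp) (by simp)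
    have hread : s'.mem (s'.reg 10) = x := by
      rw [hs.input.keeps hk _ (by omega), hp', hx.getD]
    have h13 : s'.reg 13 = ref := by
      rw [h2.reg 13 (by simp) (by simp)]
      simpa using href
    have h14 : s'.reg 14 = s.reg 14 := by
      rw [h2.reg 14 (by simp) (by simp)]
      simp
    refine Runs.setReg_seq (by decide) (by
      simp only [NExpr.eval, hread]; exact E.small (by omega)) ?_
    refine Runs.setReg_seq (by decide) (by
      simp only [NExpr.eval, State.setReg_reg, hp']
      simp only [Nat.reduceEqDiff, if_false]
      exact E.small (by omega)) ?_
    refine Runs.setReg_seq (by decide) (by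
      simp only [NExpr.eval, State.setReg_reg, h13]
      simp only [Nat.reduceEqDiff, if_false]
      exact E.small (by omega)) ?_
    refine Runs.setReg_seq hf (by
      rw [hflip _ (by simp [h14])]
      exact E.bool_small f) ?_
    rw [hflip _ (by simp [h14])]
    simp only [NExpr.eval, State.setReg_reg, hread, h13, Nat.reduceEqDiff, if_false]
    set s₂ := (((s'.setReg 17 x).setReg 10 (s'.reg 10 + 1)).setReg 16 ref).setReg 18 f.toNat
      with hs₂
    have hsol : E.Solves _ s₂ :=
      (((h1.setReg (by simp) _).setReg (by simp) _).setReg (by simp) _).setReg (by simp) _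
    refine (runs_unionLinks (s := s₂) (u := ref) (v := x) (e := f) ?_ hsol (by simp [hs₂])
      (by simp [hs₂]) (by simp [hs₂]) hrefn x.2.le).mono le_rfl ?_
    · exact ((((hs.keeps hk (by simp)).setReg (by simp) _).setReg (by simp) _).setReg
        (by simp) _).setReg (by simp) _
    · rintro s'' ⟨h3, h4⟩
      have h15 : s''.reg 15 = s'.reg 15 := by
        rw [h4.reg 15 (by simp) (by simp)]
        simp [hs₂]
      have h10 : s''.reg 10 = s'.reg 10 + 1 := by
        rw [h4.reg 10 (by simp) (by simp)]
        simp [hs₂]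
      refine ⟨by rw [h15, hc'], by rw [h10, hp']; rfl, ?_, ?_⟩
      · refine (h3.setReg (by simp) _).congr fun S => ?_
        simp only [List.forall_mem_append, List.forall_mem_singleton, and_assoc]
      · refine Env.Keeps.setReg ?_ (by simp) _
        refine ⟨fun r hr h9 => ?_, fun b hb => ?_, ?_⟩
        · rcases eq_or_ne r 10 with rfl | hr10
          · simp
          · rw [h4.reg r (by omega) h9]
            have := h2.reg r hr h9
            simp only [State.setReg_reg, if_neg hr10] at this
            simp only [hs₂, State.setReg_reg, if_neg hr10, this]
            split_ifs <;> first | rfl | omega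
        · rw [h4.mem b hb]
          exact h2.mem b hb
        · rw [h4.num]
          exact h2.num
  · unfold litSteps
    rw [show E.X * 5 + 6 + 4 + 2 = 5 * E.X + 12 by ring]
  · rintro s' ⟨⟨h1, h2⟩, h3, -⟩
    exact ⟨h1, h3 ▸ h2⟩

/-- Negative literals satisfy the opposite equation, so the second pass runs with `1` minus register
`14`. -/
theorem runs_linkRule {s : State K} (hs : E.Ready s) {C : Finset (Fin E.n) → Prop}
    (hC : E.Solves C s) {a ref : ℕ} {f : Bool} (α : Conj E.n) (hα : OccursAt E.inp a α.encode)
    (hp : s.reg 10 = a) (href : s.reg 13 = ref) (hrefn : ref ≤ E.n) (hf : s.reg 14 = f.toNat) :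
    Runs M E.W linkRule s (2 * litSteps E.X) fun s' =>
      E.Solves (fun S => C S ∧ α.Linked ref f S) s' ∧
      E.Keeps 15 (s.setReg 10 (a + α.encode.length)) s' := by
  refine Runs.seq' (runs_linkLits hs hC hα.left hp href hrefn (by decide) (f := f)
    fun s' h => by simp [NExpr.eval, h, hf]) ?_ (by omega) (N₂ := litSteps E.X)
  rintro s' ⟨h1, h2⟩
  have hs' := hs.keeps (h2.of_setReg (m' := 10) (by simp) (by simp)) (by simp)
  have h10 := h2.reg 10 (by simp) (by simp)
  have h13 := h2.reg 13 (by simp) (by simp)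
  have h14 := h2.reg 14 (by simp) (by simp)
  simp only [State.setReg_reg, Nat.reduceEqDiff, if_false, if_true] at h10 h13 h14
  refine (runs_linkLits hs' h1 hα.right h10 (h13.trans href) hrefn (by decide) (f := !f)
    fun s' h => by simp only [NExpr.eval, h, h14, hf]; cases f <;> rfl).mono le_rfl ?_
  rintro s'' ⟨h3, h4⟩
  refine ⟨h3.congr fun S => and_assoc, ?_⟩
  refine ⟨fun r hr h9 => ?_, fun b hb => (h4.mem b hb).trans (h2.mem b hb), h4.num.trans h2.num⟩
  rw [h4.reg r hr h9]
  have := h2.reg r hr h9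
  rcases eq_or_ne r 10 with rfl | hr10
  · simp [Conj.encode, Nat.add_assoc]
  · simpa [hr10] using this

/-- The counter in register `11` is one more than the number of groups that follow, as is register
`5` for the group of the chosen rule; comparing them decides whether two rules share a group. With
more than two groups the equations carry no meaning, and the caller starts from an unsolvable system
instead. -/
theorem runs_linkGroups {s : State K} (hs : E.Ready s) {C : Finset (Fin E.n) → Prop}
    (hC : E.Solves C s) (γ : WeightedRule E.n K) {a : ℕ} (hocc : OccursAt E.inp a γ.encode)
    {dG tG : List (List (MCRule E.n K))} {G : List (MCRule E.n K)}
    (hγ : γ.groups = dG ++ G :: tG) (h4 : s.reg 4 = a) (h5 : s.reg 5 = tG.length + 1) :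
    Runs M E.W linkGroups s (groupSteps E.X) fun s' =>
      E.Solves (fun S => C S ∧ ∀ d G' t, γ.groups = d ++ G' :: t → ∀ r ∈ G',
        r.Compatible (γ.groups.length = 1) (t.length ≠ tG.length) S) s' ∧
      E.Keeps 10 s s' := by
  have hX := E.n_lt
  have hlen := E.length_le
  have hale := hocc.le
  have h0 : E.Keeps 10 s (s.setReg 10 a) := (Env.Keeps.refl 10 s).setReg (by simp) _
  have henc : ∀ l : List (List ℕ), encodeBlocks l ≠ [] := by simp [encodeBlocks]
  unfold groupSteps
  refine Runs.setReg_seq (N := 20 * E.X * (20 * E.X * (2 * litSteps E.X + 4 + 2) + 3 + 2) + 3)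
    (by decide) (by simp only [NExpr.eval, h4]; exact E.small (by omega)) ?_
  simp only [NExpr.eval, h4]
  refine (Runs.forBlocks (X := 20 * E.X) (by simp)
    (fun done s' => E.Solves (fun S => C S ∧ ∀ d G' t, γ.groups = d ++ G' :: t →
      d.length < done.length → ∀ r ∈ G',
        r.Compatible (γ.groups.length = 1) (t.length ≠ tG.length) S) s' ∧ E.Keeps 10 s s')
    (hs.input.keeps h0) (E.small (by omega))
    ((length_le_of_occursAt hocc (fun _ => henc _)).trans hlen) (E.small (by omega)) hocc
    (by simp) ?_ ?_).mono le_rfl ?_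
  · exact ⟨(((hC.setReg (by simp) _).setReg (by simp) _).setReg (by simp) _).congr (by simp),
      (h0.setReg (by simp) _).setReg (by simp) _⟩
  · rintro d G' t s₁ hγ' hG' ⟨h1, h2⟩ hp hc
    refine (Runs.forBlocks (X := 20 * E.X) (N := 2 * litSteps E.X + 4) (by simp)
      (fun done s' => E.Solves (fun S => (C S ∧ ∀ d' G' t, γ.groups = d' ++ G' :: t →
        d'.length < d.length → ∀ r ∈ G',
        r.Compatible (γ.groups.length = 1) (t.length ≠ tG.length) S) ∧
        ∀ r ∈ done, r.Compatible (γ.groups.length = 1) (t.length ≠ tG.length) S) s' ∧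
        E.Keeps 10 s s' ∧ s'.reg 11 = t.length + 1)
      (hs.input.keeps h2) (E.small (by omega))
      ((length_le_of_occursAt hG' (fun _ => by simp [Conj.encode, encodeBlocks])).trans hlen)
      (E.small (by omega)) hG' hp ?_ ?_).mono le_rfl ?_
    · exact ⟨((h1.setReg (by simp) _).setReg (by simp) _).congr (by simp),
        (h2.setReg (by simp) _).setReg (by simp) _, by simpa using hc⟩
    · rintro dr r tr s₂ hG hr ⟨h1, h2, h11⟩ hp' hc'
      have hs₂ := hs.keeps h2 (by simp)
      have hm : s₂.mem a = γ.groups.length := by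
        rw [hs₂.input _ (by simp [WeightedRule.encode, encodeBlocks] at hale; omega)]
        have := OccursAt.getD hocc
        simpa using this
      have h4' : s₂.reg 4 = a := (h2.reg 4 (by simp) (by simp)).trans h4
      have h5' : s₂.reg 5 = tG.length + 1 := (h2.reg 5 (by simp) (by simp)).trans h5
      set b := blockPos (blockPos a (fun G => encodeBlocks (List.map (fun r => r.expr.encode) G)) d)
        (fun r : MCRule E.n K => r.expr.encode) dr with hb
      -- The code of a conjunction begins with the number of positive literals, so the next cell
      -- holds the first of them.
      have hhead : s₂.mem (b + 1) = (r.expr.pos.head r.expr.pos_ne_nil).val ∧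
          b + 1 < E.inp.length := by
        have hble := hr.le
        obtain ⟨x, l, hxl⟩ := List.exists_cons_of_ne_nil r.expr.pos_ne_nil
        simp only [Conj.encode, encodeBlocks, hxl, List.map_cons, List.length_cons,
          List.flatten_cons, List.cons_append, List.nil_append] at hble hr
        have hlt : b + 1 < E.inp.length := by omega
        refine ⟨?_, hlt⟩
        rw [hs₂.input _ hlt]
        rw [← List.singleton_append] at hr
        have := hr.right.getD
        simpa [hxl] using this
      have hcond : decide (γ.groups.length = 1) = true →
          decide (t.length ≠ tG.length) = false := by
        intro h
        have h := of_decide_eq_true h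
        have e1 := congrArg List.length hγ
        have e2 := congrArg List.length hγ'
        simp only [List.length_append, List.length_cons] at e1 e2
        simp only [decide_eq_false_iff_not, not_not]
        omega
      set ref := if decide (γ.groups.length = 1) = true
        then (r.expr.pos.head r.expr.pos_ne_nil).val else E.n with href
      have hrefn : ref ≤ E.n := by
        rw [href]
        split_ifs
        · exact (r.expr.pos.head r.expr.pos_ne_nil).2.le
        · exact le_rfl
      have hlpos : γ.groups.length ≠ 0 := fun h => γ.groups_ne_nil (List.length_eq_zero_iff.1 h)
      refine Runs.seq' (N₁ := 2) (N₂ := 2 + 2 * litSteps E.X)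
        (P := fun s' => s' = s₂.setReg 13 ref) ?_ ?_ (by omega)
      · refine Runs.ite (by decide) (fun hne => ?_) (fun heq => ?_)
        · simp only [NExpr.eval, h4', hm] at hne
          have h1 : ref = E.n := by rw [href, if_neg]; simp only [decide_eq_true_eq]; omega
          refine Runs.setReg (N := 0) (by decide) ?_ ?_
          · rw [eval_playersE, hs₂.input.players]
            exact E.small (by omega)
          · rw [eval_playersE, hs₂.input.players, h1]
        · simp only [NExpr.eval, h4', hm] at heq
          have h1 : ref = (r.expr.pos.head r.expr.pos_ne_nil).val := by
            rw [href, if_pos]; simp only [decide_eq_true_eq]; omega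
          have hval : (NExpr.load (.add (.reg 10) (.const 1))).eval s₂ = ref := by
            simp only [NExpr.eval, hp', hhead.1, h1]
          refine Runs.setReg (N := 0) (by decide) ?_ ?_
          · rw [hval]
            exact E.small (by omega)
          · rw [hval]
      rintro _ rfl
      refine Runs.seq' (N₁ := 2) (N₂ := 2 * litSteps E.X)
        (P := fun s' => s' = (s₂.setReg 13 ref).setReg 14
          (decide (t.length ≠ tG.length)).toNat) ?_ ?_ (by omega)
      · refine Runs.ite (by decide) (fun hne => ?_) (fun heq => ?_)
        · simp [NExpr.eval, h11, h5'] at hne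
          refine Runs.setReg (N := 0) (by decide) (by exact E.small (by simp [NExpr.eval])) ?_
          have : t.length ≠ tG.length := by omega
          simp [NExpr.eval, this]
        · simp [NExpr.eval, h11, h5'] at heq
          refine Runs.setReg (N := 0) (by decide) (by exact E.small (by simp [NExpr.eval])) ?_
          have : t.length = tG.length := by omega
          simp [NExpr.eval, this]
      rintro _ rfl
      refine (runs_linkRule ((hs₂.setReg (by simp) _).setReg (by simp) _)
        ((h1.setReg (by simp) _).setReg (by simp) _)
        (f := decide (t.length ≠ tG.length)) r.expr hr (by simpa using hp')
        (by simp) hrefn (by simp)).mono le_rfl ?_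
      rintro s₃ ⟨h6, h7⟩
      have e10 := h7.reg 10 (by simp) (by simp)
      have e11 := h7.reg 11 (by simp) (by simp)
      have e12 := h7.reg 12 (by simp) (by simp)
      simp only [State.setReg_reg, Nat.reduceEqDiff, if_false, if_true] at e10 e11 e12
      refine ⟨e12.trans hc', e10, ?_, ?_, by simpa using e11.trans h11⟩
      · refine (h6.setReg (by simp) _).congr fun S => ?_
        rw [List.forall_mem_append, List.forall_mem_singleton, r.compatible_iff _ _ hcond,
          ← href, and_assoc]
      · refine Env.Keeps.setReg ?_ (by simp) _
        refine h2.trans ?_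
        have e1 := h7.of_setReg (m' := 10) (by simp) (by simp)
        have e2 := e1.of_setReg (m' := 10) le_rfl (by simp)
        exact e2.of_setReg le_rfl (by simp)
    · rintro s' ⟨⟨h6, h7, h8⟩, h9, -⟩
      refine ⟨h8, h9, ?_, h7.setReg (by simp) _⟩
      refine (h6.setReg (by simp) _).congr fun S => ?_
      rw [and_assoc]
      refine and_congr_right fun _ => ?_
      constructor
      · rintro ⟨hA, hB⟩ d' G'' t' hsplit hlt
        rcases lt_or_ge d'.length d.length with h | h
        · exact hA d' G'' t' hsplit h
        · have hl : d'.length = d.length := by simp at hlt; omega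
          obtain ⟨rfl, h'⟩ := List.append_inj (hsplit.symm.trans hγ') hl
          obtain ⟨rfl, rfl⟩ := List.cons.inj h'
          exact hB
      · intro hA
        exact ⟨fun d' G'' t' hsplit hlt => hA d' G'' t' hsplit (by simp; omega),
          hA d G' t hγ' (by simp)⟩
  · rintro s' ⟨⟨h6, h7⟩, -, -⟩
    refine ⟨h6.congr fun S => and_congr_right fun _ => ?_, h7⟩
    refine forall_congr' fun d => forall_congr' fun G' => forall_congr' fun t => ?_
    refine forall_congr' fun hsplit => ?_
    have : d.length < γ.groups.length := by
      rw [hsplit]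
      simp
    simp [this]

end Linking

/-! ### Evaluating the generating function and reading off its coefficients. -/

section Counting

/-- The weight of the value `b` of the variable in register `20`. -/
def weightE (b : Bool) : NExpr :=
  if b then .sub (.reg 1) (.mul (.sub (.reg 1) (.const 1)) (.div (.reg 20) playersE))
  else .sub (.const 1) (.div (.reg 20) playersE)

/-- Multiplying the class weights in registers `18` and `19` by the weights of a variable with the
parity `b`. -/
def mulWeights (b : Bool) : Program :=
  .seq (.setReg 18 (.mul (.reg 18) (weightE !b))) (.setReg 19 (.mul (.reg 19) (weightE b)))

/-- Computing the generating function of the solutions in register `16`. -/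
def computeGenFun : Program :=
  .seq (.setReg 16 (.reg 9)) <|
  forPlayers 17 <|
    .ite (distE (.load (repE 17)) (.reg 17)) .skip <|
    .seq (.setReg 18 (.const 1)) <|
    .seq (.setReg 19 (.const 1)) <|
    .seq (forPlayers 20 (.ite (distE (.load (repE 20)) (.reg 17)) .skip
      (.ite (.load (parE 20)) (mulWeights true) (mulWeights false)))) <|
    .setReg 16 (.mul (.reg 16) (.add (.reg 18) (.reg 19)))

/-- The address of the factorial of the value of `e`. -/
def factE (e : NExpr) : NExpr := .add (.add (.reg 0) (.mul (.const 3) e)) (.const 2)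

/-- Extracting the coefficients of the generating function in register `16`, and computing their
weighted sum in register `17`. -/
def sumCoeffs (e : ℕ) : Program :=
  .seq (.setReg 17 (.const 0)) <|
  forPlayers 18 <|
    .seq (.setReg 17 (.add (.reg 17) (.mul
      (.mul (.load (factE (.sub (.add (.reg 18) (.const e)) (.const 1))))
        (.load (factE (.sub (.sub playersE (.reg 18)) (.const e)))))
      (.sub (.reg 16) (.mul (.reg 1) (.div (.reg 16) (.reg 1))))))) <|
    .setReg 16 (.div (.reg 16) (.reg 1))

/-- The number of steps of `computeGenFun` followed by `sumCoeffs`. -/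
def countSteps (X : ℕ) : ℕ := X * (X * 6 + 8) + 3 + (X * 4 + 3)

theorem classWeight_succ (n x : ℕ) (σ : Links) (ρ : ℕ) (b : Bool) (m : ℕ) :
    classWeight n x σ ρ b (m + 1) = classWeight n x σ ρ b m *
      if σ.rep m = ρ then varWeight n x m (b ^^ σ.par m) else 1 :=
  Finset.prod_range_succ _ _

theorem genFun_succ (n x : ℕ) (σ : Links) (m : ℕ) :
    genFun n x σ (m + 1) = genFun n x σ m * if σ.rep m = m then
      classWeight n x σ m true (n + 1) + classWeight n x σ m false (n + 1) else 1 := by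
  rw [genFun, genFun, Finset.prod_range_succ, mul_assoc]

variable {E : Env}

theorem Env.pow_lt (E : Env) {v k : ℕ} (hv : v ≤ 2 ^ k) (hk : k ≤ 9 * (E.X + 10) ^ 3) :
    v < 2 ^ E.W := by
  refine hv.trans_lt (Nat.pow_lt_pow_right (by simp) ?_)
  have := E.le_W
  have : 0 < (E.X + 10) ^ 3 := by positivity
  omega

theorem Env.classWeight_lt (E : Env) (σ : Links) (ρ : ℕ) (b : Bool) {m : ℕ} (hm : m ≤ E.n + 1) :
    classWeight E.n (2 ^ (E.n + 1)) σ ρ b m < 2 ^ E.W := by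
  have hX := E.n_lt
  refine E.pow_lt (k := (E.n + 1) * m) ?_ ?_
  · rw [pow_mul]
    exact classWeight_le Nat.one_le_two_pow _ _ _ _
  · calc (E.n + 1) * m ≤ (E.X + 10) * (E.X + 10) := Nat.mul_le_mul (by omega) (by omega)
      _ ≤ 9 * (E.X + 10) ^ 3 := by nlinarith [Nat.zero_le (E.X ^ 3), Nat.zero_le (E.X ^ 2)]

theorem Env.genFun_lt (E : Env) (σ : Links) {m : ℕ} (hm : m ≤ E.n + 1) :
    genFun E.n (2 ^ (E.n + 1)) σ m < 2 ^ E.W := by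
  have hX := E.n_lt
  refine E.pow_lt (k := (E.n + 1) * ((E.n + 2) * m)) ?_ ?_
  · rw [pow_mul]
    exact genFun_le (by rw [pow_succ]; have := Nat.one_le_two_pow (n := E.n); omega) _ _
  · calc (E.n + 1) * ((E.n + 2) * m) ≤ (E.X + 10) * ((E.X + 10) * (E.X + 10)) :=
        Nat.mul_le_mul (by omega) (Nat.mul_le_mul (by omega) (by omega))
      _ ≤ 9 * (E.X + 10) ^ 3 := by nlinarith [Nat.zero_le (E.X ^ 3), Nat.zero_le (E.X ^ 2)]

theorem factorial_le_two_pow {n v : ℕ} (h : v ≤ n) : v.factorial ≤ 2 ^ (n * n) :=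
  calc v.factorial ≤ n.factorial := Nat.factorial_le h
    _ ≤ n ^ n := Nat.factorial_le_pow n
    _ ≤ (2 ^ n) ^ n := Nat.pow_le_pow_left Nat.lt_two_pow_self.le n
    _ = 2 ^ (n * n) := (pow_mul _ _ _).symm

/-- Two factorials below `2 ^ (n * n)`, a count below `2 ^ (n + 1)` and at most `n + 1` terms give
the exponent `2 * n ^ 2 + 2 * (n + 1)`, which is at most `2 * (n + 1) ^ 2`. -/
theorem Env.sum_coeffNum_lt (E : Env) {e : ℕ} (he : e ≤ 1) {c : ℕ → ℕ}
    (hc : ∀ s, c s < 2 ^ (E.n + 1)) {m : ℕ} (hm : m ≤ E.n + 1) :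
    ∑ s ∈ Finset.range m, coeffNum E.n e s * c s < 2 ^ (2 * E.X ^ 2) := by
  have hX : E.n + 1 ≤ E.X := E.n_lt
  calc ∑ s ∈ Finset.range m, coeffNum E.n e s * c s
      ≤ ∑ s ∈ Finset.range m, 2 ^ (E.n * E.n) * 2 ^ (E.n * E.n) * 2 ^ (E.n + 1) := by
        refine Finset.sum_le_sum fun s hs => Nat.mul_le_mul (Nat.mul_le_mul ?_ ?_) (hc s).le
        · rw [Finset.mem_range] at hs
          exact factorial_le_two_pow (by omega)
        · exact factorial_le_two_pow (by omega)
    _ = m * 2 ^ (2 * (E.n * E.n) + (E.n + 1)) := by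
        rw [Finset.sum_const, Finset.card_range, smul_eq_mul, ← pow_add, ← pow_add, two_mul]
    _ < 2 ^ (E.n + 1) * 2 ^ (2 * (E.n * E.n) + (E.n + 1)) :=
        Nat.mul_lt_mul_of_pos_right (hm.trans_lt Nat.lt_two_pow_self) (by positivity)
    _ = 2 ^ (2 * (E.n * E.n) + 2 * (E.n + 1)) := by
        rw [← pow_add]
        congr 1
        ring
    _ ≤ 2 ^ (2 * E.X ^ 2) := by
        refine Nat.pow_le_pow_right (by simp) ?_
        have := Nat.pow_le_pow_left hX 2
        nlinarith

theorem Env.two_mul_sq_le (E : Env) : 2 * E.X ^ 2 ≤ 9 * (E.X + 10) ^ 3 := by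
  nlinarith [Nat.zero_le (E.X ^ 3), Nat.zero_le (E.X ^ 2)]

variable {K : Type}

/-- For `k ≤ n` and `n > 0` the quotient `k / n` is the indicator of `k = n`, so the weight is
computed without a branch. -/
theorem eval_weightE {s : State K} (hs : E.Ready s) {k : ℕ} (hk : s.reg 20 = k) (hkn : k ≤ E.n)
    (b : Bool) : (weightE b).eval s = varWeight E.n (2 ^ (E.n + 1)) k b := by
  have hn : 0 < E.n := by have := E.i_lt; omega
  have h1 := Nat.one_le_two_pow (n := E.n + 1)
  rcases hkn.lt_or_eq with h | rfl
  · have : k / E.n = 0 := Nat.div_eq_of_lt h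
    cases b <;> simp [weightE, NExpr.eval, hs.radix, hk, hs.input.players, this, varWeight, h]
  · have : E.n / E.n = 1 := Nat.div_self hn
    cases b <;> simp [weightE, NExpr.eval, hs.radix, hk, hs.input.players, hn, varWeight]
    omega

variable [Field K] {M : CostModel K}

/-- If the class has the value `true`, its variable `k` has the value `!σ.par k`, hence the negation
in the first factor of the program. -/
theorem runs_mulWeights {s : State K} (hs : E.Ready s) {σ : Links} {k ρ : ℕ}
    (hk : s.reg 20 = k) (hkn : k ≤ E.n) (hρ : σ.rep k = ρ)
    (h18 : s.reg 18 = classWeight E.n (2 ^ (E.n + 1)) σ ρ true k)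
    (h19 : s.reg 19 = classWeight E.n (2 ^ (E.n + 1)) σ ρ false k) :
    Runs M E.W (mulWeights (σ.par k)) s 2 fun s' => ∃ v v',
      v = classWeight E.n (2 ^ (E.n + 1)) σ ρ true (k + 1) ∧
      v' = classWeight E.n (2 ^ (E.n + 1)) σ ρ false (k + 1) ∧
      s' = (s.setReg 18 v).setReg 19 v' := by
  have hnode : ∀ b, (weightE b).nodes ≤ 190 := by decide
  have e1 : (NExpr.mul (.reg 18) (weightE !σ.par k)).eval s =
      classWeight E.n (2 ^ (E.n + 1)) σ ρ true (k + 1) := by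
    rw [classWeight_succ, if_pos hρ]
    simp [NExpr.eval, h18, eval_weightE hs hk hkn]
  refine Runs.setReg_seq (N := 1) ?_ (by rw [e1]; exact E.classWeight_lt _ _ _ (by omega)) ?_
  · have := hnode (!σ.par k)
    simp only [NExpr.nodes]
    omega
  rw [e1]
  have e2 : (NExpr.mul (.reg 19) (weightE (σ.par k))).eval (s.setReg 18
      (classWeight E.n (2 ^ (E.n + 1)) σ ρ true (k + 1))) =
      classWeight E.n (2 ^ (E.n + 1)) σ ρ false (k + 1) := by
    rw [classWeight_succ _ _ _ _ false, if_pos hρ]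
    simp [NExpr.eval, h19, eval_weightE (hs.setReg (by simp) _)
      (show (s.setReg 18 _).reg 20 = k by simpa using hk) hkn]
  refine Runs.setReg (N := 0) ?_ (by rw [e2]; exact E.classWeight_lt _ _ _ (by omega)) ?_
  · have := hnode (σ.par k)
    simp only [NExpr.nodes]
    omega
  rw [e2]
  exact ⟨_, _, rfl, rfl, rfl⟩

theorem runs_computeGenFun {s : State K} (hs : E.Ready s) {σ : Links} (hσ : E.Stores σ s) :
    Runs M E.W computeGenFun s (E.X * (E.X * 6 + 8) + 3) fun s' =>
      s'.reg 16 = genFun E.n (2 ^ (E.n + 1)) σ (E.n + 1) ∧ E.Keeps 16 s s' := by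
  have hX : E.n + 1 ≤ E.X := E.n_lt
  refine Runs.setReg_seq (N := E.X * (E.X * 6 + 8) + 2) (by decide) (by
    simp only [NExpr.eval, hσ.ok]; exact E.bool_small _) ?_
  simp only [NExpr.eval, hσ.ok]
  refine (Runs.forPlayers (n := E.n) (N := E.X * 6 + 6) (fun k s' => s'.reg 17 = k ∧
    s'.reg 16 = genFun E.n (2 ^ (E.n + 1)) σ k ∧ E.Keeps 16 s s' ∧ E.Stores σ s')
    (E.small (by omega)) ?_ ?_ ?_).mono ?_ ?_
  · rintro k s' ⟨h1, -, h2, -⟩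
    exact ⟨(hs.input.keeps h2).players, h1⟩
  · exact ⟨by simp, by simp [genFun], ((Env.Keeps.refl 16 s).setReg (by simp) _).setReg
      (by simp) _, (hσ.setReg (by simp) _).setReg (by simp) _⟩
  · rintro ρ s₁ hρ ⟨h17, h16, hk, hst⟩
    have hs₁ := hs.keeps hk (by simp)
    have hrep := hst.rep ρ hρ
    refine Runs.ite (N := E.X * 6 + 5) (by decide) (fun hne => ?_) (fun heq => ?_)
    · have hne' : σ.rep ρ ≠ ρ := by
        simp only [NExpr.eval, eval_distE, eval_repE, hs₁.base, h17, hrep] at hne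
        omega
      refine Runs.skip ⟨h17, by simp, ?_, hk.setReg (by simp) _, hst.setReg (by simp) _⟩
      rw [genFun_succ, if_neg hne', mul_one]
      simpa using h16
    · have heq' : σ.rep ρ = ρ := by
        simp only [NExpr.eval, eval_distE, eval_repE, hs₁.base, h17, hrep] at heq
        omega
      refine Runs.setReg_seq (N := E.X * 6 + 4) (by decide) (E.small (by simp [NExpr.eval])) ?_
      refine Runs.setReg_seq (N := E.X * 6 + 3) (by decide) (E.small (by simp [NExpr.eval])) ?_
      simp only [NExpr.eval]
      set s₂ := (s₁.setReg 18 1).setReg 19 1 with hs₂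
      have hk₂ : E.Keeps 16 s s₂ := (hk.setReg (by simp) _).setReg (by simp) _
      have hst₂ : E.Stores σ s₂ := (hst.setReg (by simp) _).setReg (by simp) _
      have hr₂ := hs.keeps hk₂ (by simp)
      have h16₂ : s₂.reg 16 = genFun E.n (2 ^ (E.n + 1)) σ ρ := by simpa [hs₂] using h16
      have h17₂ : s₂.reg 17 = ρ := by simpa [hs₂] using h17
      have h18₂ : s₂.reg 18 = 1 := by simp [hs₂]
      have h19₂ : s₂.reg 19 = 1 := by simp [hs₂]
      clear_value s₂
      refine Runs.seq' (N₁ := E.X * 6 + 2) (N₂ := 1) (P := fun s' => E.Keeps 18 s₂ s' ∧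
        E.Stores σ s' ∧ s'.reg 18 = classWeight E.n (2 ^ (E.n + 1)) σ ρ true (E.n + 1) ∧
        s'.reg 19 = classWeight E.n (2 ^ (E.n + 1)) σ ρ false (E.n + 1)) ?_ ?_ (by omega)
      · refine (Runs.forPlayers (n := E.n) (N := 4) (fun k s' => s'.reg 20 = k ∧ E.Keeps 18 s₂ s' ∧
          E.Stores σ s' ∧ s'.reg 18 = classWeight E.n (2 ^ (E.n + 1)) σ ρ true k ∧
          s'.reg 19 = classWeight E.n (2 ^ (E.n + 1)) σ ρ false k)
          (E.small (by omega)) ?_ ?_ ?_).mono (by omega) ?_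
        · rintro k s' ⟨h1, h2, -⟩
          exact ⟨(hr₂.input.keeps h2).players, h1⟩
        · exact ⟨by simp, (Env.Keeps.refl 18 s₂).setReg (by simp) _, hst₂.setReg (by simp) _,
            by simp [classWeight, h18₂], by simp [classWeight, h19₂]⟩
        · rintro k s₃ hkn ⟨h20, hk₃, hst₃, h18, h19⟩
          have hr₃ := hr₂.keeps hk₃ (by simp)
          have h17₃ : s₃.reg 17 = ρ := (hk₃.reg 17 (by simp) (by simp)).trans h17₂
          have hrep₃ := hst₃.rep k hkn
          have hpar₃ := hst₃.par k hkn
          refine Runs.ite (N := 3) (by decide) (fun hne => ?_) (fun heq => ?_)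
          · have hne' : σ.rep k ≠ ρ := by
              simp only [NExpr.eval, eval_distE, eval_repE, hr₃.base, h20, h17₃, hrep₃] at hne
              omega
            refine Runs.skip ⟨h20, by simp, hk₃.setReg (by simp) _, hst₃.setReg (by simp) _,
              ?_, ?_⟩
            all_goals
              rw [classWeight_succ, if_neg hne', mul_one]
              simpa
          · have heq' : σ.rep k = ρ := by
              simp only [NExpr.eval, eval_distE, eval_repE, hr₃.base, h20, h17₃, hrep₃] at heq
              omega
            have hmul := runs_mulWeights (M := M) hr₃ h20 hkn heq' h18 h19
            have hpost : ∀ s', (∃ v v', v = classWeight E.n (2 ^ (E.n + 1)) σ ρ true (k + 1) ∧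
                v' = classWeight E.n (2 ^ (E.n + 1)) σ ρ false (k + 1) ∧
                s' = (s₃.setReg 18 v).setReg 19 v') → s'.reg 20 = k ∧
                (s'.setReg 20 (k + 1)).reg 20 = k + 1 ∧ E.Keeps 18 s₂ (s'.setReg 20 (k + 1)) ∧
                E.Stores σ (s'.setReg 20 (k + 1)) ∧ (s'.setReg 20 (k + 1)).reg 18 =
                  classWeight E.n (2 ^ (E.n + 1)) σ ρ true (k + 1) ∧
                (s'.setReg 20 (k + 1)).reg 19 =
                  classWeight E.n (2 ^ (E.n + 1)) σ ρ false (k + 1) := by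
              rintro s' ⟨v, v', h1, h2, rfl⟩
              exact ⟨by simpa using h20, by simp, ((hk₃.setReg (by simp) _).setReg (by simp)
                _).setReg (by simp) _, ((hst₃.setReg (by simp) _).setReg (by simp) _).setReg
                (by simp) _, by simpa using h1, by simpa using h2⟩
            refine Runs.ite (N := 2) (by decide) (fun hp => ?_) (fun hp => ?_)
            · simp only [NExpr.eval, eval_parE, hr₃.base, h20, hpar₃] at hp
              have hp' : σ.par k = true := by simpa using hp
              rw [hp'] at hmul
              exact hmul.mono le_rfl hpost
            · simp only [NExpr.eval, eval_parE, hr₃.base, h20, hpar₃] at hp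
              have hp' : σ.par k = false := by simpa using hp
              rw [hp'] at hmul
              exact hmul.mono le_rfl hpost
        · rintro s' ⟨-, h⟩
          exact h
      · rintro s₃ ⟨hk₃, hst₃, h18, h19⟩
        have h16₃ : s₃.reg 16 = _ := (hk₃.reg 16 (by simp) (by simp)).trans h16₂
        have h17₃ : s₃.reg 17 = ρ := (hk₃.reg 17 (by simp) (by simp)).trans h17₂
        have hval : (NExpr.mul (.reg 16) (.add (.reg 18) (.reg 19))).eval s₃ =
            genFun E.n (2 ^ (E.n + 1)) σ (ρ + 1) := by
          rw [genFun_succ, if_pos heq']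
          simp only [NExpr.eval, h16₃, h18, h19]
        refine Runs.setReg (N := 0) (by decide) (by
          rw [hval]; exact E.genFun_lt _ (by omega)) ?_
        rw [hval]
        exact ⟨by simpa using h17₃, by simp, by simp,
          ((hk₂.trans (hk₃.mono (by simp))).setReg (by simp) _).setReg (by simp) _,
          (hst₃.setReg (by simp) _).setReg (by simp) _⟩
  · have : (E.n + 1) * (E.X * 6 + 6 + 2) ≤ E.X * (E.X * 6 + 8) := Nat.mul_le_mul_right _ hX
    omega
  · rintro s' ⟨-, h1, h2, -⟩
    exact ⟨h1, h2⟩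

/-- Before round `k` the lowest `k` digits have been shifted out of register `16`, and the sum so
far is in register `17`. -/
theorem runs_sumCoeffs {s : State K} (hs : E.Ready s) {e : ℕ} (he : e ≤ 1) {c : ℕ → ℕ}
    (hc : ∀ v, c v < 2 ^ (E.n + 1))
    (h16 : s.reg 16 = ∑ v ∈ Finset.range (E.n + 1), c v * (2 ^ (E.n + 1)) ^ v) :
    Runs M E.W (sumCoeffs e) s (E.X * 4 + 3) fun s' =>
      s'.reg 17 = ∑ v ∈ Finset.range (E.n + 1), coeffNum E.n e v * c v ∧ E.Keeps 16 s s' := by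
  have hX : E.n + 1 ≤ E.X := E.n_lt
  -- Register `16` only decreases, so its bit length is controlled by the bound on the initial
  -- configuration.
  refine Runs.of_bounded fun hb => ?_
  refine Runs.setReg_seq (N := E.X * 4 + 2) (by decide) (E.small (by simp [NExpr.eval])) ?_
  simp only [NExpr.eval]
  refine (Runs.forPlayers (n := E.n) (N := 2) (fun k s' => s'.reg 18 = k ∧
    s'.reg 17 = ∑ v ∈ Finset.range k, coeffNum E.n e v * c v ∧
    s'.reg 16 = ∑ v ∈ Finset.range (E.n + 1 - k), c (k + v) * (2 ^ (E.n + 1)) ^ v ∧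
    s'.reg 16 ≤ s.reg 16 ∧ E.Keeps 16 s s')
    (E.small (by omega)) ?_ ?_ ?_).mono (by omega) ?_
  · rintro k s' ⟨h1, -, -, -, h2⟩
    exact ⟨(hs.input.keeps h2).players, h1⟩
  · exact ⟨by simp, by simp, by simpa using h16, by simp,
      ((Env.Keeps.refl 16 s).setReg (by simp) _).setReg (by simp) _⟩
  · rintro k s₁ hk ⟨h18, h17, hT, hle, hk₁⟩
    have hs₁ := hs.keeps hk₁ (by simp)
    have hdig := sum_digits_mod (fun v => c (k + v)) (x := 2 ^ (E.n + 1)) (by positivity)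
      (fun v => hc _) (E.n - k)
    rw [show E.n - k + 1 = E.n + 1 - k by omega, ← hT] at hdig
    have hf1 := hs₁.fact (k + e - 1) (by omega)
    have hf2 := hs₁.fact (E.n - k - e) (by omega)
    -- The remainder has to be expressed through division and truncated subtraction.
    have hmod : s₁.reg 16 - 2 ^ (E.n + 1) * (s₁.reg 16 / 2 ^ (E.n + 1)) = c k := by
      have h1 := Nat.mod_add_div (s₁.reg 16) (2 ^ (E.n + 1))
      rw [hdig.1] at h1
      simp only [add_zero] at h1
      omega
    have hval : (NExpr.add (.reg 17) (.mul
        (.mul (.load (factE (.sub (.add (.reg 18) (.const e)) (.const 1))))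
          (.load (factE (.sub (.sub playersE (.reg 18)) (.const e)))))
        (.sub (.reg 16) (.mul (.reg 1) (.div (.reg 16) (.reg 1)))))).eval s₁ =
        ∑ v ∈ Finset.range (k + 1), coeffNum E.n e v * c v := by
      rw [Finset.sum_range_succ, coeffNum]
      simp only [NExpr.eval, factE, eval_playersE, h17, h18, hs₁.base, hs₁.radix,
        hs₁.input.players, hmod, Nat.add_assoc] at hf1 hf2 ⊢
      rw [hf1, hf2]
    refine Runs.setReg_seq (N := 1) ?_ ?_ ?_
    · interval_cases e <;> decide
    · rw [hval]
      exact E.pow_lt (E.sum_coeffNum_lt he hc (by omega)).le E.two_mul_sq_le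
    rw [hval]
    have hdiv : (NExpr.div (.reg 16) (.reg 1)).eval (s₁.setReg 17
        (∑ v ∈ Finset.range (k + 1), coeffNum E.n e v * c v)) = s₁.reg 16 / 2 ^ (E.n + 1) := by
      simp [NExpr.eval, hs₁.radix]
    have hdle : s₁.reg 16 / 2 ^ (E.n + 1) ≤ s.reg 16 := (Nat.div_le_self _ _).trans hle
    refine Runs.setReg (N := 0) (by decide) (by
      rw [hdiv]
      exact hdle.trans_lt (hb.reg 16)) ?_
    rw [hdiv]
    refine ⟨by simpa using h18, by simp, by simp, ?_, by simpa using hdle,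
      ((hk₁.setReg (by simp) _).setReg (by simp) _).setReg (by simp) _⟩
    simp only [State.setReg_reg]
    simp only [Nat.reduceEqDiff, if_false, if_true]
    rw [hdig.2, show E.n + 1 - (k + 1) = E.n - k by omega]
    exact Finset.sum_congr rfl fun v _ => by rw [show k + (v + 1) = k + 1 + v by omega]
  · rintro s' ⟨-, h1, -, -, h2⟩
    exact ⟨h1, h2⟩

open Classical in
theorem runs_count {s : State K} (hs : E.Ready s) {C : Finset (Fin E.n) → Prop}
    (hC : E.Solves C s) {e : ℕ} (he : e ≤ 1) :
    Runs M E.W (.seq computeGenFun (sumCoeffs e)) s (countSteps E.X) fun s' =>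
      s'.reg 17 = ∑ S : Finset (Fin E.n) with C S, coeffNum E.n e S.card ∧
      s'.reg 17 < 2 ^ (2 * E.X ^ 2) ∧ E.Keeps 16 s s' := by
  obtain ⟨σ, hwf, hst, hsol⟩ := hC
  refine Runs.seq' (runs_computeGenFun hs hst) ?_ le_rfl
  rintro s₁ ⟨h16, hk⟩
  set A : Finset (Finset (Fin E.n)) := Finset.univ.filter fun S => C S with hA
  have hgen : s₁.reg 16 = ∑ v ∈ Finset.range (E.n + 1),
      sizeCount A v * (2 ^ (E.n + 1)) ^ v := by
    rw [h16, genFun_eq _ hwf, Finset.filter_congr fun S _ => hsol S,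
      sum_sizeCount _ fun v => (2 ^ (E.n + 1)) ^ v]
    exact Finset.sum_congr rfl fun v _ => mul_comm _ _
  refine (runs_sumCoeffs (hs.keeps hk (by simp)) he (sizeCount_lt A) hgen).mono le_rfl ?_
  rintro s₂ ⟨h17, hk'⟩
  refine ⟨?_, ?_, hk.trans hk'⟩
  · rw [h17, ← sum_sizeCount A (coeffNum E.n e)]
  · rw [h17]
    exact E.sum_coeffNum_lt he (sizeCount_lt A) le_rfl

end Counting

/-! ### The contribution of one rule. -/

section Evaluation

/-- Adding to cell `0` the contribution of the coalitions that contain the player, or subtracting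
the contribution of those that do not (`b = true`), for the rule at register `2`. -/
def evalRule (b : Bool) : Program :=
  .seq (initLinks (.sub (.const 1) (.sub (.load (.reg 4)) (.const 2)))) <|
  .seq linkGroups <|
  .seq (.setReg 10 (.reg 2)) <|
  .seq (.setReg 13 playersE) <|
  .seq (.setReg 14 (.const 0)) <|
  .seq linkRule <|
  .seq (.setReg 16 playersE) <|
  .seq (.setReg 17 (.load (.const 1))) <|
  .seq (.setReg 18 (.const b.toNat)) <|
  .seq unionLinks <|
  .seq (.seq computeGenFun (sumCoeffs b.toNat)) <|
  .setNum (.const 0) <|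
    if b then .sub (.load (.const 0)) (.mul (.load (.reg 7)) (.ofNat (.reg 17)))
    else .add (.load (.const 0)) (.mul (.load (.reg 7)) (.ofNat (.reg 17)))

/-- The number of steps of `evalRule`. -/
def evalSteps (X : ℕ) : ℕ := 9 * X + 16 + groupSteps X + 2 * litSteps X + countSteps X

variable {K : Type} [Field K] {M : CostModel K} {E : Env}

open Classical in
/-- The sum of the coefficients over the relevant coalitions that contain the player (`b = false`)
or do not contain it (`b = true`). -/
noncomputable def ruleSum {n : ℕ} (i : Fin n) (γ : WeightedRule n K) (r : MCRule n K) (b : Bool) :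
    ℕ :=
  ∑ S : Finset (Fin n) with (r.expr.SatisfiedBy S ∧ γ.SatisfiedByPair S) ∧ (i ∈ S ↔ b = false),
    coeffNum n b.toNat S.card

/-- The player as an element of `Fin n`. -/
def Env.playerFin (E : Env) : Fin E.n := ⟨E.i, E.i_lt⟩

/-- The system collects the compatibility of all rules, the chosen rule itself, and an equation with
parity `b` between node `n` and the player, which encodes `i ∈ S` or `i ∉ S`. The height of cell `0`
grows by that of the weight, by `2 * X ^ 2 + 1` for the natural factor, and by one for each of the
two field operations. -/
theorem runs_evalRule {s : State K} (hs : E.Ready s) (b : Bool) (γ : WeightedRule E.n K)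
    {dG tG : List (List (MCRule E.n K))} {G dR tR : List (MCRule E.n K)} {r : MCRule E.n K}
    (hγ : γ.groups = dG ++ G :: tG) (hG : G = dR ++ r :: tR)
    (h4 : OccursAt E.inp (s.reg 4) γ.encode) (h2 : OccursAt E.inp (s.reg 2) r.expr.encode)
    (h5 : s.reg 5 = tG.length + 1)
    (hht : M.ht (s.num 0) + M.ht (s.num (s.reg 7)) + 2 * E.X ^ 2 + 3 ≤ E.W) :
    Runs M E.W (evalRule b) s (evalSteps E.X) fun s' => ∃ s₁,
      s' = s₁.setNum 0 (if b then s.num 0 - s.num (s.reg 7) * (ruleSum E.playerFin γ r b : K)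
        else s.num 0 + s.num (s.reg 7) * (ruleSum E.playerFin γ r b : K)) ∧
      M.ht (s'.num 0) ≤ M.ht (s.num 0) + M.ht (s.num (s.reg 7)) + 2 * E.X ^ 2 + 3 ∧
      E.Keeps 9 s s₁ ∧ s₁.reg 10 = s.reg 2 + r.expr.encode.length := by
  have hX := E.n_lt
  have hlen := E.length_le
  have h2le := h2.le
  have h4le := h4.le
  have hm : s.mem (s.reg 4) = γ.groups.length := by
    rw [hs.input _ (by simp [WeightedRule.encode, encodeBlocks] at h4le; omega)]
    simpa using OccursAt.getD h4
  unfold evalSteps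
  refine Runs.seq' (runs_initLinks (b := decide (γ.groups.length ≤ 2)) hs (by decide) ?_) ?_
    (N₂ := groupSteps E.X + (3 + 2 * litSteps E.X + (3 + (E.X * 5 + 6) + (countSteps E.X + 1))))
    (by omega)
  · intro s' hk
    simp only [NExpr.eval, hk.reg 4 (by simp) (by simp),
      (hs.input.keeps hk) _ (show s.reg 4 < E.inp.length by
        simp [WeightedRule.encode, encodeBlocks] at h4le; omega),
      ← hs.input _ (show s.reg 4 < E.inp.length by
        simp [WeightedRule.encode, encodeBlocks] at h4le; omega), hm]
    by_cases h : γ.groups.length ≤ 2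
    · simp [h]
    · simp [h]
      omega
  rintro s₁ ⟨hC₁, hk₁⟩
  have hs₁ := hs.keeps hk₁ (by simp)
  refine Runs.seq' (runs_linkGroups hs₁ hC₁ γ h4 hγ (hk₁.reg 4 (by simp) (by simp))
    ((hk₁.reg 5 (by simp) (by simp)).trans h5)) ?_ le_rfl
  rintro s₂ ⟨hC₂, hk₂⟩
  have hk₂ := (hk₁.mono (by simp)).trans hk₂
  have hs₂ := hs.keeps hk₂ (by simp)
  refine Runs.mono (N := 2 * litSteps E.X + (E.X * 5 + 6 + (countSteps E.X + 1) + 1 + 1 + 1) +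
    1 + 1 + 1) ?_ (by omega) fun _ => id
  have e2 : s₂.reg 2 = s.reg 2 := hk₂.reg 2 (by simp) (by simp)
  refine Runs.setReg_seq (by decide) (by simp only [NExpr.eval, e2]; exact E.small (by omega)) ?_
  simp only [NExpr.eval, e2]
  refine Runs.setReg_seq (by decide) (by
    simp only [eval_playersE, State.setReg_mem, hs₂.input.players]; exact E.small (by omega)) ?_
  simp only [eval_playersE, State.setReg_mem, hs₂.input.players]
  refine Runs.setReg_seq (by decide) (E.small (by simp [NExpr.eval])) ?_
  simp only [NExpr.eval]
  set s₃ := ((s₂.setReg 10 (s.reg 2)).setReg 13 E.n).setReg 14 0 with hs₃'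
  have hk₃ : E.Keeps 10 s s₃ := ((hk₂.setReg (by simp) _).setReg (by simp) _).setReg (by simp) _
  have hs₃ := hs.keeps hk₃ (by simp)
  have hC₃ : E.Solves _ s₃ := ((hC₂.setReg (by simp) _).setReg (by simp) _).setReg (by simp) _
  have h10₃ : s₃.reg 10 = s.reg 2 := by simp [hs₃']
  have h13₃ : s₃.reg 13 = E.n := by simp [hs₃']
  have h14₃ : s₃.reg 14 = false.toNat := by simp [hs₃']
  clear_value s₃
  refine Runs.seq' (runs_linkRule hs₃ hC₃ r.expr h2 h10₃ h13₃ le_rfl h14₃) ?_ le_rfl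
  rintro s₄ ⟨hC₄, hk₄'⟩
  have h10₄ := hk₄'.reg 10 (by simp) (by simp)
  simp only [State.setReg_reg, if_true] at h10₄
  have hk₄ := hk₃.trans (hk₄'.of_setReg (m' := 10) (by simp) (by simp))
  have hs₄ := hs.keeps hk₄ (by simp)
  refine Runs.setReg_seq (by decide) (by
    simp only [eval_playersE, hs₄.input.players]; exact E.small (by omega)) ?_
  simp only [eval_playersE, hs₄.input.players]
  have hi := E.i_lt
  refine Runs.setReg_seq (by decide) (by
    simp only [NExpr.eval, State.setReg_mem, hs₄.input.player]; exact E.small (by omega)) ?_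
  simp only [NExpr.eval, State.setReg_mem, hs₄.input.player]
  refine Runs.setReg_seq (by cases b <;> decide) (by
    simp only [NExpr.eval]; exact E.bool_small b) ?_
  simp only [NExpr.eval]
  set s₅ := ((s₄.setReg 16 E.n).setReg 17 E.i).setReg 18 b.toNat with hs₅'
  have hk₅ : E.Keeps 10 s s₅ := ((hk₄.setReg (by simp) _).setReg (by simp) _).setReg (by simp) _
  have hs₅ := hs.keeps hk₅ (by simp)
  have hC₅ : E.Solves _ s₅ := ((hC₄.setReg (by simp) _).setReg (by simp) _).setReg (by simp) _
  have h10₅ : s₅.reg 10 = s.reg 2 + r.expr.encode.length := by simpa [hs₅'] using h10₄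
  refine Runs.seq' (runs_unionLinks hs₅ hC₅ (u := E.n) (v := E.i) (e := b) (by simp [hs₅'])
    (by simp [hs₅']) (by simp [hs₅']) le_rfl hi.le) ?_ le_rfl
  clear_value s₅
  rintro s₆ ⟨hC₆, hk₆'⟩
  have h10₆ := (hk₆'.reg 10 (by simp) (by simp)).trans h10₅
  have hk₆ := hk₅.trans (hk₆'.mono (by simp))
  have hs₆ := hs.keeps hk₆ (by simp)
  have hb1 : b.toNat ≤ 1 := b.toNat_le
  -- The accumulated equations are turned back into the condition that defines `ruleSum`.
  have hC₆ := hC₆.congr (C' := fun S => (r.expr.SatisfiedBy S ∧ γ.SatisfiedByPair S) ∧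
    (E.playerFin ∈ S ↔ b = false)) (by
      intro S
      have hmem : r ∈ G := by simp [hG]
      have h1 := γ.satisfiedByPair_iff hγ hmem S
      have h2 : (charFun S E.n ^^ charFun S E.i) = b ↔ (E.playerFin ∈ S ↔ b = false) := by
        have : charFun S E.i = decide (E.playerFin ∈ S) := charFun_fin S E.playerFin
        rw [charFun_self, this]
        by_cases h : E.playerFin ∈ S <;> cases b <;> simp [h]
      rw [h2, Conj.linked_self]
      refine and_congr_left fun _ => ?_
      simp only [decide_eq_true_eq, Bool.false_eq_true, if_false]
      rw [and_comm (a := r.expr.SatisfiedBy S), h1])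
  refine Runs.seq' (runs_count hs₆ hC₆ hb1) ?_ le_rfl
  rintro s₇ ⟨h17, hlt, hk₇'⟩
  have h10₇ := (hk₇'.reg 10 (by simp) (by simp)).trans h10₆
  have hk₇ := hk₆.trans (hk₇'.mono (by simp))
  have hsum : s₇.reg 17 = ruleSum E.playerFin γ r b := by
    rw [h17]
    unfold ruleSum
    congr!
  have hnat : M.ht ((s₇.reg 17 : ℕ) : K) ≤ 2 * E.X ^ 2 + 1 :=
    (M.ht_nat _).trans (Nat.succ_le_succ (Nat.size_le.2 hlt))
  have e7 : s₇.reg 7 = s.reg 7 := hk₇.reg 7 (by simp) (by simp)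
  have hmul := M.ht_mul (s.num (s.reg 7)) ((s₇.reg 17 : ℕ) : K)
  have hadd := M.ht_add (s.num 0) (s.num (s.reg 7) * ((s₇.reg 17 : ℕ) : K))
  have hsub := M.ht_sub (s.num 0) (s.num (s.reg 7) * ((s₇.reg 17 : ℕ) : K))
  have hval : (if b then KExpr.sub (.load (.const 0)) (.mul (.load (.reg 7)) (.ofNat (.reg 17)))
      else .add (.load (.const 0)) (.mul (.load (.reg 7)) (.ofNat (.reg 17)))).eval s₇ =
      if b then s.num 0 - s.num (s.reg 7) * ((s₇.reg 17 : ℕ) : K)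
        else s.num 0 + s.num (s.reg 7) * ((s₇.reg 17 : ℕ) : K) := by
    cases b <;> simp [KExpr.eval, NExpr.eval, hk₇.num, e7]
  have hbound : M.ht (if b then s.num 0 - s.num (s.reg 7) * ((s₇.reg 17 : ℕ) : K)
        else s.num 0 + s.num (s.reg 7) * ((s₇.reg 17 : ℕ) : K)) ≤
      M.ht (s.num 0) + M.ht (s.num (s.reg 7)) + 2 * E.X ^ 2 + 3 := by
    split_ifs <;> omega
  refine Runs.setNum (N := 0) (by decide) (by cases b <;> decide) ?_ ?_
  · rw [hval]
    exact hbound.trans hht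
  · rw [hval]
    refine ⟨s₇, by rw [← hsum]; rfl, ?_, hk₇.mono (by simp), h10₇⟩
    simpa [State.setNum_num, NExpr.eval] using hbound

end Evaluation

/-! ### Traversing all rules. -/

section Walk

/-- The traversal of all the rules: register `2` points to the current rule, register `4` to the
current weighted rule, and register `5` holds the number of the current group. -/
def walkRules (body : Program) : Program :=
  forBlocks 2 3 (.seq (.setReg 4 (.reg 2)) (forBlocks 2 5 (forBlocks 2 6 body)))

/-- The number of steps of a traversal with `N` steps for every rule. -/
def walkSteps (X N : ℕ) : ℕ := 20 * X * (20 * X * (20 * X * (N + 2) + 3 + 2) + 4 + 2) + 3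

variable {K : Type} {n : ℕ}

/-- The rules, with the weighted rules to which they belong. -/
def allRules (Γ : List (WeightedRule n K)) : List (WeightedRule n K × MCRule n K) :=
  Γ.flatMap fun γ => γ.groups.flatten.map fun r => (γ, r)

variable [Field K] {M : CostModel K} {E : Env}

/-- The invariant is indexed by the flat list of rules already visited and must not depend on
registers `2` to `6`, which steer the three nested loops. The traversal serves twice: to find the
end of the input, and to add up the contributions. -/
theorem runs_walkRules {Γ : List (WeightedRule E.n K)} {body : Program} {N : ℕ}
    (I : List (WeightedRule E.n K × MCRule E.n K) → State K → Prop)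
    (hI : ∀ L s r v, 2 ≤ r → r ≤ 6 → I L s → I L (s.setReg r v))
    (hinp : ∀ L s, I L s → E.Input s)
    (hbody : ∀ L rest γ dG G tG dR r tR s, allRules Γ = L ++ (γ, r) :: rest →
      γ.groups = dG ++ G :: tG → G = dR ++ r :: tR → OccursAt E.inp (s.reg 4) γ.encode →
      OccursAt E.inp (s.reg 2) r.expr.encode → s.reg 5 = tG.length + 1 → I L s →
      Runs M E.W body s N fun s' => (∀ r, 3 ≤ r → r ≤ 6 → s'.reg r = s.reg r) ∧
        s'.reg 2 = s.reg 2 + r.expr.encode.length ∧ I (L ++ [(γ, r)]) s')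
    {a : ℕ} (hocc : OccursAt E.inp a (encodeBlocks (Γ.map fun γ => γ.encode)))
    {s : State K} (h2 : s.reg 2 = a) (h0 : I [] s) :
    Runs M E.W (walkRules body) s (walkSteps E.X N) fun s' => I (allRules Γ) s' ∧
      s'.reg 2 = a + (encodeBlocks (Γ.map fun γ => γ.encode)).length := by
  have hX := E.n_lt
  have hlen := E.length_le
  have henc : ∀ l : List (List ℕ), encodeBlocks l ≠ [] := by simp [encodeBlocks]
  have hbound : ∀ {α : Type} {b : ℕ} {l : List α} {enc : α → List ℕ},
      OccursAt E.inp b (encodeBlocks (l.map enc)) → (∀ x, enc x ≠ []) → l.length ≤ 20 * E.X :=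
    fun h h' => (length_le_of_occursAt h h').trans hlen
  unfold walkSteps
  refine (Runs.forBlocks (X := 20 * E.X) (by simp) (fun done s' => I (allRules done) s')
    (hinp _ _ h0) (E.small (by omega)) (hbound hocc fun _ => henc _) (E.small (by omega)) hocc h2
    (hI _ _ _ _ (by simp) (by simp) (hI _ _ _ _ (by simp) (by simp) h0))
    (N := 20 * E.X * (20 * E.X * (N + 2) + 3 + 2) + 4) ?_).mono le_rfl
    (fun s' h => ⟨h.1, h.2.1⟩)
  rintro dΓ γ tΓ s₁ hΓ hγocc hI₁ hp₁ hc₁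
  set p₁ := blockPos a (fun γ : WeightedRule E.n K => γ.encode) dΓ with hp₁'
  have hle := hγocc.le
  have hset : (NExpr.reg 2).eval s₁ = p₁ := hp₁
  refine Runs.setReg_seq (N := 20 * E.X * (20 * E.X * (N + 2) + 3 + 2) + 3) (by decide)
    (by rw [hset]; exact E.small (by omega)) ?_
  rw [hset]
  have hI₁' := hI _ _ 4 p₁ (by simp) (by simp) hI₁
  refine (Runs.forBlocks (X := 20 * E.X) (by simp) (fun dG s' =>
    I (allRules dΓ ++ dG.flatten.map fun r => (γ, r)) s' ∧ s'.reg 4 = p₁ ∧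
      s'.reg 3 = tΓ.length + 1)
    (hinp _ _ hI₁') (E.small (by omega)) (hbound hγocc fun _ => henc _) (E.small (by omega))
    hγocc (by simpa using hp₁)
    ⟨by simpa using hI _ _ _ _ (by simp) (by simp) (hI _ _ _ _ (by simp) (by simp) hI₁'),
      by simp, by simpa using hc₁⟩
    (N := 20 * E.X * (N + 2) + 3) ?_).mono le_rfl ?_
  · rintro dG G tG s₂ hγ hGocc ⟨hI₂, h4₂, h3₂⟩ hp₂ hc₂
    refine (Runs.forBlocks (X := 20 * E.X) (by simp) (fun dR s' =>
      I (allRules dΓ ++ (dG.flatten ++ dR).map fun r => (γ, r)) s' ∧ s'.reg 4 = p₁ ∧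
        s'.reg 3 = tΓ.length + 1 ∧ s'.reg 5 = tG.length + 1)
      (hinp _ _ hI₂) (E.small (by omega))
      (hbound hGocc fun _ => by simp [Conj.encode, encodeBlocks]) (E.small (by omega))
      hGocc hp₂
      ⟨by simpa using hI _ _ _ _ (by simp) (by simp) (hI _ _ _ _ (by simp) (by simp) hI₂),
        by simpa using h4₂, by simpa using h3₂, by simpa using hc₂⟩ ?_).mono le_rfl ?_
    · rintro dR r tR s₃ hG hrocc ⟨hI₃, h4₃, h3₃, h5₃⟩ hp₃ hc₃
      refine (hbody _ (tR.map (fun r => (γ, r)) ++ (tG.flatten.map (fun r => (γ, r)) ++ allRules tΓ))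
        γ dG G tG dR r tR s₃ ?_ hγ hG (by rw [h4₃]; exact hγocc) (by rw [hp₃]; exact hrocc)
        h5₃ hI₃).mono le_rfl ?_
      · rw [hΓ]
        simp [allRules, hγ, hG]
      · rintro s' ⟨hreg, hp', hI'⟩
        refine ⟨(hreg 6 (by simp) le_rfl).trans hc₃, by rw [hp', hp₃],
          hI _ _ _ _ (by simp) (by simp) ?_, ?_, ?_, ?_⟩
        · simpa using hI'
        · simpa using (hreg 4 (by simp) (by simp)).trans h4₃
        · simpa using (hreg 3 (by simp) (by simp)).trans h3₃
        · simpa using (hreg 5 (by simp) (by simp)).trans h5₃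
    · rintro s' ⟨⟨hI', h4', h3', h5'⟩, hp', -⟩
      exact ⟨h5', hp', hI _ _ _ _ (by simp) (by simp) (by simpa using hI'), by simpa using h4',
        by simpa using h3'⟩
  · rintro s' ⟨⟨hI', h4', h3'⟩, hp', -⟩
    refine ⟨h3', hp', hI _ _ _ _ (by simp) (by simp) ?_⟩
    simpa [allRules] using hI'

end Walk

/-! ### The complete program and its correctness. -/

section Main

/-- Skipping the code of a conjunction. -/
def skipRule : Program :=
  .seq (.setReg 2 (.add (.add (.reg 2) (.load (.reg 2))) (.const 1)))
    (.setReg 2 (.add (.add (.reg 2) (.load (.reg 2))) (.const 1)))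

/-- Computing the base address, the radix and the factorials. -/
def setup : Program :=
  .seq (.setReg 2 (.const 2)) <|
  .seq (walkRules skipRule) <|
  .seq (.setReg 0 (.reg 2)) <|
  .seq (.setReg 1 (.const 1)) <|
  .seq (forPlayers 3 (.setReg 1 (.mul (.reg 1) (.const 2)))) <|
  .seq (.setMem (factE (.const 0)) (.const 1)) <|
  forPlayers 3 (.setMem (factE (.add (.reg 3) (.const 1)))
    (.mul (.load (factE (.reg 3))) (.add (.reg 3) (.const 1))))

/-- Adding the contribution of the rule at register `2` to cell `0`. -/
def addRule : Program :=
  .seq (evalRule false) <|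
  .seq (evalRule true) <|
  .seq (.setReg 7 (.add (.reg 7) (.const 1))) (.setReg 2 (.reg 10))

/-- The program that computes the MQ-value. -/
def mqProgram : Program :=
  .seq setup <|
  .seq (.setReg 2 (.const 2)) <|
  .seq (.setReg 7 (.const 1)) <|
  .seq (walkRules addRule) <|
  .setNum (.const 0) (.div (.load (.const 0)) (.ofNat (.load (factE playersE))))

/-- The number of steps of `setup`. -/
def setupSteps (X : ℕ) : ℕ := walkSteps X 2 + 6 * X + 8

/-- The number of steps of `mqProgram`. -/
def mqSteps (X : ℕ) : ℕ := setupSteps X + walkSteps X (2 * evalSteps X + 2) + 3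

variable {K : Type}

theorem length_encode_literals {n : ℕ} (l : List (Fin n)) :
    (encodeBlocks (l.map fun a => [a.val])).length = l.length + 1 := by
  rw [encodeBlocks, List.length_cons]
  congr 1
  induction l with
  | nil => rfl
  | cons a l ih =>
    simp only [List.map_cons, List.flatten_cons, List.length_append, List.length_cons, ih,
      List.length_nil]
    omega

/-- The weights are stored in the order of the traversal, so a counter of visited rules serves as
the address of the current weight. -/
theorem weights_eq {n : ℕ} (Γ : List (WeightedRule n K)) :
    weights Γ = (allRules Γ).map fun x => x.2.weight := by
  unfold weights allRules
  rw [List.map_flatMap, List.flatMap]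
  simp [Function.comp_def]

theorem sum_map_allRules {n : ℕ} {β : Type} [AddCommMonoid β] (Γ : List (WeightedRule n K))
    (f : WeightedRule n K × MCRule n K → β) : ((allRules Γ).map f).sum =
      (Γ.map fun γ => (γ.groups.flatten.map fun r => f (γ, r)).sum).sum := by
  induction Γ with
  | nil => rfl
  | cons γ Γ ih =>
    rw [allRules, List.flatMap_cons, List.map_append, List.sum_append, List.map_map]
    rw [allRules] at ih
    rw [ih, List.map_cons, List.sum_cons]
    rfl

variable [Field K] {M : CostModel K} {E : Env}

theorem runs_skipRule {s : State K} (hs : E.Input s) {α : Conj E.n}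
    (h : OccursAt E.inp (s.reg 2) α.encode) :
    Runs M E.W skipRule s 2 fun s' => s' = s.setReg 2 (s.reg 2 + α.encode.length) := by
  have hX := E.n_lt
  have hlen := E.length_le
  have hle := h.le
  simp only [Conj.encode, List.length_append, length_encode_literals] at hle ⊢
  have h1 : s.mem (s.reg 2) = α.pos.length := by
    rw [hs _ (by omega)]
    simpa using OccursAt.getD h.left
  have h2 : s.mem (s.reg 2 + α.pos.length + 1) = α.neg.length := by
    rw [hs _ (by omega)]
    have := h.right
    rw [length_encode_literals, ← Nat.add_assoc] at this
    simpa using OccursAt.getD this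
  have e1 : (NExpr.add (.add (.reg 2) (.load (.reg 2))) (.const 1)).eval s =
      s.reg 2 + α.pos.length + 1 := by simp [NExpr.eval, h1]
  refine Runs.setReg_seq (N := 1) (by decide) (by rw [e1]; exact E.small (by omega)) ?_
  rw [e1]
  have e2 : (NExpr.add (.add (.reg 2) (.load (.reg 2))) (.const 1)).eval
      (s.setReg 2 (s.reg 2 + α.pos.length + 1)) =
      s.reg 2 + (α.pos.length + 1 + (α.neg.length + 1)) := by
    simp [NExpr.eval, h2]
    omega
  refine Runs.setReg (N := 0) (by decide) (by rw [e2]; exact E.small (by omega)) ?_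
  rw [e2]
  simp [State.setReg]

/-- The input does not state its own length, so the first free cell is found by a traversal that
skips every rule. -/
theorem runs_setup {Γ : List (WeightedRule E.n K)} {s : State K} (hs : E.Input s)
    (hocc : OccursAt E.inp 2 (encodeBlocks (Γ.map fun γ => γ.encode)))
    (hlen : E.inp.length = 2 + (encodeBlocks (Γ.map fun γ => γ.encode)).length) :
    Runs M E.W setup s (setupSteps E.X) fun s' => E.Ready s' ∧ s'.num = s.num := by
  have hX : E.n + 1 ≤ E.X := E.n_lt
  have hl := E.length_le
  refine Runs.mono (N := walkSteps E.X 2 + ((E.X * 3 + 2) + ((E.X * 3 + 2) + 1) + 1 + 1) + 1) ?_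
    (by unfold setupSteps; omega) fun _ => id
  refine Runs.setReg_seq (by decide) (E.small (by simp [NExpr.eval])) ?_
  simp only [NExpr.eval]
  have hwalk : Runs M E.W (walkRules skipRule) (s.setReg 2 2) (walkSteps E.X 2) _ :=
    runs_walkRules (Γ := Γ) (fun _ s' => E.Input s' ∧ s'.num = s.num)
      (fun _ _ _ _ _ _ h => h) (fun _ _ h => h.1) (by
        intro L rest γ dG G tG dR r tR s' _ _ _ _ hr _ hI
        refine (runs_skipRule hI.1 hr).mono le_rfl ?_
        rintro _ rfl
        exact ⟨fun r hr hr' => by rw [State.setReg_reg, if_neg (by omega)], by simp, hI⟩)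
      hocc (by simp) ⟨hs, rfl⟩
  refine Runs.seq' (P := fun s' => s'.reg 2 = E.base ∧ E.Input s' ∧ s'.num = s.num)
    (hwalk.mono le_rfl fun s' h => ⟨h.2.trans hlen.symm, h.1⟩) ?_ le_rfl
  rintro s₁ ⟨h2, hin, hnum⟩
  have hbase : E.base = E.inp.length := rfl
  refine Runs.setReg_seq (by decide) (by
    simp only [NExpr.eval, h2]; exact E.small (by omega)) ?_
  refine Runs.setReg_seq (by decide) (E.small (by simp [NExpr.eval])) ?_
  simp only [NExpr.eval, h2]
  have hpow : ∀ k ≤ E.n + 1, 2 ^ k < 2 ^ E.W := fun k hk => by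
    refine E.pow_lt le_rfl ?_
    nlinarith [Nat.zero_le (E.X ^ 3), Nat.zero_le (E.X ^ 2)]
  refine Runs.seq' (P := fun s' => s'.reg 1 = 2 ^ (E.n + 1) ∧ s'.reg 0 = E.base ∧
    s'.mem = s₁.mem ∧ s'.num = s₁.num) (N₁ := E.X * 3 + 2)
    -- The `n + 1` rounds of doubling give exactly the radix `2 ^ (n + 1)`.
    ((Runs.forPlayers (n := E.n) (N := 1) (fun k s' => s'.reg 3 = k ∧ s'.reg 1 = 2 ^ k ∧
      s'.reg 0 = E.base ∧ s'.mem = s₁.mem ∧ s'.num = s₁.num) (E.small (by omega)) ?_ ?_ ?_).mono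
      (by omega) fun s' h => h.2) ?_ le_rfl
  · rintro k s' ⟨h3, -, -, hm, -⟩
    exact ⟨by rw [hm, hin.players], h3⟩
  · simp
  · rintro k s' hk ⟨h3, h1, h0, hm, hn⟩
    have e1 : (NExpr.mul (.reg 1) (.const 2)).eval s' = 2 ^ (k + 1) := by
      simp [NExpr.eval, h1, pow_succ]
    refine Runs.setReg (N := 0) (by decide) (by rw [e1]; exact hpow _ (by omega)) ?_
    rw [e1]
    simp [h3, h0, hm, hn]
  rintro s₂ ⟨h1, h0, hm, hn⟩
  have e0 : (factE (.const 0)).eval s₂ = E.base + 2 := by simp [factE, NExpr.eval, h0]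
  refine Runs.setMem_seq (by decide) (by decide) (E.small (by simp [NExpr.eval])) ?_
  rw [e0]
  simp only [NExpr.eval]
  refine (Runs.forPlayers (n := E.n) (N := 1) (fun k s' => s'.reg 3 = k ∧
    s'.reg 1 = 2 ^ (E.n + 1) ∧ s'.reg 0 = E.base ∧ (∀ t < E.inp.length, s'.mem t = s₁.mem t) ∧
    s'.num = s₁.num ∧ ∀ v ≤ k, s'.mem (E.base + 3 * v + 2) = v.factorial)
    (E.small (by omega)) ?_ ?_ ?_).mono (by omega) ?_
  · rintro k s' ⟨h3, -, -, hm, -⟩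
    exact ⟨by rw [hm 0 (by have := E.length_pos; omega), hin.players], h3⟩
  · refine ⟨by simp, by simpa using h1, by simpa using h0, fun t ht => ?_, by simpa using hn, ?_⟩
    · rw [State.setReg_mem, State.setMem_mem, if_neg (by omega), hm]
    · rintro v hv
      obtain rfl : v = 0 := by omega
      simp [State.setMem_mem]
  · rintro k s' hk ⟨h3, h1, h0, hm, hn, hf⟩
    have e1 : (NExpr.mul (.load (factE (.reg 3))) (.add (.reg 3) (.const 1))).eval s' =
        (k + 1).factorial := by
      rw [Nat.factorial_succ, mul_comm (k + 1)]
      simp [NExpr.eval, factE, h0, h3, hf k le_rfl]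
    have e2 : (factE (.add (.reg 3) (.const 1))).eval s' = E.base + 3 * (k + 1) + 2 := by
      simp [NExpr.eval, factE, h0, h3]
    refine Runs.setMem (N := 0) (by decide) (by decide) ?_ ?_
    · rw [e1]
      -- The last round writes `(n + 1)!`, one entry more than is needed, so the bound is taken at
      -- `n + 1`.
      refine E.pow_lt (factorial_le_two_pow (n := E.n + 1) (by omega)) ?_
      have := Nat.mul_le_mul hX hX
      have := E.two_mul_sq_le
      nlinarith
    · rw [e1, e2]
      refine ⟨h3, by simp, by simpa using h1, by simpa using h0, fun t ht => ?_, by simpa using hn,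
        fun v hv => ?_⟩
      · rw [State.setReg_mem, State.setMem_mem, if_neg (by omega), hm t ht]
      · rw [State.setReg_mem, State.setMem_mem]
        split_ifs with h
        · rw [show v = k + 1 by omega]
        · exact hf v (by omega)
  · rintro s' ⟨-, h1, h0, hm, hn, hf⟩
    exact ⟨⟨fun t ht => (hm t ht).trans (hin t ht), h0, h1, fun v hv => hf v (by omega)⟩,
      hn.trans hnum⟩

/-- The contribution of a rule to the MQ-value, times the factorial of the number of players. -/
noncomputable def contribution {n : ℕ} (i : Fin n) (x : WeightedRule n K × MCRule n K) : K :=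
  x.2.weight * ((ruleSum i x.1 x.2 false : K) - (ruleSum i x.1 x.2 true : K))

theorem mqValue_eq_contribution {n : ℕ} (Γ : List (WeightedRule n K)) (i : Fin n) :
    mqValue (game Γ) i = ((allRules Γ).map (contribution i)).sum / (n.factorial : K) := by
  rw [mqValue_game, sum_map_allRules, div_eq_mul_inv, ← List.sum_map_mul_right]
  congr 1
  refine List.map_congr_left fun γ _ => ?_
  rw [← List.sum_map_mul_right]
  congr 1
  refine List.map_congr_left fun r _ => ?_
  have h := sum_shapleyCoeff (K := K) i fun S => r.expr.SatisfiedBy S ∧ γ.SatisfiedByPair S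
  simp only [contribution, ruleSum, Bool.toNat_true, Bool.toNat_false, mul_assoc]
  rw [← div_eq_mul_inv]
  congr 1
  convert h <;> simp

theorem runs_mqProgram {Γ : List (WeightedRule E.n K)} {s : State K} (hs : E.Input s)
    (hocc : OccursAt E.inp 2 (encodeBlocks (Γ.map fun γ => γ.encode)))
    (hlen : E.inp.length = 2 + (encodeBlocks (Γ.map fun γ => γ.encode)).length)
    (h0 : s.num 0 = 0) (hnum : ∀ k, s.num (k + 1) = (weights Γ).getD k 0)
    (hcard : (allRules Γ).length ≤ E.X) (hht : ∀ x ∈ allRules Γ, M.ht x.2.weight ≤ E.X) :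
    Runs M E.W mqProgram s (mqSteps E.X) fun s' => s'.num 0 = mqValue (game Γ) E.playerFin := by
  have hX : E.n + 1 ≤ E.X := E.n_lt
  have hl := E.length_le
  refine Runs.seq' (runs_setup hs hocc hlen)
    (N₂ := walkSteps E.X (2 * evalSteps E.X + 2) + 1 + 1 + 1) ?_ le_rfl
  rintro s₁ ⟨hs₁, hn₁⟩
  refine Runs.setReg_seq (by decide) (E.small (by simp [NExpr.eval])) ?_
  refine Runs.setReg_seq (by decide) (E.small (by simp [NExpr.eval])) ?_
  simp only [NExpr.eval]
  -- The growth of the height of cell `0` per rule: two evaluations, each adding at most `X` for the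
  -- weight and `2 * X ^ 2 + 3` for the rest. The bound below leaves room for the final division by
  -- `n!`.
  set B := 2 * (E.X + 2 * E.X ^ 2 + 3) with hB
  have hBW : 1 + E.X * B + (2 * E.X ^ 2 + 3) ≤ E.W := by
    refine le_trans ?_ E.le_W
    rw [hB]
    nlinarith [Nat.zero_le (E.X ^ 3), Nat.zero_le (E.X ^ 2)]
  refine Runs.seq' (P := fun s' => E.Ready s' ∧
    s'.num 0 = ((allRules Γ).map (contribution E.playerFin)).sum ∧
    M.ht (s'.num 0) ≤ 1 + E.X * B) ((runs_walkRules (Γ := Γ) (fun L s' => E.Ready s' ∧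
      s'.reg 7 = L.length + 1 ∧ s'.num 0 = (L.map (contribution E.playerFin)).sum ∧
      (∀ k, s'.num (k + 1) = (weights Γ).getD k 0) ∧ M.ht (s'.num 0) ≤ 1 + L.length * B)
      ?_ (fun _ _ h => h.1.input) ?_ hocc (by simp) ?_).mono le_rfl ?_) ?_ le_rfl
  · rintro L s' r v hr hr' ⟨h1, h2, h3⟩
    exact ⟨h1.setReg hr v, by rw [State.setReg_reg, if_neg (by omega), h2], h3⟩
  · rintro L rest γ dG G tG dR r tR s' hΓ hγ hG h4 h2 h5 ⟨hr, h7, hv, hw, hh⟩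
    have hL : L.length + 1 ≤ E.X := by
      rw [hΓ] at hcard
      simp only [List.length_append, List.length_cons] at hcard
      omega
    have hLB : L.length * B + B ≤ E.X * B := by
      have := Nat.mul_le_mul_right B hL
      rw [Nat.add_mul, Nat.one_mul] at this
      exact this
    have hweight : s'.num (s'.reg 7) = r.weight := by
      rw [h7, hw, weights_eq, hΓ]
      simp
    have hrw : M.ht (s'.num (s'.reg 7)) ≤ E.X := by
      rw [hweight]
      exact hht (γ, r) (by simp [hΓ])
    refine Runs.seq' (runs_evalRule hr false γ hγ hG h4 h2 h5 (by omega)) ?_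
      (N₂ := evalSteps E.X + 1 + 1) (by omega)
    rintro _ ⟨s₂, rfl, hht₂, hk₂, h10₂⟩
    simp only [Bool.false_eq_true, if_false] at hht₂ ⊢
    set v₂ := s'.num 0 + s'.num (s'.reg 7) * (ruleSum E.playerFin γ r false : K) with hv₂
    have hr₂ : E.Ready (s₂.setNum 0 v₂) := by
      have := hr.keeps hk₂ (by simp)
      exact ⟨this.input, this.base, this.radix, this.fact⟩
    have e2 : s₂.reg 2 = s'.reg 2 := hk₂.reg 2 (by simp) (by simp)
    have e4 : s₂.reg 4 = s'.reg 4 := hk₂.reg 4 (by simp) (by simp)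
    have e5 : s₂.reg 5 = s'.reg 5 := hk₂.reg 5 (by simp) (by simp)
    have e7 : s₂.reg 7 = s'.reg 7 := hk₂.reg 7 (by simp) (by simp)
    have en0 : (s₂.setNum 0 v₂).num 0 = v₂ := by simp [State.setNum_num]
    have enk : ∀ k, (s₂.setNum 0 v₂).num (k + 1) = s'.num (k + 1) := fun k => by
      simp [State.setNum_num, hk₂.num]
    have en7 : (s₂.setNum 0 v₂).num ((s₂.setNum 0 v₂).reg 7) = r.weight := by
      rw [State.setNum_reg, e7, h7, enk, ← h7, hweight]
    rw [en0] at hht₂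
    refine Runs.seq' (runs_evalRule hr₂ true γ hγ hG (by simpa [e4] using h4)
      (by simpa [e2] using h2) (by simpa [e5] using h5) ?_) ?_
      (N₂ := 1 + 1) (by omega)
    · rw [en0, en7, ← hweight]
      omega
    rintro _ ⟨s₃, rfl, hht₃, hk₃, h10₃⟩
    rw [en0, en7] at hht₃ ⊢
    simp only [if_true] at hht₃ ⊢
    set v₃ := v₂ - r.weight * (ruleSum E.playerFin γ r true : K) with hv₃
    have hr₃ : E.Ready (s₃.setNum 0 v₃) := by
      have := hr₂.keeps hk₃ (by simp)
      exact ⟨this.input, this.base, this.radix, this.fact⟩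
    have f7 : s₃.reg 7 = L.length + 1 := by
      rw [hk₃.reg 7 (by simp) (by simp), State.setNum_reg, e7, h7]
    have f10 : s₃.reg 10 = s'.reg 2 + r.expr.encode.length := by
      rw [h10₃, State.setNum_reg, e2]
    have hle := h2.le
    refine Runs.setReg_seq (by decide) (by
      simp only [NExpr.eval, State.setNum_reg, f7]; exact E.small (by omega)) ?_
    refine Runs.setReg (N := 0) (by decide) (by
      simp [NExpr.eval, f10]; exact E.small (by omega)) ?_
    simp only [NExpr.eval, State.setNum_reg, f7, State.setReg_reg, Nat.reduceEqDiff, if_false,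
      f10]
    refine ⟨fun j hj hj' => ?_, by simp, ((hr₃.setReg (by simp) _).setReg (by simp) _), by simp,
      ?_, fun k => ?_, ?_⟩
    · simp only [if_neg (show j ≠ 2 by omega), if_neg (show j ≠ 7 by omega)]
      rw [hk₃.reg j (by omega) (by omega), State.setNum_reg, hk₂.reg j (by omega) (by omega)]
    · simp only [State.setReg_num, State.setNum_num, if_true, List.map_append, List.sum_append,
        List.map_cons, List.map_nil, List.sum_singleton, ← hv, contribution, hv₃, hv₂, hweight]
      ring
    · simp only [State.setReg_num, State.setNum_num, hk₃.num, Nat.add_eq_zero_iff,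
        Nat.one_ne_zero, and_false, if_false]
      rw [hk₂.num, hw k]
    · simp only [State.setReg_num]
      refine hht₃.trans ?_
      rw [← hweight, List.length_append, List.length_singleton, Nat.add_mul, Nat.one_mul]
      omega
  · refine ⟨(hs₁.setReg (by simp) _).setReg (by simp) _, by simp, by simp [hn₁, h0],
      fun k => by simp [hn₁, hnum], ?_⟩
    have := M.ht_nat 0
    simpa [hn₁, h0] using this
  · rintro s' ⟨⟨h1, -, h3, -, h5⟩, -⟩
    exact ⟨h1, h3, h5.trans (Nat.add_le_add_left (Nat.mul_le_mul_right _ hcard) _)⟩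
  rintro s' ⟨hr, hv, hh⟩
  have hfact : ((factE playersE).eval s') = E.base + 3 * E.n + 2 := by
    simp [factE, NExpr.eval, hr.base, hr.input.players]
  have e1 : (KExpr.div (.load (.const 0)) (.ofNat (.load (factE playersE)))).eval s' =
      s'.num 0 / (E.n.factorial : K) := by
    simp [KExpr.eval, NExpr.eval, hfact, hr.fact E.n le_rfl]
  refine Runs.setNum (N := 0) (by decide) (by decide) ?_ ?_
  · rw [e1]
    have h1 := M.ht_div (s'.num 0) (E.n.factorial : K)
    have h2 := M.ht_nat (K := K) E.n.factorial
    have h3 : E.n.factorial < 2 ^ (2 * E.X ^ 2) :=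
      (factorial_le_two_pow le_rfl).trans_lt (Nat.pow_lt_pow_right (by simp) (by nlinarith))
    have h4 := Nat.size_le.2 h3
    omega
  · rw [e1, hv, mqValue_eq_contribution]
    simp [State.setNum_num, NExpr.eval]

end Main

/-! ### Length and entries of the encoded input. -/

section Size

variable {n : ℕ} {K : Type}

/-- All entries of the list are bounded by `n` plus the length of the list. -/
def SmallEntries (n : ℕ) (l : List ℕ) : Prop := ∀ t ∈ l, t ≤ n + l.length

/-- The leading entry is the number of blocks, at most the total length because no block is empty.
Small entries are what bounds the bit lengths in the initial memory. -/
theorem SmallEntries.encodeBlocks {l : List (List ℕ)} (h : ∀ b ∈ l, b ≠ [] ∧ SmallEntries n b) :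
    SmallEntries n (encodeBlocks l) := by
  have h1 : ∀ b ∈ l, b.length ≤ l.flatten.length := fun b hb =>
    (List.sublist_flatten_of_mem hb).length_le
  have h2 := length_le_of_occursAt (inp := MCNets.encodeBlocks l) (a := 0) (l := l.attach)
    (enc := fun b => b.1) ⟨[], [], by simp, rfl⟩ (fun b => (h b.1 b.2).1)
  intro t ht
  simp only [MCNets.encodeBlocks, List.length_cons, List.length_attach] at h2 ⊢
  rcases List.mem_cons.1 ht with rfl | ht
  · omega
  · obtain ⟨b, hb, htb⟩ := List.mem_flatten.1 ht
    have := (h b hb).2 t htb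
    have := h1 b hb
    omega

theorem SmallEntries.append {l l' : List ℕ} (h : SmallEntries n l) (h' : SmallEntries n l') :
    SmallEntries n (l ++ l') := by
  intro t ht
  rw [List.length_append]
  rcases List.mem_append.1 ht with ht | ht
  · have := h t ht
    omega
  · have := h' t ht
    omega

theorem encodeBlocks_ne_nil (l : List (List ℕ)) : encodeBlocks l ≠ [] := by
  simp [encodeBlocks]

theorem Conj.smallEntries_encode (α : Conj n) : SmallEntries n α.encode := by
  have : ∀ l : List (Fin n), SmallEntries n (encodeBlocks (l.map fun a => [a.val])) := by
    intro l
    refine SmallEntries.encodeBlocks fun b hb => ?_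
    obtain ⟨a, -, rfl⟩ := List.mem_map.1 hb
    refine ⟨by simp, fun t ht => ?_⟩
    rw [List.mem_singleton.1 ht]
    have := a.2
    omega
  exact (this _).append (this _)

theorem smallEntries_encode (Γ : List (WeightedRule n K)) :
    SmallEntries n (encodeBlocks (Γ.map fun γ => γ.encode)) := by
  refine SmallEntries.encodeBlocks fun b hb => ?_
  obtain ⟨γ, -, rfl⟩ := List.mem_map.1 hb
  refine ⟨encodeBlocks_ne_nil _, SmallEntries.encodeBlocks fun b hb => ?_⟩
  obtain ⟨G, -, rfl⟩ := List.mem_map.1 hb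
  refine ⟨encodeBlocks_ne_nil _, SmallEntries.encodeBlocks fun b hb => ?_⟩
  obtain ⟨r, -, rfl⟩ := List.mem_map.1 hb
  exact ⟨by simp [Conj.encode, encodeBlocks], r.expr.smallEntries_encode⟩

theorem length_encodeBlocks_le {α : Type} {l : List α} {enc : α → List ℕ} {m : α → ℕ} {c : ℕ}
    (h : ∀ x ∈ l, (enc x).length ≤ c * m x) :
    (encodeBlocks (l.map enc)).length ≤ c * (l.map m).sum + 1 := by
  rw [encodeBlocks, List.length_cons]
  refine Nat.succ_le_succ ?_
  induction l with
  | nil => simp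
  | cons x l ih =>
    have h1 := h x (by simp)
    have h2 := ih fun y hy => h y (by simp [hy])
    simp only [List.map_cons, List.flatten_cons, List.length_append, List.sum_cons, Nat.mul_add]
    omega

/-- For a nonempty list of items of measure at least one, the header is absorbed by raising the
factor by one. -/
theorem length_encodeBlocks_le' {α : Type} {l : List α} {enc : α → List ℕ} {m : α → ℕ} {c : ℕ}
    (hl : l ≠ []) (hm : ∀ x ∈ l, 1 ≤ m x) (h : ∀ x ∈ l, (enc x).length ≤ c * m x) :
    (encodeBlocks (l.map enc)).length ≤ (c + 1) * (l.map m).sum ∧ 1 ≤ (l.map m).sum := by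
  have h1 := length_encodeBlocks_le h
  have h2 : 1 ≤ (l.map m).sum := by
    obtain ⟨x, l, rfl⟩ := List.exists_cons_of_ne_nil hl
    have := hm x (by simp)
    simp only [List.map_cons, List.sum_cons]
    omega
  refine ⟨?_, h2⟩
  rw [Nat.add_mul]
  omega

theorem Conj.length_encode (α : Conj n) : α.encode.length = α.pos.length + α.neg.length + 2 := by
  rw [Conj.encode, List.length_append, length_encode_literals, length_encode_literals]
  omega

/-- A conjunction has two headers and at least one literal, hence the factor `3`; a group raises it
to `4` and a weighted rule to `5`. Only the outermost list may be empty, which leaves the summand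
`1`. -/
theorem length_encode_le (sz : K → ℕ) (Γ : List (WeightedRule n K)) :
    (encodeBlocks (Γ.map fun γ => γ.encode)).length ≤ 5 * size sz Γ + 1 := by
  refine length_encodeBlocks_le fun γ _ => ?_
  rw [List.map_flatten, List.sum_flatten, List.map_map]
  refine (length_encodeBlocks_le' (c := 4) (m := fun G => (G.map fun r =>
    r.expr.pos.length + r.expr.neg.length + sz r.weight).sum) γ.groups_ne_nil ?_ ?_).1
  all_goals
    intro G hG
    have hr : ∀ r ∈ G, 1 ≤ r.expr.pos.length := fun r _ =>
      List.length_pos_iff.2 r.expr.pos_ne_nil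
    have := length_encodeBlocks_le' (c := 3) (enc := fun r : MCRule n K => r.expr.encode)
      (m := fun r => r.expr.pos.length + r.expr.neg.length + sz r.weight)
      (γ.group_ne_nil G hG) (fun r hrG => by have := hr r hrG; omega)
      (fun r hrG => by
        have := hr r hrG
        rw [r.expr.length_encode]
        omega)
  · exact this.2
  · exact this.1

theorem size_eq (sz : K → ℕ) (Γ : List (WeightedRule n K)) :
    size sz Γ = ((allRules Γ).map fun x =>
      x.2.expr.pos.length + x.2.expr.neg.length + sz x.2.weight).sum :=
  (sum_map_allRules Γ fun x => x.2.expr.pos.length + x.2.expr.neg.length + sz x.2.weight).symm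

theorem sz_le_size (sz : K → ℕ) (Γ : List (WeightedRule n K)) {x : WeightedRule n K × MCRule n K}
    (hx : x ∈ allRules Γ) : sz x.2.weight ≤ size sz Γ := by
  rw [size_eq]
  refine le_trans ?_ (List.single_le_sum (by simp) _ (List.mem_map_of_mem hx))
  omega

theorem length_allRules_le (sz : K → ℕ) (Γ : List (WeightedRule n K)) :
    (allRules Γ).length ≤ size sz Γ := by
  rw [size_eq]
  refine (List.length_map (as := allRules Γ) _).symm.le.trans
    (List.length_le_sum_of_one_le _ fun t ht => ?_)
  obtain ⟨x, -, rfl⟩ := List.mem_map.1 ht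
  have := List.length_pos_iff.2 x.2.expr.pos_ne_nil
  omega

end Size

/-! ### The polynomial time bound. -/

section Polynomial

/-- The time bound of the program in terms of the size parameter. -/
def timeBound (X : ℕ) : ℕ := mqSteps X * stepCost (10 * (X + 10) ^ 3)

theorem exists_polynomial_timeBound : ∃ p : Polynomial ℕ, ∀ m, p.eval m = timeBound (m + 1) := by
  let X : Polynomial ℕ := Polynomial.X + 1
  let lit : Polynomial ℕ := 20 * X * (5 * X + 12) + 3
  let grp : Polynomial ℕ := 20 * X * (20 * X * (2 * lit + 4 + 2) + 3 + 2) + 4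
  let cnt : Polynomial ℕ := X * (X * 6 + 8) + 3 + (X * 4 + 3)
  let ev : Polynomial ℕ := 9 * X + 16 + grp + 2 * lit + cnt
  let walk : Polynomial ℕ → Polynomial ℕ := fun N =>
    20 * X * (20 * X * (20 * X * (N + 2) + 3 + 2) + 4 + 2) + 3
  refine ⟨((walk 2 + 6 * X + 8) + walk (2 * ev + 2) + 3) * (400000 * (10 * (X + 10) ^ 3 + 1)),
    fun m => ?_⟩
  simp only [X, lit, grp, cnt, ev, walk, timeBound, mqSteps, setupSteps, walkSteps, evalSteps,
    countSteps, groupSteps, litSteps, stepCost, Polynomial.eval_add, Polynomial.eval_mul,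
    Polynomial.eval_pow, Polynomial.eval_X, Polynomial.eval_one, Polynomial.eval_ofNat]

variable {K : Type} [Field K]

/-- What remains is to fit the input into an `Env` and to bound its initial configuration: entries
of the code are at most the number of players plus the length of the code, and the height of each
weight is at most its share of the size. -/
theorem computesMQ_mqProgram (M : CostModel K) {n : ℕ} (Γ : List (WeightedRule n K)) (i : Fin n) :
    ComputesMQ M.sz mqProgram Γ i (timeBound (n + size M.sz Γ + 1)) := by
  have hlen := length_encode_le M.sz Γ
  have hpos : 1 ≤ (encodeBlocks (Γ.map fun γ => γ.encode)).length := by simp [encodeBlocks]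
  let E : Env :=
    { n := n
      i := i
      inp := n :: i.val :: encodeBlocks (Γ.map fun γ => γ.encode)
      X := n + size M.sz Γ + 1
      W := 10 * (n + size M.sz Γ + 1 + 10) ^ 3
      inp_zero := rfl
      inp_one := rfl
      length_pos := by simp only [List.length_cons]; omega
      i_lt := i.2
      n_lt := by omega
      length_le := by simp only [List.length_cons]; omega
      le_W := le_rfl }
  have hX : E.X = n + size M.sz Γ + 1 := rfl
  have hnum : ∀ k, (inputState Γ i).num (k + 1) = (weights Γ).getD k 0 := fun k => by
    simp [inputState]
  have hht : ∀ x ∈ allRules Γ, M.ht x.2.weight ≤ E.X := fun x hx => by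
    have h1 := M.ht_le x.2.weight
    have h2 := sz_le_size M.sz Γ hx
    omega
  have h0 : M.ht (0 : K) ≤ E.X := by
    have := M.ht_nat 0
    simp only [Nat.cast_zero, Nat.size_zero] at this
    omega
  have hXW : E.X ≤ E.W := by have := E.linear_le; omega
  have hbdd : Bounded M E.W (inputState Γ i) := by
    refine ⟨fun r => E.bool_small false, fun a => ?_, fun a => ?_⟩
    · refine E.small ?_
      show (n :: i.val :: encodeBlocks (Γ.map fun γ => γ.encode)).getD a 0 ≤ _
      rcases a with _ | _ | a
      · simp only [List.getD_cons_zero]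
        omega
      · simp only [List.getD_cons_succ, List.getD_cons_zero]
        have := i.2
        omega
      · simp only [List.getD_cons_succ]
        rw [List.getD_eq_getElem?_getD]
        rcases h : (encodeBlocks (Γ.map fun γ => γ.encode))[a]? with _ | t
        · rw [h]
          exact Nat.zero_le _
        · have := smallEntries_encode Γ t (List.mem_of_getElem? h)
          rw [h, Option.getD_some]
          omega
    · rcases a with _ | a
      · exact h0.trans hXW
      · rw [hnum, weights_eq, List.getD_eq_getElem?_getD]
        rcases h : ((allRules Γ).map fun x => x.2.weight)[a]? with _ | t
        · rw [h]
          exact h0.trans hXW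
        · rw [h]
          obtain ⟨x, hx, rfl⟩ := List.mem_map.1 (List.mem_of_getElem? h)
          exact (hht x hx).trans hXW
  obtain ⟨s', t, h1, h2, -, h3⟩ := runs_mqProgram (M := M) (E := E) (Γ := Γ) (s := inputState Γ i)
    (fun _ _ => rfl) ⟨[n, i.val], [], by simp [E], rfl⟩ (by simp [E]; omega) rfl hnum
    (by have := length_allRules_le M.sz Γ; omega) hht hbdd
  exact ⟨s', t, h1, h3, h2⟩

end Polynomial

end MCNets

/-- One program computes the MQ-value from weighted MC-nets in polynomial time, both for real
weights with field operations at unit cost, and for rational weights with bit costs throughout. -/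
theorem mainTheorem1 :
    ∃ (c : MCNets.Program) (p : Polynomial ℕ),
      (∀ (n : ℕ) (Γ : List (MCNets.WeightedRule n ℝ)) (i : Fin n),
        MCNets.ComputesMQ (fun _ => 1) c Γ i
          (p.eval (n + MCNets.size (fun _ => 1) Γ))) ∧
      (∀ (n : ℕ) (Γ : List (MCNets.WeightedRule n ℚ)) (i : Fin n),
        MCNets.ComputesMQ MCNets.ratBits c Γ i
          (p.eval (n + MCNets.size MCNets.ratBits Γ))) := by
  obtain ⟨p, hp⟩ := MCNets.exists_polynomial_timeBound
  refine ⟨MCNets.mqProgram, p, fun n Γ i => ?_, fun n Γ i => ?_⟩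
  · rw [hp]
    exact MCNets.computesMQ_mqProgram (MCNets.CostModel.unit ℝ) Γ i
  · rw [hp]
    exact MCNets.computesMQ_mqProgram MCNets.CostModel.rat Γ i
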